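/- Theorem 1.2. Let $n\ge 0$ and $[n]=\{1,\dots,n\}$. Let $\mathrm{Sym}$ be the $\mathbb{C}$-algebra of symmetric functions, with complete homogeneous functions $h_k$, elementary functions $e_k$ and power sums $p_k$. Put $P_k=\frac12\sum_{i=0}^k h_ie_{k-i}$, let $\mathtt{sh}:\mathrm{Sym}\to\mathrm{Sym}$ be the algebra homomorphism with $\mathtt{sh}(h_k)=2P_k$ for all $k\ge1$, and for a partition $\lambda$ put $h_\lambda=\prod_i h_{\lambda_i}$ and $V_\lambda=\prod_i P_{\lambda_i}$ (products over the positive parts). A parking function of size $n$ is a tuple $p=(p_1,\dots,p_n)$ of positive integers whose weakly increasing rearrangement $\mathtt{sort}(p)$ has $i$th entry at most $i$ for every $i$. Let $\alpha_k(p)=\#\{i: p_i=k\}$, and let $\mathrm{shape}(p)\vdash n$ be the partition formed by the nonzero $\alpha_k(p)$, $k\in[n]$. Put $PF_n=\sum_{p} h_{\mathrm{shape}(p)}$, the sum over the weakly increasing parking functions $p$ of size $n$, and $SH_n=\mathtt{sh}(PF_n)$. For $\sigma\in\{-1,1\}^n$ let $\overline\sigma_k=\prod_{i:\,p_i=k}\sigma_i$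 if $\alpha_k(p)>0$ and $\overline\sigma_k=0$ otherwise. An odd shifted parking function of size $n$ is a triple $(p,\sigma,\tau)$ where $p$ is a parking function of size $n$ all of whose shape's parts are odd, $\sigma\in\{-1,1\}^n$, and $\tau$ is a noncrossing partial matching of the integers appearing in $p$ (arcs written $(a,b)$ with $a<b$) such that: (1) if $(a,b)\in\tau$ then $\overline\sigma_a=-\overline\sigma_b$; (2) if $(a,c)\in\tau$ and $a<b<c$ then $b$ appears in $p$; (3) if $(a,d),(b,c)\in\tau$ and $a<b<c<d$ then $\overline\sigma_a=\overline\sigma_b$. Let $\mathrm{OShPf}(n)$ be the set of these triples. The sorted odd shifted parking functions of size $n$ are the triples $(\mathtt{sort}(p),\overline\sigma,\tau)$ with $(p,\sigma,\tau)\in\mathrm{OShPf}(n)$. Let $\mathfrak S_n$ act linearly on $\mathbb{C}[\mathrm{OShPf}(n)]$ by permuting positions in $p$ and $\sigma$ and fixing $\tau$, where $\sigma$ is identified with the basis element $v_{i_1}\wedge\dots\wedge v_{i_k}$ of $\bigwedge(\mathbb{C}^n)$, $\{i_1<\dots<i_k\}=\{i:\sigma_i=-1\}$; that is, $$\pi\cdot(p,\sigma,\tau)=(-1)^{\#\{i<j\,:\,\sigma_i=\sigma_j=-1,\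 \pi(i)>\pi(j)\}}\,(p\circ\pi^{-1},\sigma\circ\pi^{-1},\tau).$$ Then the Frobenius character of $\mathbb{C}[\mathrm{OShPf}(n)]$, i.e. the image of its character $\chi$ under $\chi\mapsto\frac1{n!}\sum_{\pi\in\mathfrak S_n}\chi(\pi)\,p_{\mathrm{type}(\pi)}=\sum_{\lambda\vdash n}z_\lambda^{-1}\chi(\pi_\lambda)p_\lambda$ (where $p_\lambda=\prod_i p_{\lambda_i}$, $\mathrm{type}(\pi)$ is the cycle type of $\pi$, $\pi_\lambda$ is a permutation of cycle type $\lambda$, and $z_\lambda$ is the order of its centralizer), is $SH_n$. Moreover, $$SH_n=\sum_{(p,\overline\sigma,\tau)\ \text{sorted}}V_{\mathrm{shape}(p)},$$ the sum over all sorted odd shifted parking functions of size $n$, and every shape occurring in this sum has only odd parts. -/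

import Mathlib

open scoped BigOperators

namespace ShiftedParking

noncomputable section

/-! ### The algebra of symmetric functions -/

/-- The algebra `Sym` of symmetric functions over `ℂ` in the variables `x₀, x₁, …`: formal power
series of bounded degree that are invariant under all permutations of the variables. -/
def SymFun : Subalgebra ℂ (MvPowerSeries ℕ ℂ) where
  carrier := {f | (∀ σ : Equiv.Perm ℕ, MvPowerSeries.renameEquiv ℂ σ f = f) ∧
    ∃ d : ℕ, ∀ m : ℕ →₀ ℕ, MvPowerSeries.coeff m f ≠ 0 → m.degree ≤ d}
  mul_mem' := by
    rintro f g ⟨hf, d, hd⟩ ⟨hg, d', hd'⟩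
    refine ⟨fun σ => by rw [map_mul, hf, hg], d + d', fun m hm => ?_⟩
    classical
    rw [MvPowerSeries.coeff_mul] at hm
    obtain ⟨x, hx, hne⟩ := Finset.exists_ne_zero_of_sum_ne_zero hm
    rw [← Finset.HasAntidiagonal.mem_antidiagonal.1 hx, map_add]
    exact add_le_add (hd _ (left_ne_zero_of_mul hne)) (hd' _ (right_ne_zero_of_mul hne))
  add_mem' := by
    rintro f g ⟨hf, d, hd⟩ ⟨hg, d', hd'⟩
    refine ⟨fun σ => by rw [map_add, hf, hg], max d d', fun m hm => ?_⟩
    rw [map_add] at hm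
    by_cases h : MvPowerSeries.coeff m f = 0
    · rw [h, zero_add] at hm
      exact (hd' _ hm).trans (le_max_right _ _)
    · exact (hd _ h).trans (le_max_left _ _)
  algebraMap_mem' := by
    intro r
    refine ⟨fun σ => AlgEquiv.commutes _ r, 0, fun m hm => ?_⟩
    classical
    rw [MvPowerSeries.algebraMap_apply, MvPowerSeries.coeff_C] at hm
    have : m = 0 := by
      by_contra h
      simp [h] at hm
    simp [this]

theorem coeff_renameEquiv (σ : Equiv.Perm ℕ) (f : MvPowerSeries ℕ ℂ) (m : ℕ →₀ ℕ) :
    MvPowerSeries.coeff (m.embDomain σ.toEmbedding) (MvPowerSeries.renameEquiv ℂ σ f) =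
      MvPowerSeries.coeff m f :=
  MvPowerSeries.coeff_embDomain_rename σ.toEmbedding f m

theorem degree_embDomain {α β : Type*} (e : α ↪ β) (m : α →₀ ℕ) :
    (m.embDomain e).degree = m.degree := by
  rw [Finsupp.embDomain_eq_mapDomain, Finsupp.degree_mapDomain]

/-- A criterion for membership in `SymFun` for a series whose coefficients are invariant. -/
theorem mem_symFun_of_coeff {f : MvPowerSeries ℕ ℂ} {d : ℕ}
    (hs : ∀ (σ : Equiv.Perm ℕ) (m : ℕ →₀ ℕ),
      MvPowerSeries.coeff (m.embDomain σ.toEmbedding) f = MvPowerSeries.coeff m f)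
    (hd : ∀ m : ℕ →₀ ℕ, MvPowerSeries.coeff m f ≠ 0 → m.degree ≤ d) : f ∈ SymFun := by
  refine ⟨fun σ => ?_, d, hd⟩
  ext m
  obtain ⟨m', rfl⟩ : ∃ m' : ℕ →₀ ℕ, m'.embDomain σ.toEmbedding = m := by
    refine ⟨m.embDomain σ.symm.toEmbedding, ?_⟩
    ext i
    obtain ⟨j, rfl⟩ := σ.surjective i
    obtain ⟨k, rfl⟩ := σ.symm.surjective j
    have h1 := Finsupp.embDomain_apply_self σ.toEmbedding
      (m.embDomain σ.symm.toEmbedding) (σ.symm k)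
    have h2 := Finsupp.embDomain_apply_self σ.symm.toEmbedding m k
    simp only [Equiv.coe_toEmbedding] at h1 h2
    rw [h1, h2, Equiv.apply_symm_apply]
  rw [coeff_renameEquiv, hs]

theorem coeff_embDomain_of_mem {f : MvPowerSeries ℕ ℂ} (hf : f ∈ SymFun) (σ : Equiv.Perm ℕ)
    (m : ℕ →₀ ℕ) :
    MvPowerSeries.coeff (m.embDomain σ.toEmbedding) f = MvPowerSeries.coeff m f := by
  conv_lhs => rw [← hf.1 σ]
  exact coeff_renameEquiv σ f m

/-- The complete homogeneous symmetric function `h_k`: the sum of all monomials of degree `k`. -/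
def h (k : ℕ) : SymFun :=
  ⟨fun m => if m.degree = k then 1 else 0, mem_symFun_of_coeff (d := k)
    (fun σ m => by
      change (if _ = k then (1 : ℂ) else 0) = if _ = k then 1 else 0
      rw [degree_embDomain])
    (fun m hm => by
      change (if m.degree = k then (1 : ℂ) else 0) ≠ 0 at hm
      by_contra hk
      exact hm (if_neg fun h => hk h.le))⟩

theorem forall_embDomain_le_one (σ : Equiv.Perm ℕ) (m : ℕ →₀ ℕ) :
    (∀ i, m.embDomain σ.toEmbedding i ≤ 1) ↔ ∀ i, m i ≤ 1 := by
  rw [σ.surjective.forall]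
  exact forall_congr' fun i => by
    rw [← Equiv.coe_toEmbedding, Finsupp.embDomain_apply_self]

open Classical in
/-- The elementary symmetric function `e_k`: the sum of all squarefree monomials of degree `k`. -/
def e (k : ℕ) : SymFun :=
  ⟨fun m => if m.degree = k ∧ ∀ i, m i ≤ 1 then 1 else 0, mem_symFun_of_coeff (d := k)
    (fun σ m => by
      change (if _ = k ∧ (∀ i, _) then (1 : ℂ) else 0) = if _ = k ∧ (∀ i, _) then 1 else 0
      simp only [degree_embDomain, forall_embDomain_le_one])
    (fun m hm => by
      change (if m.degree = k ∧ ∀ i, m i ≤ 1 then (1 : ℂ) else 0) ≠ 0 at hm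
      by_contra hk
      exact hm (if_neg fun h => hk h.1.le))⟩

open Classical in
/-- The power sum `p_k = ∑ᵢ xᵢ ^ k` (used only for `k ≥ 1`). -/
def powerSum (k : ℕ) : SymFun :=
  ⟨fun m => if ∃ i, m = Finsupp.single i k then 1 else 0, mem_symFun_of_coeff (d := k)
    (fun σ m => by
      change (if (∃ i, _) then (1 : ℂ) else 0) = if (∃ i, _) then 1 else 0
      congr 1
      rw [eq_iff_iff, σ.surjective.exists]
      refine exists_congr fun i => ?_
      rw [← Equiv.coe_toEmbedding, ← Finsupp.embDomain_single]
      exact (Finsupp.embDomain_injective σ.toEmbedding).eq_iff)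
    (fun m hm => by
      change (if ∃ i, m = Finsupp.single i k then (1 : ℂ) else 0) ≠ 0 at hm
      by_contra hk
      refine hm (if_neg ?_)
      rintro ⟨i, rfl⟩
      exact hk (by rw [Finsupp.degree_single]))⟩

/-- `P_k = (1/2) ∑_{i=0}^k h_i e_{k-i}`. -/
def P (k : ℕ) : SymFun := (1 / 2 : ℂ) • ∑ i ∈ Finset.range (k + 1), h i * e (k - i)

theorem coeff_h (k : ℕ) (m : ℕ →₀ ℕ) :
    MvPowerSeries.coeff m (h k : MvPowerSeries ℕ ℂ) = if m.degree = k then 1 else 0 := rfl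

open Classical in
theorem coeff_e (k : ℕ) (m : ℕ →₀ ℕ) :
    MvPowerSeries.coeff m (e k : MvPowerSeries ℕ ℂ) =
      if m.degree = k ∧ ∀ i, m i ≤ 1 then 1 else 0 := rfl

theorem h_zero : h 0 = 1 := by
  ext m
  rw [coeff_h, OneMemClass.coe_one]
  classical
  rw [MvPowerSeries.coeff_one]
  simp only [Finsupp.degree_eq_zero_iff]

theorem e_zero : e 0 = 1 := by
  ext m
  rw [coeff_e, OneMemClass.coe_one]
  classical
  rw [MvPowerSeries.coeff_one]
  congr 1
  rw [eq_iff_iff, Finsupp.degree_eq_zero_iff]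
  exact ⟨fun h => h.1, fun h => ⟨h, by simp [h]⟩⟩

/-! ### Shiftification is well defined: `Sym` is freely generated by the `h_k` -/

/-- `ℂ[y₀, y₁, …] → Sym`, `y_i ↦ e_{i+1}`. -/
def eHom : MvPolynomial ℕ ℂ →ₐ[ℂ] SymFun := MvPolynomial.aeval fun i => e (i + 1)

theorem killCompl_e (n k : ℕ) :
    MvPowerSeries.killCompl (Fin.valEmbedding (n := n)) (e k : MvPowerSeries ℕ ℂ) =
      (MvPolynomial.esymm (Fin n) ℂ k : MvPowerSeries (Fin n) ℂ) := by
  classical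
  ext m
  rw [MvPowerSeries.coeff_killCompl, coeff_e, degree_embDomain, MvPolynomial.coeff_coe,
    MvPolynomial.esymm_eq_sum_monomial, MvPolynomial.coeff_sum]
  simp only [MvPolynomial.coeff_monomial]
  have key : ∀ t : Finset (Fin n), (∑ i ∈ t, Finsupp.single i 1 : Fin n →₀ ℕ) = m ↔
      (t = m.support ∧ ∀ i, m i ≤ 1) := by
    intro t
    have hval : ∀ i, (∑ i ∈ t, Finsupp.single i 1 : Fin n →₀ ℕ) i = if i ∈ t then 1 else 0 := by
      intro i
      rw [Finsupp.finsetSum_apply]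
      simp [Finsupp.single_apply]
    constructor
    · rintro rfl
      refine ⟨?_, fun i => by rw [hval]; split_ifs <;> simp⟩
      ext i
      rw [Finsupp.mem_support_iff, hval]
      simp
    · rintro ⟨rfl, h1⟩
      ext i
      rw [hval]
      have := h1 i
      by_cases h0 : m i = 0
      · simp [h0]
      · simp [h0]; omega
  have hall : (∀ i, m.embDomain (Fin.valEmbedding (n := n)) i ≤ 1) ↔ ∀ i, m i ≤ 1 := by
    constructor
    · intro h i
      have := h (Fin.valEmbedding i)
      rwa [Finsupp.embDomain_apply_self] at this
    · intro h i
      by_cases hi : i ∈ Set.range (Fin.valEmbedding (n := n))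
      · obtain ⟨j, rfl⟩ := hi
        rw [Finsupp.embDomain_apply_self]
        exact h j
      · rw [Finsupp.embDomain_of_notMem_range _ _ _ hi]
        exact Nat.zero_le _
  simp only [key, hall]
  by_cases h1 : ∀ i, m i ≤ 1
  · have hdeg : m.degree = m.support.card := by
      rw [Finsupp.degree_apply, Finset.card_eq_sum_ones]
      refine Finset.sum_congr rfl fun i hi => ?_
      have := h1 i
      have := Finsupp.mem_support_iff.1 hi
      omega
    simp only [h1, implies_true, and_true]
    rw [Finset.sum_ite_eq', hdeg]
    simp [Finset.mem_powersetCard]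
  · simp [h1]

theorem killCompl_eHom_rename (n : ℕ) (q : MvPolynomial (Fin n) ℂ) :
    MvPowerSeries.killCompl (Fin.valEmbedding (n := n))
      (eHom (MvPolynomial.rename Fin.val q) : MvPowerSeries ℕ ℂ) =
      ((MvPolynomial.esymmAlgHom (Fin n) ℂ n q : MvPolynomial (Fin n) ℂ) :
        MvPowerSeries (Fin n) ℂ) := by
  induction q using MvPolynomial.induction_on with
  | C a => 
    rw [MvPolynomial.rename_C, ← MvPolynomial.algebraMap_eq, ← MvPolynomial.algebraMap_eq,
      AlgHom.commutes, AlgHom.commutes, Subalgebra.coe_algebraMap, Subalgebra.coe_algebraMap,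
      AlgHom.commutes, MvPolynomial.algebraMap_eq, MvPolynomial.coe_C]
    rfl
  | add p q hp hq =>
    simp only [map_add, Subalgebra.coe_add, hp, hq, MvPolynomial.coe_add]
  | mul_X p i hp =>
    simp only [map_mul, Subalgebra.coe_mul, hp, MvPolynomial.coe_mul, MvPolynomial.rename_X]
    congr 1
    rw [eHom, MvPolynomial.aeval_X, killCompl_e, MvPolynomial.esymmAlgHom, MvPolynomial.aeval_X]

theorem eHom_injective : Function.Injective eHom := by
  rw [injective_iff_map_eq_zero]
  intro p hp
  obtain ⟨q, hq⟩ := MvPolynomial.exists_rename_eq_of_vars_subset_range p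
    (Fin.val : Fin (p.vars.sup id + 1) → ℕ) Fin.val_injective (by
      intro i hi
      exact ⟨⟨i, Nat.lt_succ_of_le (Finset.le_sup (f := id) hi)⟩, rfl⟩)
  have h1 := killCompl_eHom_rename _ q
  rw [hq, hp, ZeroMemClass.coe_zero, map_zero] at h1
  have h2 : ((MvPolynomial.esymmAlgHom (Fin (p.vars.sup id + 1)) ℂ (p.vars.sup id + 1) q :
      MvPolynomial.symmetricSubalgebra (Fin (p.vars.sup id + 1)) ℂ) :
      MvPolynomial (Fin (p.vars.sup id + 1)) ℂ) = 0 :=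
    MvPolynomial.coe_injective (Fin _) ℂ (by rw [← h1, MvPolynomial.coe_zero])
  have h3 := MvPolynomial.esymmAlgHom_injective ℂ (le_of_eq (Fintype.card_fin _).symm)
    ((ZeroMemClass.coe_eq_zero.1 h2).trans (map_zero _).symm)
  rw [← hq, h3, map_zero]

theorem isHomogeneous_e (k : ℕ) : (e k : MvPowerSeries ℕ ℂ).IsHomogeneous k := by
  classical
  intro m hm
  by_contra hk
  rw [coeff_e] at hm
  refine hm (if_neg fun h => hk ?_)
  rw [← h.1, Finsupp.degree_eq_weight_one]
  rfl

theorem eHom_monomial_isHomogeneous (s : ℕ →₀ ℕ) :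
    ∃ w, (eHom (MvPolynomial.monomial s 1) : MvPowerSeries ℕ ℂ).IsHomogeneous w := by
  induction s using Finsupp.induction_linear with
  | zero =>
    refine ⟨0, ?_⟩
    have : MvPolynomial.monomial (0 : ℕ →₀ ℕ) (1 : ℂ) = 1 := rfl
    rw [this, map_one, ← e_zero]
    exact @isHomogeneous_e 0
  | add f g hf hg =>
    obtain ⟨a, ha⟩ := hf
    obtain ⟨b, hb⟩ := hg
    refine ⟨a + b, ?_⟩
    have : MvPolynomial.monomial (f + g) (1 : ℂ) =
        MvPolynomial.monomial f 1 * MvPolynomial.monomial g 1 := by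
      rw [MvPolynomial.monomial_mul, one_mul]
    rw [this, map_mul, Subalgebra.coe_mul]
    exact fun {_} hm => MvPowerSeries.IsHomogeneous.mul ha hb hm
  | single i k =>
    have : MvPolynomial.monomial (Finsupp.single i k) (1 : ℂ) = MvPolynomial.X i ^ k :=
      MvPolynomial.X_pow_eq_monomial.symm
    rw [this, map_pow, eHom, MvPolynomial.aeval_X]
    induction k with
    | zero =>
      refine ⟨0, ?_⟩
      rw [pow_zero, ← e_zero]
      exact @isHomogeneous_e 0
    | succ k ih =>
      obtain ⟨w, hw⟩ := ih MvPolynomial.X_pow_eq_monomial.symm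
      refine ⟨w + (i + 1), ?_⟩
      rw [pow_succ, Subalgebra.coe_mul]
      exact fun {_} hm => MvPowerSeries.IsHomogeneous.mul hw (isHomogeneous_e _) hm

theorem exists_eHom_trunc (d : ℕ) (p : MvPolynomial ℕ ℂ) : ∃ p' : MvPolynomial ℕ ℂ,
    ∀ m : ℕ →₀ ℕ, MvPowerSeries.coeff m (eHom p' : MvPowerSeries ℕ ℂ) =
      if m.degree ≤ d then MvPowerSeries.coeff m (eHom p : MvPowerSeries ℕ ℂ) else 0 := by
  induction p using MvPolynomial.induction_on' with
  | monomial s a =>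
    obtain ⟨w, hw⟩ := eHom_monomial_isHomogeneous s
    have hs : eHom (MvPolynomial.monomial s a) = a • eHom (MvPolynomial.monomial s 1) := by
      rw [← map_smul, MvPolynomial.smul_monomial, smul_eq_mul, mul_one]
    by_cases hwd : w ≤ d
    · refine ⟨MvPolynomial.monomial s a, fun m => ?_⟩
      split_ifs with hm
      · rfl
      · rw [hs, Subalgebra.coe_smul, MvPowerSeries.coeff_smul,
          hw.coeff_eq_zero (fun h => hm (h ▸ hwd)), mul_zero]
    · refine ⟨0, fun m => ?_⟩
      rw [map_zero, ZeroMemClass.coe_zero, map_zero]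
      split_ifs with hm
      · rw [hs, Subalgebra.coe_smul, MvPowerSeries.coeff_smul,
          hw.coeff_eq_zero (fun h => hwd (h ▸ hm)), mul_zero]
      · rfl
  | add p q hp hq =>
    obtain ⟨p', hp'⟩ := hp
    obtain ⟨q', hq'⟩ := hq
    refine ⟨p' + q', fun m => ?_⟩
    rw [map_add, map_add, Subalgebra.coe_add, Subalgebra.coe_add, map_add, map_add, hp', hq']
    split_ifs <;> simp

/-- A monomial of degree at most `d` can be moved into the first `d` variables. -/
theorem exists_perm_embDomain (d : ℕ) (m : ℕ →₀ ℕ) (hm : m.degree ≤ d) :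
    ∃ (σ : Equiv.Perm ℕ) (m' : Fin d →₀ ℕ),
      m.embDomain σ.toEmbedding = m'.embDomain Fin.valEmbedding := by
  classical
  have hcard : m.support.card ≤ d := by
    refine le_trans ?_ hm
    rw [Finsupp.degree_apply, Finset.card_eq_sum_ones]
    exact Finset.sum_le_sum fun i hi => Nat.one_le_iff_ne_zero.2 (Finsupp.mem_support_iff.1 hi)
  obtain ⟨σ, hσ⟩ : ∃ σ : Equiv.Perm ℕ, ∀ i ∈ m.support, σ i < d := by
    obtain ⟨f, hf⟩ := Equiv.Perm.exists_extending_pair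
      (fun i : Fin m.support.card => (m.support.equivFin.symm i : ℕ))
      (fun i : Fin m.support.card => (i : ℕ))
      (fun a b hab => m.support.equivFin.symm.injective (Subtype.ext hab)) Fin.val_injective
    refine ⟨f, fun i hi => ?_⟩
    have := hf (m.support.equivFin ⟨i, hi⟩)
    simp only [Equiv.symm_apply_apply] at this
    rw [this]
    exact (Fin.is_lt _).trans_le hcard
  refine ⟨σ, (m.embDomain σ.toEmbedding).comapDomain Fin.val Fin.val_injective.injOn, ?_⟩
  ext i
  by_cases hi : i < d
  · have := Finsupp.embDomain_apply_self (Fin.valEmbedding (n := d))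
      ((m.embDomain σ.toEmbedding).comapDomain Fin.val Fin.val_injective.injOn) ⟨i, hi⟩
    rw [Finsupp.comapDomain_apply] at this
    exact this.symm
  · rw [Finsupp.embDomain_of_notMem_range (Fin.valEmbedding (n := d)) _ i (by
      rintro ⟨j, hj⟩
      exact hi (hj ▸ j.2))]
    obtain ⟨j, rfl⟩ := σ.surjective i
    have := Finsupp.embDomain_apply_self σ.toEmbedding m j
    rw [Equiv.coe_toEmbedding] at this
    rw [this]
    by_contra hne
    exact hi (hσ j (Finsupp.mem_support_iff.2 hne))

theorem ext_of_killCompl {f g : SymFun} {d : ℕ}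
    (hf : ∀ m : ℕ →₀ ℕ, MvPowerSeries.coeff m (f : MvPowerSeries ℕ ℂ) ≠ 0 → m.degree ≤ d)
    (hg : ∀ m : ℕ →₀ ℕ, MvPowerSeries.coeff m (g : MvPowerSeries ℕ ℂ) ≠ 0 → m.degree ≤ d)
    (h : ∀ m' : Fin d →₀ ℕ, m'.degree ≤ d →
      MvPowerSeries.coeff (m'.embDomain Fin.valEmbedding) (f : MvPowerSeries ℕ ℂ) =
      MvPowerSeries.coeff (m'.embDomain Fin.valEmbedding) (g : MvPowerSeries ℕ ℂ)) : f = g := by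
  ext m
  by_cases hm : m.degree ≤ d
  · obtain ⟨σ, m', hm'⟩ := exists_perm_embDomain d m hm
    rw [← coeff_embDomain_of_mem f.2 σ, ← coeff_embDomain_of_mem g.2 σ, hm']
    refine h m' ?_
    rw [← degree_embDomain Fin.valEmbedding, ← hm', degree_embDomain]
    exact hm
  · rw [not_imp_comm.1 (hf m) hm, not_imp_comm.1 (hg m) hm]

theorem eHom_surjective : Function.Surjective eHom := by
  classical
  intro f
  obtain ⟨d, hd⟩ := f.2.2
  -- the restriction of `f` to the first `d` variables is a symmetric polynomial
  let F : MvPolynomial (Fin d) ℂ := MvPowerSeries.truncTotal (d + 1)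
    (MvPowerSeries.killCompl (Fin.valEmbedding (n := d)) (f : MvPowerSeries ℕ ℂ))
  have hF : ∀ m' : Fin d →₀ ℕ, MvPolynomial.coeff m' F =
      MvPowerSeries.coeff (m'.embDomain Fin.valEmbedding) (f : MvPowerSeries ℕ ℂ) := by
    intro m'
    by_cases hm : m'.degree < d + 1
    · rw [MvPowerSeries.coeff_truncTotal _ hm, MvPowerSeries.coeff_killCompl]
    · rw [MvPowerSeries.coeff_truncTotal_eq_zero _ (not_lt.1 hm)]
      symm
      by_contra hne
      have := hd _ hne
      rw [degree_embDomain] at this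
      omega
  have hsymm : F.IsSymmetric := by
    intro τ
    ext m'
    obtain ⟨m'', rfl⟩ : ∃ m'' : Fin d →₀ ℕ, m''.mapDomain τ = m' :=
      ⟨m'.mapDomain τ.symm, by
        rw [← Finsupp.mapDomain_comp, Equiv.self_comp_symm, Finsupp.mapDomain_id]⟩
    rw [MvPolynomial.coeff_rename_mapDomain _ τ.injective, hF, hF]
    obtain ⟨σ, hσ⟩ := Equiv.Perm.exists_extending_pair
      (fun i : Fin d => (i : ℕ)) (fun i : Fin d => (τ i : ℕ)) Fin.val_injective
      (Fin.val_injective.comp τ.injective)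
    rw [← coeff_embDomain_of_mem f.2 σ]
    congr 1
    simp only [Finsupp.embDomain_eq_mapDomain, ← Finsupp.mapDomain_comp]
    congr 2
    funext i
    exact hσ i
  obtain ⟨q, hq⟩ := MvPolynomial.esymmAlgHom_surjective ℂ (le_of_eq (Fintype.card_fin d))
    ⟨F, hsymm⟩
  obtain ⟨p', hp'⟩ := exists_eHom_trunc d (MvPolynomial.rename Fin.val q)
  refine ⟨p', ext_of_killCompl (d := d) (fun m hm => ?_) hd fun m' hm' => ?_⟩
  · by_contra hdeg
    rw [hp', if_neg hdeg] at hm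
    exact hm rfl
  · rw [hp', degree_embDomain, if_pos hm', ← MvPowerSeries.coeff_killCompl,
      killCompl_eHom_rename, hq, MvPolynomial.coeff_coe, hF]

/-- The relation `∑ (-1)^a e_a h_b = 0` as `E(-t) H(t) = 1`. -/
theorem rescale_e_mul_h :
    PowerSeries.rescale (-1 : SymFun) (PowerSeries.mk e) * PowerSeries.mk h = 1 := by
  classical
  ext n m
  rw [PowerSeries.coeff_mul, PowerSeries.coeff_one]
  simp only [PowerSeries.coeff_rescale, PowerSeries.coeff_mk]
  have hterm : ∀ x : ℕ × ℕ, MvPowerSeries.coeff m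
      (((-1 : SymFun) ^ x.1 * e x.1 * h x.2 : SymFun) : MvPowerSeries ℕ ℂ) =
      ∑ y ∈ Finset.HasAntidiagonal.antidiagonal m, if (y.1.degree = x.1 ∧ y.2.degree = x.2) ∧ ∀ i, y.1 i ≤ 1
        then (-1 : ℂ) ^ y.1.degree else 0 := by
    intro x
    have : ((-1 : SymFun) ^ x.1 * e x.1 * h x.2) = ((-1 : ℂ) ^ x.1) • (e x.1 * h x.2) := by
      rw [Algebra.smul_def, map_pow, map_neg, map_one, mul_assoc]
    rw [this, Subalgebra.coe_smul, MvPowerSeries.coeff_smul, Subalgebra.coe_mul,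
      MvPowerSeries.coeff_mul, Finset.mul_sum]
    refine Finset.sum_congr rfl fun y _ => ?_
    rw [coeff_e, coeff_h]
    by_cases h1 : y.1.degree = x.1 <;> by_cases h2 : y.2.degree = x.2 <;>
      by_cases h3 : ∀ i, y.1 i ≤ 1 <;> simp [h1, h2, h3]
  rw [AddSubmonoidClass.coe_finsetSum, map_sum]
  simp only [hterm]
  rw [Finset.sum_comm]
  have hinner : ∀ y ∈ Finset.HasAntidiagonal.antidiagonal m,
      (∑ x ∈ Finset.HasAntidiagonal.antidiagonal n,
        if (y.1.degree = x.1 ∧ y.2.degree = x.2) ∧ ∀ i, y.1 i ≤ 1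
          then (-1 : ℂ) ^ y.1.degree else 0) =
      if m.degree = n then (if ∀ i, y.1 i ≤ 1 then (-1 : ℂ) ^ y.1.degree else 0) else 0 := by
    intro y hy
    have hdeg : y.1.degree + y.2.degree = m.degree := by
      rw [← map_add, Finset.HasAntidiagonal.mem_antidiagonal.1 hy]
    split_ifs with h1 h2
    · rw [Finset.sum_eq_single (y.1.degree, y.2.degree)]
      · simp [h2]
      · intro x _ hx
        refine if_neg fun hh => hx ?_
        exact Prod.ext hh.1.1.symm hh.1.2.symm
      · intro hx
        exact absurd (Finset.HasAntidiagonal.mem_antidiagonal.2 (hdeg.trans h1)) hx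
    · simp [h2]
    · refine Finset.sum_eq_zero fun x hx => if_neg fun hh => h1 ?_
      rw [← hdeg, hh.1.1, hh.1.2]
      exact Finset.HasAntidiagonal.mem_antidiagonal.1 hx
  rw [Finset.sum_congr rfl hinner]
  have hmain : (∑ y ∈ Finset.HasAntidiagonal.antidiagonal m,
      if ∀ i, y.1 i ≤ 1 then (-1 : ℂ) ^ y.1.degree else 0) = if m = 0 then 1 else 0 := by
    have hpow := Finset.sum_powerset_neg_one_pow_card (x := m.support)
    have hpow' : (∑ S ∈ m.support.powerset, (-1 : ℂ) ^ S.card) = if m = 0 then 1 else 0 := by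
      have := congrArg (Int.cast : ℤ → ℂ) hpow
      push_cast [Finsupp.support_eq_empty] at this
      exact this
    rw [← hpow', ← Finset.sum_filter]
    have hind : ∀ (S : Finset ℕ) (i : ℕ),
        Finsupp.indicator S (fun _ _ => 1) i = if i ∈ S then 1 else 0 := by
      intro S i
      rw [Finsupp.indicator_apply]
      simp
    have hsq : ∀ (a : ℕ →₀ ℕ), (∀ i, a i ≤ 1) →
        Finsupp.indicator a.support (fun _ _ => 1) = a := by
      intro a ha
      ext i
      rw [hind]
      have := ha i
      by_cases h0 : a i = 0
      · simp [h0]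
      · rw [if_pos (Finsupp.mem_support_iff.2 h0)]
        omega
    refine Finset.sum_bij' (fun y _ => y.1.support)
      (fun S _ => (Finsupp.indicator S (fun _ _ => 1),
        m - Finsupp.indicator S (fun _ _ => 1))) ?_ ?_ ?_ ?_ ?_
    · intro y hy
      rw [Finset.mem_filter, Finset.HasAntidiagonal.mem_antidiagonal] at hy
      rw [Finset.mem_powerset, ← hy.1]
      intro i hi
      rw [Finsupp.mem_support_iff] at hi ⊢
      rw [Finsupp.add_apply]
      omega
    · intro S hS
      rw [Finset.mem_powerset] at hS
      rw [Finset.mem_filter, Finset.HasAntidiagonal.mem_antidiagonal]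
      refine ⟨?_, fun i => ?_⟩
      · ext i
        rw [Finsupp.add_apply, Finsupp.tsub_apply, hind]
        split_ifs with hi
        · have := Finsupp.mem_support_iff.1 (hS hi)
          omega
        · simp
      · simp only [hind]
        split_ifs <;> simp
    · intro y hy
      rw [Finset.mem_filter, Finset.HasAntidiagonal.mem_antidiagonal] at hy
      refine Prod.ext (hsq _ hy.2) ?_
      simp only [hsq _ hy.2]
      rw [← hy.1, add_tsub_cancel_left]
    · intro S _
      ext i
      simp only [Finsupp.mem_support_iff, hind]
      simp
    · intro y hy
      rw [Finset.mem_filter] at hy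
      congr 1
      rw [Finsupp.degree_apply, Finset.card_eq_sum_ones]
      refine Finset.sum_congr rfl fun i hi => ?_
      have := hy.2 i
      have := Finsupp.mem_support_iff.1 hi
      omega
  by_cases hmn : m.degree = n
  · simp only [hmn, if_true]
    rw [hmain]
    have h0 : n = 0 ↔ m = 0 := by rw [← hmn, Finsupp.degree_eq_zero_iff]
    by_cases hm : m = 0
    · rw [if_pos hm, if_pos (h0.2 hm), hm, OneMemClass.coe_one, MvPowerSeries.coeff_zero_one]
    · rw [if_neg hm, if_neg (fun h => hm (h0.1 h)), ZeroMemClass.coe_zero, map_zero]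
  · simp only [hmn, if_false, Finset.sum_const_zero]
    by_cases hn : n = 0
    · have hm : m ≠ 0 := by
        rintro rfl
        exact hmn (by rw [hn, map_zero])
      rw [if_pos hn, OneMemClass.coe_one, MvPowerSeries.coeff_one, if_neg hm]
    · rw [if_neg hn, ZeroMemClass.coe_zero, map_zero]

theorem two_smul_P (k : ℕ) :
    (2 : ℂ) • P k = PowerSeries.coeff k (PowerSeries.mk h * PowerSeries.mk e) := by
  rw [P, smul_smul, PowerSeries.coeff_mul,
    Finset.Nat.sum_antidiagonal_eq_sum_range_succ_mk]
  rw [show (2 : ℂ) * (1 / 2) = 1 by norm_num, one_smul]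
  refine Finset.sum_congr rfl fun i _ => ?_
  rw [PowerSeries.coeff_mk, PowerSeries.coeff_mk]

theorem rescale_involutive (F : PowerSeries SymFun) :
    PowerSeries.rescale (-1 : SymFun) (PowerSeries.rescale (-1 : SymFun) F) = F := by
  ext1 k
  rw [PowerSeries.coeff_rescale, PowerSeries.coeff_rescale, ← mul_assoc, ← mul_pow,
    show (-1 : SymFun) * -1 = 1 by ring, one_pow, one_mul]

/-- There is a unique algebra endomorphism of `Sym` with `h_k ↦ 2 P_k` for all `k ≥ 1`. -/
theorem existsUnique_sh :
    ∃! φ : SymFun →ₐ[ℂ] SymFun, ∀ k : ℕ, 1 ≤ k → φ (h k) = (2 : ℂ) • P k := by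
  set E : PowerSeries SymFun := PowerSeries.mk e with hE
  set H : PowerSeries SymFun := PowerSeries.mk h with hH
  have hEH : PowerSeries.rescale (-1) E * H = 1 := rescale_e_mul_h
  have hEH' : E * PowerSeries.rescale (-1) H = 1 := by
    have := congrArg (PowerSeries.rescale (-1 : SymFun)) hEH
    rwa [map_mul, map_one, rescale_involutive] at this
  have hmapr : ∀ (φ : SymFun →ₐ[ℂ] SymFun) (F : PowerSeries SymFun),
      PowerSeries.map (φ : SymFun →+* SymFun) (PowerSeries.rescale (-1) F) =
        PowerSeries.rescale (-1) (PowerSeries.map (φ : SymFun →+* SymFun) F) := by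
    intro φ F
    ext1 k
    simp [PowerSeries.coeff_rescale]
  let Φ : MvPolynomial ℕ ℂ ≃ₐ[ℂ] SymFun :=
    AlgEquiv.ofBijective eHom ⟨eHom_injective, eHom_surjective⟩
  have hΦ : ∀ i, Φ (MvPolynomial.X i) = e (i + 1) := fun i => by
    change eHom _ = _
    rw [eHom, MvPolynomial.aeval_X]
  let φ : SymFun →ₐ[ℂ] SymFun :=
    (MvPolynomial.aeval fun i => (2 : ℂ) • P (i + 1)).comp (Φ.symm : SymFun →ₐ[ℂ] _)
  have hφe : ∀ i, φ (e i) = (2 : ℂ) • P i := by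
    intro i
    cases i with
    | zero =>
      rw [e_zero, map_one, two_smul_P, PowerSeries.coeff_mul,
        Finset.Nat.antidiagonal_zero, Finset.sum_singleton, PowerSeries.coeff_mk,
        PowerSeries.coeff_mk, e_zero, h_zero, one_mul]
    | succ i =>
      change MvPolynomial.aeval _ (Φ.symm (e (i + 1))) = _
      rw [← hΦ, AlgEquiv.symm_apply_apply, MvPolynomial.aeval_X]
  have hφE : PowerSeries.map (φ : SymFun →+* SymFun) E = H * E := by
    ext1 k
    rw [PowerSeries.coeff_map, hE, PowerSeries.coeff_mk, ← two_smul_P]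
    exact hφe k
  have hφH : PowerSeries.map (φ : SymFun →+* SymFun) H = H * E := by
    have h1 := congrArg (PowerSeries.map (φ : SymFun →+* SymFun)) hEH
    rw [map_mul, map_one, hmapr, hφE, map_mul] at h1
    calc PowerSeries.map (φ : SymFun →+* SymFun) H
        = (PowerSeries.map (φ : SymFun →+* SymFun) H) *
            ((PowerSeries.rescale (-1) E * H) * (E * PowerSeries.rescale (-1) H)) := by
          rw [hEH, hEH', mul_one, mul_one]
      _ = (PowerSeries.rescale (-1) H * PowerSeries.rescale (-1) E *
            PowerSeries.map (φ : SymFun →+* SymFun) H) * (H * E) := by ring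
      _ = H * E := by rw [h1, one_mul]
  refine ⟨φ, fun k _ => ?_, fun ψ hψ => ?_⟩
  · have := congrArg (PowerSeries.coeff k) hφH
    rw [PowerSeries.coeff_map, hH, PowerSeries.coeff_mk] at this
    rw [two_smul_P]
    exact this
  · have hψH : PowerSeries.map (ψ : SymFun →+* SymFun) H = H * E := by
      ext1 k
      rw [PowerSeries.coeff_map, hH, PowerSeries.coeff_mk, ← two_smul_P]
      rcases Nat.eq_zero_or_pos k with rfl | hk
      · rw [← hφe, e_zero, h_zero, map_one, map_one]
      · exact hψ k hk
    have hψE : PowerSeries.map (ψ : SymFun →+* SymFun) E = H * E := by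
      have h1 := congrArg (PowerSeries.map (ψ : SymFun →+* SymFun)) hEH'
      rw [map_mul, map_one, hmapr, hψH, map_mul] at h1
      calc PowerSeries.map (ψ : SymFun →+* SymFun) E
          = (PowerSeries.map (ψ : SymFun →+* SymFun) E) *
              ((PowerSeries.rescale (-1) E * H) * (E * PowerSeries.rescale (-1) H)) := by
            rw [hEH, hEH', mul_one, mul_one]
        _ = (PowerSeries.map (ψ : SymFun →+* SymFun) E *
              (PowerSeries.rescale (-1) H * PowerSeries.rescale (-1) E)) * (H * E) := by ring
        _ = H * E := by rw [h1, one_mul]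
    have hψe : ∀ i, ψ (e i) = (2 : ℂ) • P i := by
      intro i
      have := congrArg (PowerSeries.coeff i) hψE
      rw [PowerSeries.coeff_map, hE, PowerSeries.coeff_mk] at this
      rw [two_smul_P]
      exact this
    have hcomp : ψ.comp eHom = φ.comp eHom := by
      refine MvPolynomial.algHom_ext fun i => ?_
      rw [AlgHom.comp_apply, AlgHom.comp_apply, eHom, MvPolynomial.aeval_X, hψe, hφe]
    refine AlgHom.ext fun f => ?_
    obtain ⟨q, rfl⟩ := eHom_surjective f
    exact DFunLike.congr_fun hcomp q

/-- The shiftification operator: the algebra endomorphism of `Sym` with `h_k ↦ 2 P_k`, `k ≥ 1`. -/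
def sh : SymFun →ₐ[ℂ] SymFun := existsUnique_sh.choose

theorem sh_h (k : ℕ) (hk : 1 ≤ k) : sh (h k) = (2 : ℂ) • P k :=
  existsUnique_sh.choose_spec.1 k hk

/-- `h_λ = ∏ h_{λ_i}`. -/
def hProd {n : ℕ} (l : n.Partition) : SymFun := (l.parts.map h).prod

/-- `V_λ = ∏ P_{λ_i}`. -/
def V {n : ℕ} (l : n.Partition) : SymFun := (l.parts.map P).prod

/-- The Frobenius character of a complex representation of the symmetric group `S_n` with
character `χ`: it is `(1/n!) ∑_π χ(π) p_{type(π)}`, that is, `∑_{λ ⊢ n} z_λ⁻¹ χ(π_λ) p_λ` (there are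
`n!/z_λ` permutations of cycle type `λ`). Here `π.partition` is the cycle type of `π`, fixed points
included, and `p_λ = ∏ p_{λ_i}`. -/
def frobeniusChar {n : ℕ} {M : Type*} [AddCommGroup M] [Module ℂ M]
    (ρ : Representation ℂ (Equiv.Perm (Fin n)) M) : SymFun :=
  (n.factorial : ℂ)⁻¹ • ∑ π : Equiv.Perm (Fin n),
    ρ.character π • (π.partition.parts.map powerSum).prod

/-! ### Parking functions

Entries and positions are indexed by `Fin n = {0, …, n-1}`: the value `p i : Fin n` stands for the
entry `p i + 1 ∈ {1, …, n}` (the entries of a parking function of size `n` are at most `n`). -/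

/-- The weakly increasing rearrangement of a tuple. -/
def sortTuple {n : ℕ} (p : Fin n → Fin n) : Fin n → Fin n := p ∘ Tuple.sort p

/-- `p` is a parking function: the `i`th entry of its sort is at most `i`. -/
def IsParking {n : ℕ} (p : Fin n → Fin n) : Prop := ∀ i, sortTuple p i ≤ i

/-- `α_k(p)`, the number of occurrences of `k` in `p`. -/
def content {n : ℕ} (p : Fin n → Fin n) (k : Fin n) : ℕ :=
  (Finset.univ.filter fun i => p i = k).card

theorem sum_content {n : ℕ} (p : Fin n → Fin n) : (Finset.univ.val.map (content p)).sum = n := by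
  change ∑ k, content p k = n
  have := Finset.card_eq_sum_card_fiberwise (f := p) (s := Finset.univ) (t := Finset.univ)
    (fun _ _ => Finset.mem_coe.2 (Finset.mem_univ _))
  rw [Finset.card_univ, Fintype.card_fin] at this
  exact this.symm

/-- The shape of `p`: the partition of `n` formed by the nonzero multiplicities `α_k(p)`. -/
def shape {n : ℕ} (p : Fin n → Fin n) : n.Partition :=
  Nat.Partition.ofSums n (Finset.univ.val.map (content p)) (sum_content p)

/-- A partition is odd if all its parts are odd. -/
def IsOddPartition {n : ℕ} (l : n.Partition) : Prop := ∀ i ∈ l.parts, Odd i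

open Classical in
/-- The parking function symmetric function `PF_n = ∑ h_{shape(p)}`, over the sorted parking
functions `p` of size `n`. -/
def PF (n : ℕ) : SymFun :=
  ∑ p : Fin n → Fin n with IsParking p ∧ sortTuple p = p, hProd (shape p)

/-- The shifted parking function symmetric function. -/
def SH (n : ℕ) : SymFun := sh (PF n)

/-! ### Odd shifted parking functions -/

/-- `σ̄_k`: the product of the signs `σ_i` with `p_i = k`, or `0` if `k` does not occur in `p`. -/
def signBar {n : ℕ} (p : Fin n → Fin n) (σ : Fin n → ℤˣ) (k : Fin n) : ℤ :=
  if 0 < content p k then ∏ i with p i = k, (σ i : ℤ) else 0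

/-- `τ` is a noncrossing (partial) matching of integers that appear in `p`; an arc joining `a < b`
is recorded as the pair `(a, b)`. -/
structure IsNoncrossingMatching {n : ℕ} (p : Fin n → Fin n) (τ : Finset (Fin n × Fin n)) :
    Prop where
  lt : ∀ x ∈ τ, x.1 < x.2
  appears : ∀ x ∈ τ, x.1 ∈ Set.range p ∧ x.2 ∈ Set.range p
  disjoint : ∀ x ∈ τ, ∀ y ∈ τ, x ≠ y → x.1 ≠ y.1 ∧ x.1 ≠ y.2 ∧ x.2 ≠ y.1 ∧ x.2 ≠ y.2
  noncrossing : ∀ a b c d, (a, c) ∈ τ → (b, d) ∈ τ → ¬(a < b ∧ b < c ∧ c < d)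

/-- An odd shifted parking function of size `n`. -/
@[ext]
structure OShPf (n : ℕ) where
  p : Fin n → Fin n
  σ : Fin n → ℤˣ
  τ : Finset (Fin n × Fin n)
  parking : IsParking p
  odd : IsOddPartition (shape p)
  matching : IsNoncrossingMatching p τ
  opposite : ∀ a b, (a, b) ∈ τ → signBar p σ a = -signBar p σ b
  covered : ∀ a b c, (a, c) ∈ τ → a < b → b < c → b ∈ Set.range p
  nested : ∀ a b c d, (a, d) ∈ τ → (b, c) ∈ τ → a < b → b < c → c < d →
    signBar p σ a = signBar p σ b

instance (n : ℕ) : Finite (OShPf n) :=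
  Finite.of_injective (fun x : OShPf n => (x.p, x.σ, x.τ)) fun x y hxy => by
    simp only [Prod.mk.injEq] at hxy
    exact OShPf.ext hxy.1 hxy.2.1 hxy.2.2

instance (n : ℕ) : Fintype (OShPf n) := Fintype.ofFinite _

/-- `sort(p, σ, τ) = (sort(p), σ̄, τ)`. -/
def OShPf.sort {n : ℕ} (x : OShPf n) :
    (Fin n → Fin n) × (Fin n → ℤ) × Finset (Fin n × Fin n) :=
  (sortTuple x.p, signBar x.p x.σ, x.τ)

/-- The set of sorted odd shifted parking functions `(p, σ̄, τ)` of size `n`. -/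
def sortedOShPf (n : ℕ) : Finset ((Fin n → Fin n) × (Fin n → ℤ) × Finset (Fin n × Fin n)) :=
  Finset.univ.image OShPf.sort

/-! ### The action of the symmetric group -/

theorem sortTuple_comp {n : ℕ} (p : Fin n → Fin n) (π : Equiv.Perm (Fin n)) :
    sortTuple (p ∘ π) = sortTuple p :=
  Tuple.comp_perm_comp_sort_eq_comp_sort

theorem content_comp {n : ℕ} (p : Fin n → Fin n) (π : Equiv.Perm (Fin n)) :
    content (p ∘ π) = content p := by
  funext k
  refine Finset.card_bij (fun i _ => π i) (fun i hi => ?_) (fun i _ j _ hij => π.injective hij)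
    fun j hj => ⟨π.symm j, ?_, π.apply_symm_apply j⟩
  · simpa using hi
  · simpa using hj

theorem shape_comp {n : ℕ} (p : Fin n → Fin n) (π : Equiv.Perm (Fin n)) :
    shape (p ∘ π) = shape p := by
  simp only [shape, content_comp]

theorem signBar_comp {n : ℕ} (p : Fin n → Fin n) (σ : Fin n → ℤˣ) (π : Equiv.Perm (Fin n)) :
    signBar (p ∘ π) (σ ∘ π) = signBar p σ := by
  funext k
  simp only [signBar, content_comp]
  congr 1
  refine Finset.prod_bij (fun i _ => π i) (fun i hi => ?_) (fun i _ j _ hij => π.injective hij)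
    (fun j hj => ⟨π.symm j, ?_, π.apply_symm_apply j⟩) fun i _ => rfl
  · simpa using hi
  · simpa using hj

/-- `π · (p, σ, τ)`: the tuples `p` and `σ` are permuted (the entry in position `i` moves to
position `π i`) and `τ` is fixed. -/
def OShPf.act {n : ℕ} (π : Equiv.Perm (Fin n)) (x : OShPf n) : OShPf n where
  p := x.p ∘ ⇑(π⁻¹)
  σ := x.σ ∘ ⇑(π⁻¹)
  τ := x.τ
  parking := by
    rw [IsParking, sortTuple_comp]
    exact x.parking
  odd := by
    rw [shape_comp]
    exact x.odd
  matching :=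
    { lt := x.matching.lt
      appears := by
        rw [EquivLike.range_comp x.p π⁻¹]
        exact x.matching.appears
      disjoint := x.matching.disjoint
      noncrossing := x.matching.noncrossing }
  opposite := by
    rw [signBar_comp]
    exact x.opposite
  covered := by
    rw [EquivLike.range_comp x.p π⁻¹]
    exact x.covered
  nested := by
    rw [signBar_comp]
    exact x.nested

/-- The positions `i` with `σ_i = -1`. -/
def negSet {n : ℕ} (σ : Fin n → ℤˣ) : Finset (Fin n) := Finset.univ.filter fun i => σ i = -1

/-- The sign by which `π` acts on `v_{i₁} ∧ ⋯ ∧ v_{iₖ}`, where `I = {i₁ < ⋯ < iₖ}`, when the wedge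
product `v_{π i₁} ∧ ⋯ ∧ v_{π iₖ}` is rewritten with increasing indices:
`(-1)` to the number of pairs `i < j` in `I` with `π i > π j`. -/
def wedgeSign {n : ℕ} (π : Equiv.Perm (Fin n)) (I : Finset (Fin n)) : ℤ :=
  ∏ x ∈ I ×ˢ I with x.1 < x.2, if π x.1 < π x.2 then 1 else -1

theorem wedgeSign_mul {n : ℕ} (π ρ : Equiv.Perm (Fin n)) (I : Finset (Fin n)) :
    wedgeSign (π * ρ) I = wedgeSign π (I.image ρ) * wedgeSign ρ I := by
  have hre : wedgeSign π (I.image ρ) = ∏ x ∈ I ×ˢ I with x.1 < x.2,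
      if ρ x.1 < ρ x.2 then (if π (ρ x.1) < π (ρ x.2) then 1 else -1)
      else (if π (ρ x.2) < π (ρ x.1) then (1 : ℤ) else -1) := by
    symm
    refine Finset.prod_bij' (fun x _ => if ρ x.1 < ρ x.2 then (ρ x.1, ρ x.2) else (ρ x.2, ρ x.1))
      (fun y _ => if ρ.symm y.1 < ρ.symm y.2 then (ρ.symm y.1, ρ.symm y.2)
        else (ρ.symm y.2, ρ.symm y.1)) ?_ ?_ ?_ ?_ ?_
    · rintro ⟨a, b⟩ hx
      simp only [Finset.mem_filter, Finset.mem_product] at hx ⊢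
      have hne : ρ a ≠ ρ b := fun h => hx.2.ne (ρ.injective h)
      split_ifs with h1
      · exact ⟨⟨Finset.mem_image_of_mem _ hx.1.1, Finset.mem_image_of_mem _ hx.1.2⟩, h1⟩
      · exact ⟨⟨Finset.mem_image_of_mem _ hx.1.2, Finset.mem_image_of_mem _ hx.1.1⟩,
          lt_of_le_of_ne (not_lt.1 h1) hne.symm⟩
    · rintro ⟨a, b⟩ hx
      simp only [Finset.mem_filter, Finset.mem_product, Finset.mem_image] at hx ⊢
      obtain ⟨⟨⟨a', ha', rfl⟩, ⟨b', hb', rfl⟩⟩, hab⟩ := hx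
      simp only [Equiv.symm_apply_apply]
      have hne : a' ≠ b' := fun h => hab.ne (congrArg ρ h)
      split_ifs with h1
      · exact ⟨⟨ha', hb'⟩, h1⟩
      · exact ⟨⟨hb', ha'⟩, lt_of_le_of_ne (not_lt.1 h1) hne.symm⟩
    · rintro ⟨a, b⟩ hx
      simp only [Finset.mem_filter] at hx
      have := hx.2
      split_ifs <;> simp_all [not_lt.2 hx.2.le]
    · rintro ⟨a, b⟩ hx
      simp only [Finset.mem_filter] at hx
      have := hx.2
      split_ifs <;> simp_all [not_lt.2 hx.2.le]
    · rintro ⟨a, b⟩ hx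
      simp only
      split_ifs <;> simp_all
  rw [hre, wedgeSign, wedgeSign, ← Finset.prod_mul_distrib]
  refine Finset.prod_congr rfl fun x hx => ?_
  have hne : π (ρ x.1) ≠ π (ρ x.2) := fun h =>
    (Finset.mem_filter.1 hx).2.ne (ρ.injective (π.injective h))
  simp only [Equiv.Perm.mul_apply]
  rcases lt_or_gt_of_ne hne with h1 | h1 <;> split_ifs <;> simp_all [not_lt.2 h1.le]

theorem negSet_comp {n : ℕ} (σ : Fin n → ℤˣ) (π : Equiv.Perm (Fin n)) :
    negSet (σ ∘ ⇑(π⁻¹)) = (negSet σ).image π := by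
  ext i
  simp only [negSet, Finset.mem_filter, Finset.mem_image, Finset.mem_univ, true_and,
    Function.comp_apply]
  constructor
  · intro hi
    exact ⟨π⁻¹ i, hi, by simp⟩
  · rintro ⟨j, hj, rfl⟩
    simpa using hj

/-- The representation of `S_n` on `ℂ[OShPf(n)]`: on basis elements,
`π · (p, σ, τ) = ε • (π·p, π·σ, τ)`, where `ε` is the sign coming from the identification of `σ`
with the element `v_{i₁} ∧ ⋯ ∧ v_{iₖ}` of the exterior algebra of `ℂⁿ`,
`{i₁ < ⋯ < iₖ} = {i | σ_i = -1}`, on which `S_n` acts by `v_i ↦ v_{π i}`. -/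
def oddRep (n : ℕ) : Representation ℂ (Equiv.Perm (Fin n)) (OShPf n →₀ ℂ) where
  toFun π := Finsupp.linearCombination ℂ fun x =>
    Finsupp.single (x.act π) (wedgeSign π (negSet x.σ) : ℂ)
  map_one' := by
    refine Finsupp.lhom_ext fun x c => ?_
    have h1 : x.act 1 = x := rfl
    have h2 : wedgeSign 1 (negSet x.σ) = 1 := by
      refine Finset.prod_eq_one fun y hy => if_pos ?_
      exact (Finset.mem_filter.1 hy).2
    rw [Finsupp.linearCombination_single, h1, h2]
    simp
  map_mul' π ρ := by
    refine Finsupp.lhom_ext fun x c => ?_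
    have h1 : x.act (π * ρ) = (x.act ρ).act π := by
      refine OShPf.ext ?_ ?_ rfl <;>
      · funext i
        simp [OShPf.act, mul_inv_rev]
    have h2 : negSet (x.act ρ).σ = (negSet x.σ).image ρ := negSet_comp x.σ ρ
    rw [Module.End.mul_apply, Finsupp.linearCombination_single,
      Finsupp.linearCombination_single, map_smul, Finsupp.linearCombination_single, h1, h2,
      wedgeSign_mul]
    simp [mul_comm]

end

end ShiftedParking

namespace ShiftedParking

/-! Both sums are evaluated by one operator on power series over `SymFun`. Put `Q = ∑ sh(h_k) X^k =
H(X) E(X)`. A weakly increasing parking function is determined by its contents, which form a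
Łukasiewicz word: the height starts at 1, a letter `a` changes it by `a - 1`, it must be positive
before each letter, and it ends at 1. The operator `T : A ↦ Q (A - A(0)) / X` sends `X^j` to `∑ q_a
X^(j-1+a)` for `j > 0` and kills `1`, so it performs one step of this walk with weight `q_a`. Hence
`SH n` is the constant term of `T^(n+1) X` (`SH_eq_lukEval`).

For the sorted odd shifted parking functions, scan the values from left to right and keep the number
`d` of open arcs. An absent value needs `d = 0`. A present value is unmatched (two signs), or closes
the innermost open arc (sign forced), or opens an arc (sign free if `d = 0`, forced otherwise).
`arcCount` is this recursion, and the `card_arcPatterns_*` lemmas prove that it counts signs and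
matchings. Encode height `j` and depth `d` by `X^j Y^d`, and put `F = ∑ P_k X^k` over odd `k`. The
same operator `T` performs the refined walk as soon as `Q = 1 + 2F(1+Y)` and `Q Y = F(1+Y)^2`. Since
`Q(X) Q(-X) = 1`, one has `4F = Q - Q⁻¹`, and `Y = (Q-1)/(Q+1)` solves both equations. As `Y^0 = 1`,
the sum over patterns is again the constant term of `T^(n+1) X` (`sum_arcCount`, `sum_oddPatterns`).

The Frobenius character is computed in `d` variables by a signed Burnside argument. The power sum
product of `π` enumerates the `π`-invariant colorings, so the character becomes a sum over tuples of
triples (entry, sign, color), each weighted by the sum of the wedge signs over its stabilizer. A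
transposition of two equal triples of sign `-1` makes this weight vanish; otherwise the weight is
the order of the stabilizer. Orbit counting leaves a sum over multisets of triples in which those of
sign `-1` do not repeat. At each value these multisets generate products `h_i e_j`, and for `a > 0`
the products with `i + j = a` and prescribed sign `(-1)^j` add up to `P_a` for either sign, because
`∑ (-1)^j h_i e_j = 0` (`P_eq_sum_antidiagonal`). The result is the sum of the `∏ P_{α_k}` over the
same patterns. -/

open PowerSeries in
/-- The linear functional on power series with `lukEval Q 0 A = A(0)` and
`lukEval Q (M + 1) A = lukEval Q M (Q * (A - A(0)) / X)`. -/
noncomputable def lukEval {R : Type*} [CommRing R] (Q : PowerSeries R) : ℕ → PowerSeries R → R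
  | 0, A => constantCoeff A
  | M + 1, A => lukEval Q M (Q * PowerSeries.mk fun n => coeff (n + 1) A)

/-! ### The transfer operator on power series -/

section lukEval

variable {R : Type*} [CommRing R] (Q : PowerSeries R)

theorem lukEval_add (M : ℕ) (A B : PowerSeries R) :
    lukEval Q M (A + B) = lukEval Q M A + lukEval Q M B := by
  induction M generalizing A B with
  | zero => simp [lukEval]
  | succ M ih =>
    rw [lukEval, lukEval, lukEval, ← ih, ← mul_add]
    congr 2

theorem lukEval_C_mul (M : ℕ) (r : R) (A : PowerSeries R) :
    lukEval Q M (PowerSeries.C r * A) = r * lukEval Q M A := by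
  induction M generalizing A with
  | zero => simp [lukEval]
  | succ M ih =>
    rw [lukEval, lukEval, ← ih]
    congr 1
    rw [mul_left_comm]
    congr 1
    ext k
    simp

theorem lukEval_zero_right (M : ℕ) : lukEval Q M 0 = 0 := by
  have := lukEval_C_mul Q M 0 0
  simpa using this

theorem lukEval_sum {ι : Type*} (M : ℕ) (s : Finset ι) (f : ι → PowerSeries R) :
    lukEval Q M (∑ i ∈ s, f i) = ∑ i ∈ s, lukEval Q M (f i) := by
  classical
  induction s using Finset.induction_on with
  | empty => simp [lukEval_zero_right]
  | insert a s ha ih => rw [Finset.sum_insert ha, Finset.sum_insert ha, lukEval_add, ih]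

theorem lukEval_succ_X_mul (M : ℕ) (A : PowerSeries R) :
    lukEval Q (M + 1) (PowerSeries.X * A) = lukEval Q M (Q * A) := by
  rw [lukEval]
  congr 2
  ext k
  simp

/-- A walk that reaches height 0 with steps left dies; compare `not_isForestWord_zero`. -/
theorem lukEval_succ_one (M : ℕ) : lukEval Q (M + 1) 1 = 0 := by
  rw [lukEval]
  convert lukEval_zero_right Q M
  convert mul_zero _
  ext k
  simp [PowerSeries.coeff_one]

/-- Each step lowers the height by at most 1, so height 0 is out of reach. -/
theorem lukEval_X_pow_mul_eq_zero {M N : ℕ} (hMN : M < N) (A : PowerSeries R) :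
    lukEval Q M (PowerSeries.X ^ N * A) = 0 := by
  induction M generalizing N A with
  | zero =>
    rw [lukEval]
    simp [hMN.ne']
  | succ M ih =>
    obtain ⟨N, rfl⟩ : ∃ N', N = N' + 1 := ⟨N - 1, by omega⟩
    rw [pow_succ', mul_assoc, lukEval_succ_X_mul, mul_left_comm]
    exact ih (by omega) _

/-- Only the low coefficients of a factor contribute. -/
theorem lukEval_X_pow_mul_mul {M N i : ℕ} (h : M < i + N) (F Z : PowerSeries R) :
    lukEval Q M (PowerSeries.X ^ i * (F * Z)) =
      ∑ a ∈ Finset.range N, PowerSeries.coeff a F * lukEval Q M (PowerSeries.X ^ (i + a) * Z) := by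
  -- The tail of `F` beyond degree `N` contributes a multiple of `X ^ (i + N)`, which is killed
  -- because `M < i + N`.
  have hF : F = (∑ a ∈ Finset.range N, PowerSeries.C (PowerSeries.coeff a F) * PowerSeries.X ^ a) +
      PowerSeries.X ^ N * PowerSeries.mk fun k => PowerSeries.coeff (k + N) F := by
    ext k
    simp only [map_add, map_sum, PowerSeries.coeff_C_mul, PowerSeries.coeff_X_pow,
      PowerSeries.coeff_X_pow_mul', PowerSeries.coeff_mk]
    by_cases hk : k < N
    · rw [Finset.sum_eq_single k (fun b _ hb => by simp [hb.symm]) (by simp [hk])]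
      simp [hk]
    · rw [Finset.sum_eq_zero, if_pos (not_lt.1 hk), zero_add, Nat.sub_add_cancel (not_lt.1 hk)]
      intro b hb
      have : k ≠ b := by
        have := Finset.mem_range.1 hb
        omega
      simp [this]
  conv_lhs => rw [hF]
  rw [add_mul, mul_add, lukEval_add, Finset.sum_mul, Finset.mul_sum, lukEval_sum,
    show ∀ W : PowerSeries R, PowerSeries.X ^ i * (PowerSeries.X ^ N * W * Z) =
      PowerSeries.X ^ (i + N) * (W * Z) by intro W; ring,
    lukEval_X_pow_mul_eq_zero Q h, add_zero]
  refine Finset.sum_congr rfl fun a _ => ?_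
  rw [← lukEval_C_mul]
  congr 1
  ring

end lukEval

/-! ### Weighted sums over Łukasiewicz words -/

/-- The sum over tuples of given total, split according to the first entry. -/
theorem sum_piAntidiag_succ {R : Type*} [AddCommMonoid R] (n N : ℕ) (f : (Fin (n + 1) → ℕ) → R) :
    ∑ α ∈ Finset.piAntidiag Finset.univ N, f α =
      ∑ a ∈ Finset.range (N + 1), ∑ β ∈ Finset.piAntidiag Finset.univ (N - a),
        f (Fin.cons a β) := by
  rw [Finset.sum_sigma']
  refine Finset.sum_bij' (fun α _ => ⟨α 0, Fin.tail α⟩) (fun x _ => Fin.cons x.1 x.2)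
    ?_ ?_ ?_ ?_ ?_
  · intro α hα
    simp only [Finset.mem_piAntidiag, Finset.mem_sigma, Finset.mem_range, Fin.sum_univ_succ] at *
    refine ⟨by omega, ?_, by simp⟩
    change ∑ i : Fin n, α i.succ = _
    omega
  · rintro ⟨a, β⟩ hx
    simp only [Finset.mem_piAntidiag, Finset.mem_sigma, Finset.mem_range, Fin.sum_univ_succ] at *
    simp only [Fin.cons_zero, Fin.cons_succ]
    have h2 : ∑ i, β i = N - a := hx.2.1
    have h1 : a < N + 1 := hx.1
    refine ⟨by omega, by simp⟩
  · intro α _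
    simp
  · rintro ⟨a, β⟩ _
    simp
  · intro α _
    simp

/-- The word `l` of out-degrees, followed by a final leaf, is the depth-first traversal of a forest
of `i` plane trees. -/
def IsForestWord : ℕ → List ℕ → Prop
  | i, [] => i = 1
  | i, a :: l => 1 ≤ i ∧ IsForestWord (i - 1 + a) l

instance decidableIsForestWord : ∀ i l, Decidable (IsForestWord i l)
  | i, [] => inferInstanceAs (Decidable (i = 1))
  | i, a :: l =>
    haveI := decidableIsForestWord (i - 1 + a) l
    inferInstanceAs (Decidable (1 ≤ i ∧ IsForestWord (i - 1 + a) l))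

theorem not_isForestWord_zero (l : List ℕ) : ¬IsForestWord 0 l := by
  cases l <;> simp [IsForestWord]

/-- The number of ways to complete, on a word of absences and presences, a sign pattern and a
noncrossing matching with `d` open arcs. -/
def arcCount : List Bool → ℕ → ℕ
  | [], d => if d = 0 then 1 else 0
  | false :: l, d => if d = 0 then arcCount l 0 else 0
  | true :: l, d => 2 * arcCount l d +
      if d = 0 then 2 * arcCount l 1 else arcCount l (d - 1) + arcCount l (d + 1)

section PathSums

variable {R : Type*} [CommRing R]

/-- Peeling off the first letter is one application of the operator to the state `X ^ (i + 1)`. The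
relation `i + N = n` forces height 1 after `n` letters; the extra step down to height 0 is the final
leaf, of weight `coeff 0 Q = 1`. -/
theorem sum_isForestWord (Q : PowerSeries R) (hQ : PowerSeries.coeff 0 Q = 1) (n i N : ℕ)
    (h : i + N = n) :
    ∑ α ∈ Finset.piAntidiag (Finset.univ : Finset (Fin n)) N,
      (if IsForestWord (i + 1) (List.ofFn α) then ∏ k, PowerSeries.coeff (α k) Q else 0) =
      lukEval Q (n + 1) (PowerSeries.X ^ (i + 1)) := by
  induction n generalizing i N with
  | zero =>
    obtain ⟨rfl, rfl⟩ : i = 0 ∧ N = 0 := by omega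
    rw [pow_succ', lukEval_succ_X_mul]
    simp [IsForestWord, lukEval, Finset.piAntidiag_zero, ← hQ]
  | succ n ih =>
    -- Letters `a > N` may be dropped: they lead to height `i + a > n + 1`, too high for the `n + 1`
    -- remaining steps.
    rw [sum_piAntidiag_succ, pow_succ', lukEval_succ_X_mul,
      show Q * PowerSeries.X ^ i = PowerSeries.X ^ i * (Q * 1) by ring,
      lukEval_X_pow_mul_mul Q (N := N + 1) (by omega)]
    refine Finset.sum_congr rfl fun a ha => ?_
    rw [Finset.mem_range] at ha
    rw [mul_one]
    rcases Nat.eq_zero_or_pos (i + a) with h0 | h0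
    · obtain ⟨rfl, rfl⟩ : i = 0 ∧ a = 0 := by omega
      simp [IsForestWord, not_isForestWord_zero, lukEval_succ_one]
    · obtain ⟨j, hj⟩ : ∃ j, i + a = j + 1 := ⟨i + a - 1, by omega⟩
      rw [hj, ← ih j (N - a) (by omega), Finset.mul_sum]
      refine Finset.sum_congr rfl fun β _ => ?_
      simp only [List.ofFn_cons, IsForestWord, Fin.prod_univ_succ, Fin.cons_zero, Fin.cons_succ,
        Nat.add_sub_cancel, hj, Nat.le_add_left, true_and, mul_ite, mul_zero]

/-- Here the state is `X ^ (i + 1) * Y ^ d`, for a height together with the number of open arcs. The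
hypotheses `h1` and `h2` say that multiplying `Y ^ d` by `Q` produces exactly the transitions of
`arcCount`, with weight 1 for an absent value and `F` for a present one. -/
theorem sum_arcCount (Q F Y : PowerSeries R) (hY0 : PowerSeries.constantCoeff Y = 0)
    (hQ0 : PowerSeries.constantCoeff Q = 1) (hF0 : PowerSeries.coeff 0 F = 0)
    (h1 : Q = 1 + 2 * F * (1 + Y)) (h2 : Q * Y = F * (1 + Y) ^ 2) (n i N d : ℕ)
    (h : i + N = n) :
    ∑ α ∈ Finset.piAntidiag (Finset.univ : Finset (Fin n)) N,
      (if IsForestWord (i + 1) (List.ofFn α) then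
        (arcCount (List.ofFn fun k => decide (0 < α k)) d : R) *
          ∏ k, (if 0 < α k then PowerSeries.coeff (α k) F else 1) else 0) =
      lukEval Q (n + 1) (PowerSeries.X ^ (i + 1) * Y ^ d) := by
  induction n generalizing i N d with
  | zero =>
    obtain ⟨rfl, rfl⟩ : i = 0 ∧ N = 0 := by omega
    rw [pow_succ', mul_assoc, lukEval_succ_X_mul]
    -- At the end of the word, arcs that were never closed are discarded by `Y(0) = 0`.
    rcases Nat.eq_zero_or_pos d with rfl | hd
    · simp [IsForestWord, lukEval, Finset.piAntidiag_zero, arcCount, hQ0]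
    · simp [IsForestWord, lukEval, Finset.piAntidiag_zero, arcCount, hQ0, hY0, hd.ne']
  | succ n ih =>
    -- The transition rule: `h1` is the case `d = 0`, and `h2` times `Y ^ (d - 1)` is the case `d >
    -- 0`.
    have hQY : Q * Y ^ d = (if d = 0 then 1 else 0) + F * (2 * Y ^ d +
        if d = 0 then 2 * Y ^ 1 else Y ^ (d - 1) + Y ^ (d + 1)) := by
      rcases Nat.eq_zero_or_pos d with rfl | hd
      · simp only [if_true, pow_zero, mul_one, pow_one]
        conv_lhs => rw [h1]
        ring
      · obtain ⟨d, rfl⟩ : ∃ d', d = d' + 1 := ⟨d - 1, by omega⟩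
        simp only [Nat.add_eq_zero_iff, one_ne_zero, and_false, if_false, Nat.add_sub_cancel]
        rw [pow_succ', ← mul_assoc, h2]
        ring
    -- The letter 0 is matched with the summand without `F`, the letters `a + 1` with the
    -- coefficients of `F`, whose constant term vanishes.
    rw [sum_piAntidiag_succ, pow_succ', mul_assoc, lukEval_succ_X_mul, mul_left_comm, hQY,
      mul_add, lukEval_add, lukEval_X_pow_mul_mul Q (N := N + 1) (by omega),
      Finset.sum_range_succ', Finset.sum_range_succ', hF0, zero_mul, add_zero, add_comm]
    congr 1
    · simp only [List.ofFn_succ, IsForestWord, Fin.cons_zero, Fin.cons_succ,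
        Nat.add_sub_cancel, add_zero, lt_irrefl, decide_false, arcCount, Fin.prod_univ_succ,
        if_false, one_mul, Nat.le_add_left, true_and, Nat.sub_zero]
      rcases Nat.eq_zero_or_pos d with rfl | hd
      · simp only [if_true, mul_one]
        rcases Nat.eq_zero_or_pos i with rfl | hi
        · simp [not_isForestWord_zero, lukEval_succ_one]
        · obtain ⟨j, rfl⟩ : ∃ j, i = j + 1 := ⟨i - 1, by omega⟩
          rw [ih j N 0 (by omega), pow_zero, mul_one]
      · simp [hd.ne', lukEval_zero_right]
    · refine Finset.sum_congr rfl fun a ha => ?_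
      rw [Finset.mem_range] at ha
      have hj : i + (a + 1) = (i + a) + 1 := by omega
      have key : ∀ e, lukEval Q (n + 1) (PowerSeries.X ^ (i + (a + 1)) * Y ^ e) = _ := fun e => by
        rw [hj, ← ih (i + a) (N - (a + 1)) e (by omega)]
      have key2 : lukEval Q (n + 1) (PowerSeries.X ^ (i + (a + 1)) *
          (2 * Y ^ d + if d = 0 then 2 * Y ^ 1 else Y ^ (d - 1) + Y ^ (d + 1))) =
          2 * lukEval Q (n + 1) (PowerSeries.X ^ (i + (a + 1)) * Y ^ d) +
          if d = 0 then 2 * lukEval Q (n + 1) (PowerSeries.X ^ (i + (a + 1)) * Y ^ 1)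
          else lukEval Q (n + 1) (PowerSeries.X ^ (i + (a + 1)) * Y ^ (d - 1)) +
            lukEval Q (n + 1) (PowerSeries.X ^ (i + (a + 1)) * Y ^ (d + 1)) := by
        have h2C : (2 : PowerSeries R) = PowerSeries.C 2 := (map_ofNat _ 2).symm
        split_ifs <;> simp only [mul_add, lukEval_add, h2C, lukEval_C_mul, 
          mul_left_comm _ (PowerSeries.C (2 : R))]
      rw [key2]
      simp only [key, Finset.mul_sum, ← Finset.sum_add_distrib, ← Finset.sum_ite_irrel]
      split_ifs with hd
      · refine Finset.sum_congr rfl fun β _ => ?_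
        simp only [List.ofFn_succ, IsForestWord, Fin.cons_zero, Fin.cons_succ,
          Nat.add_sub_cancel, hj, Nat.zero_lt_succ, decide_true, arcCount, Fin.prod_univ_succ,
          if_true, Nat.le_add_left, true_and, if_pos hd]
        split_ifs
        · push_cast
          ring
        · ring
      · refine Finset.sum_congr rfl fun β _ => ?_
        simp only [List.ofFn_succ, IsForestWord, Fin.cons_zero, Fin.cons_succ,
          Nat.add_sub_cancel, hj, Nat.zero_lt_succ, decide_true, arcCount, Fin.prod_univ_succ,
          if_true, Nat.le_add_left, true_and, if_neg hd]
        split_ifs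
        · push_cast
          ring
        · ring

end PathSums

/-! ### The series recording open arcs -/

/-- The series `Y = (Q - 1) / (Q + 1)` when `4 F = Q - Q⁻¹`. -/
theorem exists_arc_series {R : Type*} [CommRing R] (c : R) (hc : 2 * c = 1)
    (Q Q' F : PowerSeries R) (hQ0 : PowerSeries.constantCoeff Q = 1) (hQQ : Q * Q' = 1)
    (hF : 4 * F = Q - Q') :
    ∃ Y : PowerSeries R, PowerSeries.constantCoeff Y = 0 ∧ Q = 1 + 2 * F * (1 + Y) ∧
      Q * Y = F * (1 + Y) ^ 2 := by
  set C : PowerSeries R := PowerSeries.C c with hC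
  have hC2 : 2 * C = 1 := by
    rw [hC, show (2 : PowerSeries R) = PowerSeries.C 2 from (map_ofNat _ 2).symm, ← map_mul, hc,
      map_one]
  -- Since `C` is one half, `(1 + Q) / 2` has constant term 1. Its inverse `J` is `2 / (1 + Q)`, and
  -- `Q * J - 1` is the required `Y`.
  have hA0 : PowerSeries.constantCoeff (C * (1 + Q)) = ((1 : Rˣ) : R) := by
    rw [map_mul, map_add, map_one, hQ0, hC, PowerSeries.constantCoeff_C, Units.val_one]
    linear_combination hc
  have hJ := PowerSeries.mul_invOfUnit _ _ hA0
  set J := PowerSeries.invOfUnit (C * (1 + Q)) 1 with hJd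
  have hJ0 : PowerSeries.constantCoeff J = 1 := by
    have := congrArg PowerSeries.constantCoeff hJ
    rw [map_mul, hA0, map_one, Units.val_one, one_mul] at this
    exact this
  have hJ' : (1 + Q) * J = 2 := by linear_combination 2 * hJ - (1 + Q) * J * hC2
  have hF2 : 2 * F = C * (Q - Q') := by linear_combination C * hF - 2 * F * hC2
  have e1 : 2 * F * (Q * J) = Q - 1 := by
    rw [hF2]
    linear_combination (C * (Q - 1)) * hJ' - C * J * hQQ + (Q - 1) * hC2
  refine ⟨Q * J - 1, by simp [hQ0, hJ0], ?_, ?_⟩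
  · linear_combination -e1
  · have e2 : F * (Q * J) = C * (Q - 1) := by linear_combination C * e1 - F * (Q * J) * hC2
    linear_combination (-Q * J) * e2 + Q * hJ - Q ^ 2 * J * hC2

/-! ### Sign patterns and noncrossing matchings on final segments -/

section ArcPatterns

variable {ι : Type*} [LinearOrder ι]

/-- A sign pattern `s` and a noncrossing matching `τ` on the elements of `B` satisfying `A`, together
with a set `Δ` of right ends of arcs whose left ends lie to the left of `B` and have sign `ε`. -/
structure IsArcPattern (B : Finset ι) (A : ι → Prop) (ε : ℤˣ) (s : ι → ℤˣ)
    (τ : Finset (ι × ι)) (Δ : Finset ι) : Prop where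
  sign : ∀ j, ¬(j ∈ B ∧ A j) → s j = 1
  lt : ∀ a c, (a, c) ∈ τ → a < c
  left : ∀ a c, (a, c) ∈ τ → a ∈ B ∧ A a
  right : ∀ a c, (a, c) ∈ τ → c ∈ B ∧ A c
  disjoint : ∀ a b c d, (a, b) ∈ τ → (c, d) ∈ τ →
    (a = c ∨ b = d → a = c ∧ b = d) ∧ a ≠ d ∧ b ≠ c
  noncrossing : ∀ a b c d, (a, c) ∈ τ → (b, d) ∈ τ → a < b → b < c → d < c
  opposite : ∀ a c, (a, c) ∈ τ → s a = -s c
  covered : ∀ a b c, (a, c) ∈ τ → a < b → b < c → A b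
  nested : ∀ a b c d, (a, d) ∈ τ → (b, c) ∈ τ → a < b → c < d → s a = s b
  mem_pending : ∀ c ∈ Δ, c ∈ B ∧ A c
  pending_sign : ∀ c ∈ Δ, s c = -ε
  pending_ne : ∀ c ∈ Δ, ∀ x y, (x, y) ∈ τ → c ≠ x ∧ c ≠ y ∧ (x < c → y < c)
  pending_covered : ∀ c ∈ Δ, ∀ b ∈ B, b < c → A b
  pending_nested : ∀ c ∈ Δ, ∀ x y, (x, y) ∈ τ → y < c → s x = ε

variable {B B' : Finset ι} {A : ι → Prop} {ε : ℤˣ} {s : ι → ℤˣ} {τ : Finset (ι × ι)}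
  {Δ : Finset ι} {k : ι}

theorem IsArcPattern.congr_sign (h : IsArcPattern B A ε s τ ∅) (ε' : ℤˣ) :
    IsArcPattern B A ε' s τ ∅ :=
  { h with
    mem_pending := by simp
    pending_sign := by simp
    pending_ne := by simp
    pending_covered := by simp
    pending_nested := by simp }

/-- An absent least element cannot end an arc, and it would lie under every pending arc, so
condition (2) leaves nothing pending. -/
theorem isArcPattern_of_not_mem (hB : ∀ j, j ∈ B ↔ k ≤ j) (hB' : ∀ j, j ∈ B' ↔ k < j)
    (hk : ¬A k) :
    IsArcPattern B A ε s τ Δ ↔ IsArcPattern B' A ε s τ Δ ∧ Δ = ∅ := by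
  constructor
  · intro h
    obtain ⟨h1, h2, h3, h4, h5, h6, h7, h8, h9, h10, h11, h12, h13, h14⟩ := h
    have hΔ : Δ = ∅ := by
      by_contra hne
      obtain ⟨c, hc⟩ := Finset.nonempty_iff_ne_empty.2 hne
      have hcB := h10 c hc
      rcases ((hB c).1 hcB.1).eq_or_lt with rfl | hlt
      · exact hk hcB.2
      · exact hk (h13 c hc k ((hB k).2 le_rfl) hlt)
    refine ⟨⟨?_, h2, ?_, ?_, h5, h6, h7, h8, h9, ?_, h11, h12, ?_, h14⟩, hΔ⟩ <;> grind
  · rintro ⟨h, rfl⟩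
    obtain ⟨h1, h2, h3, h4, h5, h6, h7, h8, h9, h10, h11, h12, h13, h14⟩ := h
    refine ⟨?_, h2, ?_, ?_, h5, h6, h7, h8, h9, ?_, h11, h12, ?_, h14⟩ <;> grind

/-- All conditions except those on `s` pass to subsets. -/
theorem IsArcPattern.restrict (hB : ∀ j, j ∈ B ↔ k ≤ j) (hB' : ∀ j, j ∈ B' ↔ k < j)
    (h : IsArcPattern B A ε s τ Δ) {τ' : Finset (ι × ι)} {Δ' : Finset ι} (hτ : τ' ⊆ τ)
    (hΔ : Δ' ⊆ Δ) (hτk : ∀ c, (k, c) ∉ τ') (hΔk : k ∉ Δ') :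
    IsArcPattern B' A ε (Function.update s k 1) τ' Δ' := by
  have hu : ∀ j, k < j → Function.update s k 1 j = s j :=
    fun j hj => Function.update_of_ne hj.ne' _ _
  have hl : ∀ a c, (a, c) ∈ τ' → k < a ∧ k < c := by
    intro a c hac
    have h1 : k < a := lt_of_le_of_ne ((hB a).1 (h.left a c (hτ hac)).1) (by
      rintro rfl
      exact hτk c hac)
    exact ⟨h1, h1.trans (h.lt a c (hτ hac))⟩
  have hp : ∀ c ∈ Δ', k < c := fun c hc =>
    lt_of_le_of_ne ((hB c).1 (h.mem_pending c (hΔ hc)).1) (by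
      rintro rfl
      exact hΔk hc)
  exact
    { sign := fun j hj => by
        rcases eq_or_ne j k with rfl | hne
        · exact Function.update_self _ _ _
        · rw [Function.update_of_ne hne]
          exact h.sign j fun hjB =>
            hj ⟨(hB' j).2 (lt_of_le_of_ne ((hB j).1 hjB.1) hne.symm), hjB.2⟩
      lt := fun a c hac => h.lt a c (hτ hac)
      left := fun a c hac => ⟨(hB' a).2 (hl a c hac).1, (h.left a c (hτ hac)).2⟩
      right := fun a c hac => ⟨(hB' c).2 (hl a c hac).2, (h.right a c (hτ hac)).2⟩
      disjoint := fun a b c d hab hcd => h.disjoint a b c d (hτ hab) (hτ hcd)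
      noncrossing := fun a b c d hac hbd => h.noncrossing a b c d (hτ hac) (hτ hbd)
      opposite := fun a c hac => by
        rw [hu a (hl a c hac).1, hu c (hl a c hac).2]
        exact h.opposite a c (hτ hac)
      covered := fun a b c hac => h.covered a b c (hτ hac)
      nested := fun a b c d had hbc => by
        rw [hu a (hl a d had).1, hu b (hl b c hbc).1]
        exact h.nested a b c d (hτ had) (hτ hbc)
      mem_pending := fun c hc => ⟨(hB' c).2 (hp c hc), (h.mem_pending c (hΔ hc)).2⟩
      pending_sign := fun c hc => by
        rw [hu c (hp c hc)]
        exact h.pending_sign c (hΔ hc)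
      pending_ne := fun c hc x y hxy => h.pending_ne c (hΔ hc) x y (hτ hxy)
      pending_covered := fun c hc b hb =>
        h.pending_covered c (hΔ hc) b ((hB b).2 ((hB' b).1 hb).le)
      pending_nested := fun c hc x y hxy => by
        rw [hu x (hl x y hxy).1]
        exact h.pending_nested c (hΔ hc) x y (hτ hxy) }

theorem IsArcPattern.lt_left (hB' : ∀ j, j ∈ B' ↔ k < j) (h : IsArcPattern B' A ε s τ Δ)
    {a c : ι} (hac : (a, c) ∈ τ) : k < a := (hB' a).1 (h.left a c hac).1

theorem IsArcPattern.lt_right (hB' : ∀ j, j ∈ B' ↔ k < j) (h : IsArcPattern B' A ε s τ Δ)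
    {a c : ι} (hac : (a, c) ∈ τ) : k < c := (hB' c).1 (h.right a c hac).1

theorem IsArcPattern.lt_pending (hB' : ∀ j, j ∈ B' ↔ k < j) (h : IsArcPattern B' A ε s τ Δ)
    {c : ι} (hc : c ∈ Δ) : k < c := (hB' c).1 (h.mem_pending c hc).1

/-- A present value in no arc may carry any sign `u`: no condition on arcs, complete or pending,
involves the sign at an unmatched value. -/
theorem IsArcPattern.extend (hB : ∀ j, j ∈ B ↔ k ≤ j) (hB' : ∀ j, j ∈ B' ↔ k < j)
    (hk : A k) (h : IsArcPattern B' A ε s τ Δ) (u : ℤˣ) :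
    IsArcPattern B A ε (Function.update s k u) τ Δ := by
  have hu : ∀ j, k < j → Function.update s k u j = s j :=
    fun j hj => Function.update_of_ne hj.ne' _ _
  have hBB : ∀ j, j ∈ B' → j ∈ B := fun j hj => (hB j).2 ((hB' j).1 hj).le
  exact
    { h with
      sign := fun j hj => by
        rcases eq_or_ne j k with rfl | hne
        · exact absurd ⟨(hB j).2 le_rfl, hk⟩ hj
        · rw [Function.update_of_ne hne]
          exact h.sign j fun hjB => hj ⟨hBB j hjB.1, hjB.2⟩
      left := fun a c hac => ⟨hBB a (h.left a c hac).1, (h.left a c hac).2⟩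
      right := fun a c hac => ⟨hBB c (h.right a c hac).1, (h.right a c hac).2⟩
      opposite := fun a c hac => by
        rw [hu a (h.lt_left hB' hac), hu c (h.lt_right hB' hac)]
        exact h.opposite a c hac
      nested := fun a b c d had hbc => by
        rw [hu a (h.lt_left hB' had), hu b (h.lt_left hB' hbc)]
        exact h.nested a b c d had hbc
      mem_pending := fun c hc => ⟨hBB c (h.mem_pending c hc).1, (h.mem_pending c hc).2⟩
      pending_sign := fun c hc => by
        rw [hu c (h.lt_pending hB' hc)]
        exact h.pending_sign c hc
      pending_covered := fun c hc b hb hbc => by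
        rcases ((hB b).1 hb).eq_or_lt with rfl | hlt
        · exact hk
        · exact h.pending_covered c hc b ((hB' b).2 hlt) hbc
      pending_nested := fun c hc x y hxy => by
        rw [hu x (h.lt_left hB' hxy)]
        exact h.pending_nested c hc x y hxy }

theorem IsArcPattern.insert_pending (h : IsArcPattern B A ε s τ Δ) {c : ι}
    (hcB : c ∈ B ∧ A c) (hs : s c = -ε)
    (hne : ∀ x y, (x, y) ∈ τ → c ≠ x ∧ c ≠ y ∧ (x < c → y < c))
    (hcov : ∀ b ∈ B, b < c → A b) (hnest : ∀ x y, (x, y) ∈ τ → y < c → s x = ε) :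
    IsArcPattern B A ε s τ (insert c Δ) :=
  { h with
    mem_pending := by
      simp only [Finset.forall_mem_insert]
      exact ⟨hcB, h.mem_pending⟩
    pending_sign := by
      simp only [Finset.forall_mem_insert]
      exact ⟨hs, h.pending_sign⟩
    pending_ne := by
      simp only [Finset.forall_mem_insert]
      exact ⟨hne, h.pending_ne⟩
    pending_covered := by
      simp only [Finset.forall_mem_insert]
      exact ⟨hcov, h.pending_covered⟩
    pending_nested := by
      simp only [Finset.forall_mem_insert]
      exact ⟨hnest, h.pending_nested⟩ }

theorem IsArcPattern.erase_pending (h : IsArcPattern B A ε s τ Δ) (m : ι) :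
    IsArcPattern B A ε s τ (Δ.erase m) :=
  { h with
    mem_pending := fun c hc => h.mem_pending c (Finset.mem_of_mem_erase hc)
    pending_sign := fun c hc => h.pending_sign c (Finset.mem_of_mem_erase hc)
    pending_ne := fun c hc => h.pending_ne c (Finset.mem_of_mem_erase hc)
    pending_covered := fun c hc => h.pending_covered c (Finset.mem_of_mem_erase hc)
    pending_nested := fun c hc => h.pending_nested c (Finset.mem_of_mem_erase hc) }

/-- An arc opened at `k` lies inside all pending arcs, which started earlier, so noncrossing makes
it close first. -/
theorem IsArcPattern.lt_of_arc (hB : ∀ j, j ∈ B ↔ k ≤ j) (h : IsArcPattern B A ε s τ Δ) {c : ι}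
    (hc : (k, c) ∈ τ) : ∀ x ∈ Δ, c < x := by
  intro x hx
  have h1 := h.pending_ne x hx k c hc
  exact h1.2.2 (lt_of_le_of_ne ((hB x).1 (h.mem_pending x hx).1) h1.1.symm)

/-- Once `k` has been scanned, its arc becomes pending with right end `c`. The conditions it imposed
on later elements turn into the pending conditions at `c`, with `ε` in the role of the sign at `k`.
-/
theorem IsArcPattern.remove_arc (hB : ∀ j, j ∈ B ↔ k ≤ j) (hB' : ∀ j, j ∈ B' ↔ k < j)
    (h : IsArcPattern B A ε s τ Δ) {c : ι} (hc : (k, c) ∈ τ) (hs : s k = ε) :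
    IsArcPattern B' A ε (Function.update s k 1) (τ.erase (k, c)) (insert c Δ) := by
  have hkc := h.lt k c hc
  have hτ : ∀ x y, (x, y) ∈ τ.erase (k, c) → (x, y) ∈ τ ∧ c ≠ x ∧ c ≠ y ∧ k < x := by
    intro x y hxy
    rw [Finset.mem_erase, Ne, Prod.mk.injEq] at hxy
    have h5 := h.disjoint k c x y hc hxy.2
    refine ⟨hxy.2, h5.2.2, fun hcy => hxy.1 ?_,
      lt_of_le_of_ne ((hB x).1 (h.left x y hxy.2).1) fun hkx => hxy.1 ?_⟩
    · exact ⟨(h5.1 (Or.inr hcy)).1.symm, hcy.symm⟩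
    · exact ⟨hkx.symm, (h5.1 (Or.inl hkx)).2.symm⟩
  have h0 := h.restrict hB hB' (τ' := τ.erase (k, c)) (Δ' := Δ) (Finset.erase_subset _ _)
    subset_rfl (fun y hy => (hτ k y hy).2.2.2.false)
    (fun hk => (hkc.trans (h.lt_of_arc hB hc k hk)).false)
  refine h0.insert_pending ⟨(hB' c).2 hkc, (h.right k c hc).2⟩ ?_ ?_ ?_ ?_
  · rw [Function.update_of_ne hkc.ne', ← hs, h.opposite k c hc, neg_neg]
  · intro x y hxy
    obtain ⟨h1, h2, h3, h4⟩ := hτ x y hxy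
    exact ⟨h2, h3, fun hxc => h.noncrossing k x c y hc h1 h4 hxc⟩
  · exact fun b hb hbc => h.covered k b c hc ((hB' b).1 hb) hbc
  · intro x y hxy hyc
    obtain ⟨h1, h2, h3, h4⟩ := hτ x y hxy
    rw [Function.update_of_ne h4.ne', ← hs]
    exact (h.nested k x y c hc h1 h4 hyc).symm

/-- Inverse to `remove_arc`. Only the least pending right end can be joined to `k`: an arc to a
later one would cross the pending arc that ends at `m`. This is why recording the set of right ends
is enough. -/
theorem IsArcPattern.insert_arc (hB : ∀ j, j ∈ B ↔ k ≤ j) (hB' : ∀ j, j ∈ B' ↔ k < j)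
    (hk : A k) (h : IsArcPattern B' A ε s τ Δ) {m : ι} (hm : m ∈ Δ) (hmin : ∀ x ∈ Δ, m ≤ x) :
    IsArcPattern B A ε (Function.update s k ε) (insert (k, m) τ) (Δ.erase m) := by
  have hu : ∀ j, k < j → Function.update s k ε j = s j :=
    fun j hj => Function.update_of_ne hj.ne' _ _
  have huk : Function.update s k ε k = ε := Function.update_self _ _ _
  have hkm : k < m := h.lt_pending hB' hm
  have hτ : ∀ a b, (a, b) ∈ insert (k, m) τ ↔ (a = k ∧ b = m) ∨ (a, b) ∈ τ := by
    intro a b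
    rw [Finset.mem_insert, Prod.mk.injEq]
  have hΔ : ∀ x ∈ Δ.erase m, x ∈ Δ ∧ m < x := by
    intro x hx
    rw [Finset.mem_erase] at hx
    exact ⟨hx.2, lt_of_le_of_ne (hmin x hx.2) hx.1.symm⟩
  have h0 := (h.extend hB hB' hk ε).erase_pending m
  generalize Function.update s k ε = s' at hu huk h0
  exact
    { h0 with
      lt := by
        intro a c hac
        rcases (hτ a c).1 hac with ⟨rfl, rfl⟩ | hac
        · exact hkm
        · exact h0.lt a c hac
      left := by
        intro a c hac
        rcases (hτ a c).1 hac with ⟨rfl, rfl⟩ | hac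
        · exact ⟨(hB a).2 le_rfl, hk⟩
        · exact h0.left a c hac
      right := by
        intro a c hac
        rcases (hτ a c).1 hac with ⟨rfl, rfl⟩ | hac
        · exact ⟨(hB c).2 hkm.le, (h.mem_pending c hm).2⟩
        · exact h0.right a c hac
      disjoint := by
        intro a b c d hab hcd
        rcases (hτ a b).1 hab with ⟨rfl, rfl⟩ | hab' <;>
          rcases (hτ c d).1 hcd with ⟨rfl, rfl⟩ | hcd'
        · exact ⟨fun _ => ⟨rfl, rfl⟩, hkm.ne, hkm.ne'⟩
        · have h1 := h.pending_ne b hm c d hcd'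
          have h2 := h.lt_left hB' hcd'
          have h3 := h.lt_right hB' hcd'
          refine ⟨fun h => ?_, h3.ne, h1.1⟩
          rcases h with h | h
          · exact absurd h h2.ne
          · exact absurd h h1.2.1
        · have h1 := h.pending_ne d hm a b hab'
          have h2 := h.lt_left hB' hab'
          have h3 := h.lt_right hB' hab'
          refine ⟨fun h => ?_, h1.1.symm, h3.ne'⟩
          rcases h with h | h
          · exact absurd h h2.ne'
          · exact absurd h.symm h1.2.1
        · exact h0.disjoint a b c d hab' hcd'
      noncrossing := by
        intro a b c d hac hbd h1 h2
        rcases (hτ a c).1 hac with ⟨rfl, rfl⟩ | hac' <;>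
          rcases (hτ b d).1 hbd with ⟨rfl, rfl⟩ | hbd'
        · exact absurd h1 (lt_irrefl _)
        · exact (h.pending_ne c hm b d hbd').2.2 h2
        · exact absurd (h1.trans (h.lt_left hB' hac')) (lt_irrefl _)
        · exact h0.noncrossing a b c d hac' hbd' h1 h2
      opposite := by
        intro a c hac
        rcases (hτ a c).1 hac with ⟨rfl, rfl⟩ | hac
        · rw [huk, hu c hkm, h.pending_sign c hm, neg_neg]
        · exact h0.opposite a c hac
      covered := by
        intro a b c hac h1 h2
        rcases (hτ a c).1 hac with ⟨rfl, rfl⟩ | hac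
        · exact h.pending_covered c hm b ((hB' b).2 h1) h2
        · exact h0.covered a b c hac h1 h2
      nested := by
        intro a b c d had hbc h1 h2
        rcases (hτ a d).1 had with ⟨rfl, rfl⟩ | had' <;>
          rcases (hτ b c).1 hbc with ⟨rfl, rfl⟩ | hbc'
        · rfl
        · rw [huk, hu b h1]
          exact (h.pending_nested d hm b c hbc' h2).symm
        · exact absurd (h1.trans (h.lt_left hB' had')) (lt_irrefl _)
        · exact h0.nested a b c d had' hbc' h1 h2
      pending_ne := by
        intro c hc x y hxy
        rcases (hτ x y).1 hxy with ⟨rfl, rfl⟩ | hxy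
        · obtain ⟨h1, h2⟩ := hΔ c hc
          exact ⟨(hkm.trans h2).ne', h2.ne', fun _ => h2⟩
        · exact h0.pending_ne c hc x y hxy
      pending_nested := by
        intro c hc x y hxy h1
        rcases (hτ x y).1 hxy with ⟨rfl, rfl⟩ | hxy
        · exact huk
        · exact h0.pending_nested c hc x y hxy h1 }

/-! ### Counting arc patterns by scanning the least element -/

section Counting

variable [Fintype ι]

open Classical in
/-- The finite set of arc patterns with `d` pending arcs. -/
noncomputable def arcPatterns (B : Finset ι) (A : ι → Prop) (ε : ℤˣ) (d : ℕ) :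
    Finset ((ι → ℤˣ) × Finset (ι × ι) × Finset ι) :=
  Finset.univ.filter fun x => IsArcPattern B A ε x.1 x.2.1 x.2.2 ∧ x.2.2.card = d

theorem mem_arcPatterns {d : ℕ} {x : (ι → ℤˣ) × Finset (ι × ι) × Finset ι} :
    x ∈ arcPatterns B A ε d ↔ IsArcPattern B A ε x.1 x.2.1 x.2.2 ∧ x.2.2.card = d := by
  simp [arcPatterns]

/-- Without pending arcs, `ε` occurs in no condition. This frees the sign of an outermost arc. -/
theorem arcPatterns_zero_congr (B : Finset ι) (A : ι → Prop) (ε ε' : ℤˣ) :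
    arcPatterns B A ε 0 = arcPatterns B A ε' 0 := by
  ext ⟨s, τ, Δ⟩
  simp only [mem_arcPatterns, Finset.card_eq_zero]
  constructor <;>
  · rintro ⟨h, rfl⟩
    exact ⟨h.congr_sign _, rfl⟩

theorem card_arcPatterns_empty (A : ι → Prop) (ε : ℤˣ) (d : ℕ) :
    (arcPatterns ∅ A ε d).card = if d = 0 then 1 else 0 := by
  have key : ∀ x, x ∈ arcPatterns ∅ A ε d ↔ x = ((fun _ => 1), ∅, ∅) ∧ d = 0 := by
    rintro ⟨s, τ, Δ⟩
    rw [mem_arcPatterns]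
    constructor
    · rintro ⟨h, hd⟩
      have hΔ : Δ = ∅ := Finset.eq_empty_of_forall_notMem fun c hc => by
        simpa using (h.mem_pending c hc).1
      have hτ : τ = ∅ := Finset.eq_empty_of_forall_notMem fun c hc => by
        simpa using (h.left c.1 c.2 hc).1
      have hs : s = fun _ => 1 := funext fun j => h.sign j (by simp)
      simp only at hd
      rw [hΔ, Finset.card_empty] at hd
      exact ⟨by rw [hs, hτ, hΔ], hd.symm⟩
    · rintro ⟨hx, rfl⟩
      simp only [Prod.mk.injEq] at hx
      obtain ⟨rfl, rfl, rfl⟩ := hx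
      refine ⟨?_, rfl⟩
      constructor <;> simp
  split_ifs with hd
  · rw [Finset.card_eq_one]
    exact ⟨((fun _ => 1), ∅, ∅), Finset.ext fun x => by rw [key, Finset.mem_singleton]; simp [hd]⟩
  · rw [Finset.card_eq_zero]
    exact Finset.eq_empty_of_forall_notMem fun x hx => hd ((key x).1 hx).2

theorem card_arcPatterns_of_not (hB : ∀ j, j ∈ B ↔ k ≤ j) (hB' : ∀ j, j ∈ B' ↔ k < j)
    (hk : ¬A k) (d : ℕ) :
    (arcPatterns B A ε d).card = if d = 0 then (arcPatterns B' A ε 0).card else 0 := by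
  split_ifs with hd
  · subst hd
    congr 1
    ext ⟨s, τ, Δ⟩
    simp only [mem_arcPatterns, isArcPattern_of_not_mem hB hB' hk, Finset.card_eq_zero]
    tauto
  · rw [Finset.card_eq_zero]
    refine Finset.eq_empty_of_forall_notMem ?_
    rintro ⟨s, τ, Δ⟩ hx
    rw [mem_arcPatterns, isArcPattern_of_not_mem hB hB' hk] at hx
    refine hd ?_
    rw [← hx.2, hx.1.2, Finset.card_empty]

-- The factor 2 is the free sign at the unmatched element `k`. The inverse map resets this sign to
-- 1, the normalized value off `B'`.
open Classical in
theorem card_arcPatterns_free (hB : ∀ j, j ∈ B ↔ k ≤ j) (hB' : ∀ j, j ∈ B' ↔ k < j)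
    (hk : A k) (d : ℕ) :
    ((arcPatterns B A ε d).filter fun x => k ∉ x.2.2 ∧ ∀ c, (k, c) ∉ x.2.1).card =
      2 * (arcPatterns B' A ε d).card := by
  have h2 : Fintype.card ℤˣ = 2 := rfl
  rw [← h2, ← Finset.card_univ, ← Finset.card_product]
  symm
  refine Finset.card_nbij' (fun x => (Function.update x.2.1 k x.1, x.2.2))
    (fun y => (y.1 k, Function.update y.1 k 1, y.2)) ?_ ?_ ?_ ?_
  · rintro ⟨u, s, τ, Δ⟩ hx
    simp only [Finset.coe_product, Set.mem_prod, Finset.mem_coe, mem_arcPatterns,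
      Finset.mem_filter] at hx ⊢
    obtain ⟨-, h, hd⟩ := hx
    exact ⟨⟨h.extend hB hB' hk u, hd⟩, fun hkΔ => (h.lt_pending hB' hkΔ).false,
      fun c hc => (h.lt_left hB' hc).false⟩
  · rintro ⟨s, τ, Δ⟩ hx
    simp only [Finset.coe_product, Set.mem_prod, Finset.mem_coe, mem_arcPatterns,
      Finset.mem_filter] at hx ⊢
    obtain ⟨⟨h, hd⟩, hΔ, hτ⟩ := hx
    exact ⟨Finset.mem_univ _, h.restrict hB hB' subset_rfl subset_rfl hτ hΔ, hd⟩
  · rintro ⟨u, s, τ, Δ⟩ hx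
    simp only [Finset.coe_product, Set.mem_prod, Finset.mem_coe, mem_arcPatterns] at hx
    have hs : s k = 1 := hx.2.1.sign k fun hk' => ((hB' k).1 hk'.1).false
    simp only [Function.update_self, Function.update_idem]
    rw [← hs, Function.update_eq_self]
  · rintro ⟨s, τ, Δ⟩ _
    simp

-- Here `k` closes an open arc, so its sign must be `-ε` and one pending arc disappears.
open Classical in
theorem card_arcPatterns_pending (hB : ∀ j, j ∈ B ↔ k ≤ j) (hB' : ∀ j, j ∈ B' ↔ k < j)
    (hk : A k) (d : ℕ) :
    ((arcPatterns B A ε d).filter fun x => k ∈ x.2.2).card =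
      if d = 0 then 0 else (arcPatterns B' A ε (d - 1)).card := by
  split_ifs with hd
  · rw [Finset.card_eq_zero]
    refine Finset.eq_empty_of_forall_notMem ?_
    rintro ⟨s, τ, Δ⟩ hx
    rw [Finset.mem_filter, mem_arcPatterns, hd, Finset.card_eq_zero] at hx
    simp only at hx
    rw [hx.1.2] at hx
    simp at hx
  symm
  refine Finset.card_nbij' (fun x => (Function.update x.1 k (-ε), x.2.1, insert k x.2.2))
    (fun y => (Function.update y.1 k 1, y.2.1, y.2.2.erase k)) ?_ ?_ ?_ ?_
  · rintro ⟨s, τ, Δ⟩ hx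
    simp only [Finset.mem_coe, mem_arcPatterns, Finset.mem_filter] at hx ⊢
    obtain ⟨h, hdc⟩ := hx
    refine ⟨⟨(h.extend hB hB' hk (-ε)).insert_pending ⟨(hB k).2 le_rfl, hk⟩
      (Function.update_self _ _ _) (fun x y hxy => ?_) (fun b hb hbk => ?_)
      (fun x y hxy hyk => ?_), ?_⟩, Finset.mem_insert_self _ _⟩
    · have h1 := h.lt_left hB' hxy
      exact ⟨h1.ne, (h.lt_right hB' hxy).ne, fun hxk => absurd (h1.trans hxk) (lt_irrefl _)⟩
    · exact absurd (((hB b).1 hb).trans_lt hbk) (lt_irrefl _)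
    · exact absurd ((h.lt_right hB' hxy).trans hyk) (lt_irrefl _)
    · rw [Finset.card_insert_of_notMem fun hkΔ => (h.lt_pending hB' hkΔ).false]
      omega
  · rintro ⟨s, τ, Δ⟩ hx
    simp only [Finset.mem_coe, mem_arcPatterns, Finset.mem_filter] at hx ⊢
    obtain ⟨⟨h, hdc⟩, hΔ⟩ := hx
    refine ⟨h.restrict hB hB' subset_rfl (Finset.erase_subset _ _)
      (fun c hc => (h.pending_ne k hΔ k c hc).1 rfl) (Finset.notMem_erase _ _), ?_⟩
    rw [Finset.card_erase_of_mem hΔ, hdc]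
  · rintro ⟨s, τ, Δ⟩ hx
    simp only [Finset.mem_coe, mem_arcPatterns] at hx
    have hs : s k = 1 := hx.1.sign k fun hk' => ((hB' k).1 hk'.1).false
    have hΔ : k ∉ Δ := fun hkΔ => (hx.1.lt_pending hB' hkΔ).false
    simp only [Function.update_idem, Finset.erase_insert hΔ]
    rw [← hs, Function.update_eq_self]
  · rintro ⟨s, τ, Δ⟩ hx
    simp only [Finset.mem_coe, mem_arcPatterns, Finset.mem_filter] at hx
    simp only [Function.update_idem, Finset.insert_erase hx.2]
    rw [← hx.1.1.pending_sign k hx.2, Function.update_eq_self]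

-- Here `k` opens an arc of sign `ε`: joining `k` to the least pending right end is inverse to
-- making its arc pending.
open Classical in
theorem card_arcPatterns_arc (hB : ∀ j, j ∈ B ↔ k ≤ j) (hB' : ∀ j, j ∈ B' ↔ k < j)
    (hk : A k) (d : ℕ) :
    ((arcPatterns B A ε d).filter fun x => (∃ c, (k, c) ∈ x.2.1) ∧ x.1 k = ε).card =
      (arcPatterns B' A ε (d + 1)).card := by
  have hne : ∀ x ∈ arcPatterns B' A ε (d + 1), x.2.2.Nonempty := by
    intro x hx
    rw [mem_arcPatterns] at hx
    rw [← Finset.card_pos]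
    omega
  symm
  refine Finset.card_bij (fun x hx => (Function.update x.1 k ε,
    insert (k, x.2.2.min' (hne x hx)) x.2.1, x.2.2.erase (x.2.2.min' (hne x hx)))) ?_ ?_ ?_
  · rintro ⟨s, τ, Δ⟩ hx
    have hx' := mem_arcPatterns.1 hx
    simp only [mem_arcPatterns, Finset.mem_filter]
    refine ⟨⟨hx'.1.insert_arc hB hB' hk (Finset.min'_mem _ _) (Finset.min'_le _), ?_⟩,
      ⟨_, Finset.mem_insert_self _ _⟩, Function.update_self _ _ _⟩
    have := hx'.2
    simp only at this
    rw [Finset.card_erase_of_mem (Finset.min'_mem _ _), this, Nat.add_sub_cancel]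
  · rintro ⟨s, τ, Δ⟩ hx ⟨s', τ', Δ'⟩ hx' heq
    have h := (mem_arcPatterns.1 hx).1
    have h' := (mem_arcPatterns.1 hx').1
    simp only at h h'
    simp only [Prod.mk.injEq] at heq ⊢
    have hm := Finset.min'_mem Δ (hne _ hx)
    have hm' := Finset.min'_mem Δ' (hne _ hx')
    generalize Δ.min' (hne _ hx) = m at *
    generalize Δ'.min' (hne _ hx') = m' at *
    obtain ⟨e1, e2, e3⟩ := heq
    have hτk : ∀ c, (k, c) ∉ τ := fun c hc => (h.lt_left hB' hc).false
    have hτk' : ∀ c, (k, c) ∉ τ' := fun c hc => (h'.lt_left hB' hc).false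
    -- Patterns on `B'` have no arc at `k`, so the inserted arc is recognized as the only one there.
    have hmm : m = m' := by
      have : (k, m) ∈ insert (k, m') τ' := e2 ▸ Finset.mem_insert_self _ _
      rcases Finset.mem_insert.1 this with h1 | h1
      · exact (Prod.mk.inj h1).2
      · exact absurd h1 (hτk' m)
    subst hmm
    refine ⟨?_, ?_, ?_⟩
    · funext j
      rcases eq_or_ne j k with rfl | hj
      · rw [h.sign j fun hk' => ((hB' j).1 hk'.1).false,
          h'.sign j fun hk' => ((hB' j).1 hk'.1).false]
      · have := congrFun e1 j
        rwa [Function.update_of_ne hj, Function.update_of_ne hj] at this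
    · rw [← Finset.erase_insert (hτk m), e2, Finset.erase_insert (hτk' m)]
    · rw [← Finset.insert_erase hm, e3, Finset.insert_erase hm']
  · rintro ⟨s, τ, Δ⟩ hx
    simp only [mem_arcPatterns, Finset.mem_filter] at hx
    obtain ⟨⟨h, hd⟩, ⟨c, hc⟩, hs⟩ := hx
    have hlt := h.lt_of_arc hB hc
    have hcΔ : c ∉ Δ := fun hcΔ => (hlt c hcΔ).false
    have hmem : (Function.update s k 1, τ.erase (k, c), insert c Δ) ∈
        arcPatterns B' A ε (d + 1) := by
      rw [mem_arcPatterns]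
      refine ⟨h.remove_arc hB hB' hc hs, ?_⟩
      simp only
      rw [Finset.card_insert_of_notMem hcΔ, hd]
    refine ⟨_, hmem, ?_⟩
    have hmin : (insert c Δ).min' (hne _ hmem) = c := by
      refine le_antisymm (Finset.min'_le _ _ (Finset.mem_insert_self _ _)) ?_
      refine Finset.le_min' _ _ _ fun y hy => ?_
      rcases Finset.mem_insert.1 hy with rfl | hy
      · exact le_rfl
      · exact (hlt y hy).le
    simp only [hmin, Function.update_idem, Finset.erase_insert hcΔ, Finset.insert_erase hc]
    rw [← hs, Function.update_eq_self]

-- The element `k` closes a pending arc, is unmatched, or opens an arc; these cases are exclusive by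
-- `pending_ne`. If `d = 0` an opening arc has either sign, otherwise condition (3) forces `ε`.
open Classical in
theorem card_arcPatterns_of_mem (hB : ∀ j, j ∈ B ↔ k ≤ j) (hB' : ∀ j, j ∈ B' ↔ k < j)
    (hk : A k) (d : ℕ) :
    (arcPatterns B A ε d).card = 2 * (arcPatterns B' A ε d).card +
      if d = 0 then (arcPatterns B' A 1 1).card + (arcPatterns B' A (-1) 1).card
      else (arcPatterns B' A ε (d - 1)).card + (arcPatterns B' A ε (d + 1)).card := by
  rw [← Finset.card_filter_add_card_filter_not (s := arcPatterns B A ε d) (fun x => k ∈ x.2.2),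
    ← Finset.card_filter_add_card_filter_not (s := (arcPatterns B A ε d).filter fun x => k ∉ x.2.2)
      (fun x => ∃ c, (k, c) ∈ x.2.1), Finset.filter_filter, Finset.filter_filter,
    card_arcPatterns_pending hB hB' hk]
  have e1 : (arcPatterns B A ε d).filter (fun x => k ∉ x.2.2 ∧ ¬∃ c, (k, c) ∈ x.2.1) =
      (arcPatterns B A ε d).filter fun x => k ∉ x.2.2 ∧ ∀ c, (k, c) ∉ x.2.1 := by
    simp only [not_exists]
  have e2 : (arcPatterns B A ε d).filter (fun x => k ∉ x.2.2 ∧ ∃ c, (k, c) ∈ x.2.1) =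
      (arcPatterns B A ε d).filter fun x => ∃ c, (k, c) ∈ x.2.1 := by
    refine Finset.filter_congr fun x hx => ?_
    rw [mem_arcPatterns] at hx
    refine ⟨fun h => h.2, fun h => ⟨fun hkΔ => ?_, h⟩⟩
    obtain ⟨c, hc⟩ := h
    exact (hx.1.pending_ne k hkΔ k c hc).1 rfl
  rw [e1, e2, card_arcPatterns_free hB hB' hk]
  split_ifs with hd
  · subst hd
    -- With nothing pending, `ε` may be renamed to the actual sign `u` of `k`.
    have e3 : ∀ u : ℤˣ, ((arcPatterns B A ε 0).filter fun x =>
        (∃ c, (k, c) ∈ x.2.1) ∧ x.1 k = u).card = (arcPatterns B' A u 1).card := by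
      intro u
      rw [arcPatterns_zero_congr B A ε u, card_arcPatterns_arc hB hB' hk]
    rw [← e3 1, ← e3 (-1), ← Finset.card_filter_add_card_filter_not
      (s := (arcPatterns B A ε 0).filter fun x => ∃ c, (k, c) ∈ x.2.1) (fun x => x.1 k = 1),
      Finset.filter_filter, Finset.filter_filter]
    have e4 : (arcPatterns B A ε 0).filter (fun x => (∃ c, (k, c) ∈ x.2.1) ∧ ¬x.1 k = 1) =
        (arcPatterns B A ε 0).filter fun x => (∃ c, (k, c) ∈ x.2.1) ∧ x.1 k = -1 := by
      refine Finset.filter_congr fun x _ => ?_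
      rcases Int.units_eq_one_or (x.1 k) with h | h <;> simp [h]
    rw [e4]
    ring
  -- As `d ≠ 0`, some pending arc surrounds the arc at `k`, whose sign is therefore `ε`.
  · have e3 : (arcPatterns B A ε d).filter (fun x => ∃ c, (k, c) ∈ x.2.1) =
        (arcPatterns B A ε d).filter fun x => (∃ c, (k, c) ∈ x.2.1) ∧ x.1 k = ε := by
      refine Finset.filter_congr fun x hx => ?_
      rw [mem_arcPatterns] at hx
      refine ⟨fun h => ⟨h, ?_⟩, fun h => h.1⟩
      obtain ⟨c, hc⟩ := h
      obtain ⟨y, hy⟩ := Finset.card_pos.1 (hx.2 ▸ Nat.pos_of_ne_zero hd)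
      exact hx.1.pending_nested y hy k c hc (hx.1.lt_of_arc hB hc y hy)
    rw [e3, card_arcPatterns_arc hB hB' hk]
    ring

end Counting

end ArcPatterns

/-- The number of arc patterns on a final segment of `Fin n` depends only on the word of presences
and absences. -/
theorem card_arcPatterns_fin {n : ℕ} (A : Fin n → Prop) [DecidablePred A] (m k d : ℕ)
    (hkm : k + m = n) (ε : ℤˣ) :
    (arcPatterns (Finset.univ.filter fun j : Fin n => k ≤ j) A ε d).card =
      arcCount (List.ofFn fun i : Fin m => decide (A ⟨k + i, by omega⟩)) d := by
  induction m generalizing k d ε with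
  | zero =>
    have : (Finset.univ.filter fun j : Fin n => k ≤ j) = ∅ := by
      refine Finset.filter_eq_empty_iff.2 fun j _ => ?_
      have := j.2
      omega
    rw [this, card_arcPatterns_empty]
    simp [arcCount]
  | succ m ih =>
    have hk : k < n := by omega
    have hB : ∀ j, j ∈ (Finset.univ.filter fun j : Fin n => k ≤ j) ↔ (⟨k, hk⟩ : Fin n) ≤ j := by
      intro j
      simp [Fin.le_def]
    have hB' : ∀ j, j ∈ (Finset.univ.filter fun j : Fin n => k + 1 ≤ j) ↔
        (⟨k, hk⟩ : Fin n) < j := by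
      intro j
      simp [Fin.lt_def]
    have ih' : ∀ d ε, (arcPatterns (Finset.univ.filter fun j : Fin n => k + 1 ≤ j) A ε d).card =
        arcCount (List.ofFn fun i : Fin m => decide (A ⟨k + i.succ, by simp; omega⟩)) d := by
      intro d ε
      rw [ih (k + 1) d (by omega)]
      congr 2
      funext i
      congr 3
      simp only [Fin.val_succ]
      omega
    rw [List.ofFn_succ]
    by_cases hA : A ⟨k, hk⟩
    · have : decide (A ⟨k + ((0 : Fin (m + 1)) : ℕ), by simpa using hk⟩) = true := by
        simpa using hA
      rw [this, card_arcPatterns_of_mem hB hB' hA, arcCount]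
      simp only [ih']
      congr 1
      -- By induction the counts for `ε = 1` and `ε = -1` are equal, which gives the factor 2 in
      -- `arcCount`.
      split_ifs
      · ring
      · rfl
    · have : decide (A ⟨k + ((0 : Fin (m + 1)) : ℕ), by simpa using hk⟩) = false := by
        simpa using hA
      rw [this, card_arcPatterns_of_not hB hB' hA, arcCount, ih']

/-! ### Tuples with prescribed fiber sizes -/

section Fibers

variable {n : ℕ} {C : Type*} [DecidableEq C]

/-- The number of occurrences of `c` among the values of `f`. -/
def fiberCard (f : Fin n → C) (c : C) : ℕ := (Finset.univ.filter fun i => f i = c).card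

theorem fiberCard_comp (f : Fin n → C) (π : Equiv.Perm (Fin n)) :
    fiberCard (f ∘ π) = fiberCard f := by
  funext c
  refine Finset.card_bij (fun i _ => π i) (fun i hi => ?_) (fun i _ j _ hij => π.injective hij)
    fun j hj => ⟨π.symm j, ?_, π.apply_symm_apply j⟩
  · simpa using hi
  · simpa using hj

/-- Fibers of equal size are in bijection, and such bijections glue to a permutation. -/
theorem exists_perm_of_fiberCard_eq {f g : Fin n → C} (h : fiberCard f = fiberCard g) :
    ∃ π : Equiv.Perm (Fin n), f = g ∘ π := by
  have e : ∀ c, Nonempty ({i // f i = c} ≃ {i // g i = c}) := fun c => by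
    refine ⟨Fintype.equivOfCardEq ?_⟩
    rw [Fintype.card_subtype, Fintype.card_subtype]
    exact congrFun h c
  refine ⟨Equiv.ofFiberEquiv fun c => (e c).some, ?_⟩
  funext i
  exact (Equiv.ofFiberEquiv_map (fun c => (e c).some) i).symm

theorem sum_fiberCard [Fintype C] (f : Fin n → C) : ∑ c, fiberCard f c = n := by
  have := Finset.card_eq_sum_card_fiberwise (f := f) (s := Finset.univ) (t := Finset.univ)
    (fun _ _ => Finset.mem_coe.2 (Finset.mem_univ _))
  rw [Finset.card_univ, Fintype.card_fin] at this
  exact this.symm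

theorem exists_fiberCard_eq [Fintype C] (μ : C → ℕ) (h : ∑ c, μ c = n) :
    ∃ f : Fin n → C, fiberCard f = μ := by
  have hc : Fintype.card (Σ c, Fin (μ c)) = Fintype.card (Fin n) := by
    simp [h]
  let e := Fintype.equivOfCardEq hc
  refine ⟨fun i => (e.symm i).1, ?_⟩
  funext c
  rw [fiberCard, ← Fintype.card_subtype]
  conv_rhs => rw [← Fintype.card_fin (μ c)]
  refine Fintype.card_congr ((Equiv.subtypeEquiv e.symm (q := fun x => x.1 = c) ?_).trans
    (Equiv.sigmaSubtype c))
  intro i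
  rfl

end Fibers

/-! ### Parking functions and forest words -/

/-- The height before letter `k` is `i - k` plus the sum of the earlier letters; it must be at least
1 there, and the final height must equal 1. -/
theorem isForestWord_ofFn_iff {n : ℕ} (i : ℕ) (α : Fin n → ℕ) :
    IsForestWord i (List.ofFn α) ↔
      (∀ k : Fin n, k + 1 ≤ i + ∑ j, if j < k then α j else 0) ∧ i + ∑ j, α j = n + 1 := by
  induction n generalizing i with
  | zero => simp [IsForestWord]
  | succ n ih =>
    rw [List.ofFn_succ, IsForestWord, ih, Fin.forall_fin_succ]
    simp only [Fin.sum_univ_succ, Fin.val_succ, Fin.succ_lt_succ_iff, Fin.not_lt_zero, if_false,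
      Finset.sum_const_zero, add_zero, Fin.val_zero, zero_add, Fin.succ_pos, if_true]
    constructor
    · rintro ⟨h1, h2, h3⟩
      refine ⟨⟨h1, fun k => ?_⟩, by omega⟩
      have := h2 k
      omega
    · rintro ⟨⟨h1, h2⟩, h3⟩
      refine ⟨h1, fun k => ?_, by omega⟩
      have := h2 k
      omega

theorem isParking_iff_card {n : ℕ} (p : Fin n → Fin n) :
    IsParking p ↔ ∀ i : Fin n, (i : ℕ) + 1 ≤ (Finset.univ.filter fun j => p j ≤ i).card := by
  have hmono : Monotone (sortTuple p) := Tuple.monotone_sort p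
  have hcard : ∀ i : Fin n, (Finset.univ.filter fun j => p j ≤ i).card =
      (Finset.univ.filter fun j => sortTuple p j ≤ i).card := by
    intro i
    symm
    refine Finset.card_bij (fun j _ => Tuple.sort p j) (fun j hj => ?_)
      (fun a _ b _ hab => (Tuple.sort p).injective hab)
      fun j hj => ⟨(Tuple.sort p).symm j, ?_, Equiv.apply_symm_apply _ _⟩
    · exact Finset.mem_filter.2 ⟨Finset.mem_univ _, (Finset.mem_filter.1 hj).2⟩
    · refine Finset.mem_filter.2 ⟨Finset.mem_univ _, ?_⟩
      change p (Tuple.sort p ((Tuple.sort p).symm j)) ≤ i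
      rw [Equiv.apply_symm_apply]
      exact (Finset.mem_filter.1 hj).2
  constructor
  · intro h i
    rw [hcard, ← Fin.card_Iic i]
    refine Finset.card_le_card fun j hj => ?_
    simp only [Finset.mem_Iic, Finset.mem_filter, Finset.mem_univ, true_and] at hj ⊢
    exact (hmono hj).trans (h i)
  · intro h i
    by_contra hlt
    have h1 := h i
    rw [hcard] at h1
    have h2 : (Finset.univ.filter fun j => sortTuple p j ≤ i) ⊆ Finset.Iio i := by
      intro j hj
      simp only [Finset.mem_Iio, Finset.mem_filter, Finset.mem_univ, true_and] at hj ⊢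
      by_contra hij
      exact hlt ((hmono (not_lt.1 hij)).trans hj)
    have h3 := Finset.card_le_card h2
    rw [Fin.card_Iio] at h3
    omega

/-- The parking inequality at `i` is the height condition at `i + 1`. The two unmatched cases, the
height at 0 and the inequality at the last index, hold automatically because the contents add up to
`n`. -/
theorem isParking_iff {n : ℕ} (p : Fin n → Fin n) :
    IsParking p ↔ IsForestWord 1 (List.ofFn (content p)) := by
  have hcard : ∀ i : Fin n, (Finset.univ.filter fun j => p j ≤ i).card =
      ∑ k, if k ≤ i then content p k else 0 := by
    intro i
    rw [← Finset.sum_filter, Finset.card_eq_sum_card_fiberwise (f := p)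
      (t := Finset.univ.filter fun k => k ≤ i) (fun j hj => by simpa using hj)]
    refine Finset.sum_congr rfl fun k hk => ?_
    rw [Finset.mem_filter] at hk
    rw [content, Finset.filter_filter]
    congr 1
    refine Finset.filter_congr fun j _ => ⟨fun h => h.2, fun h => ⟨h ▸ hk.2, h⟩⟩
  have htot : ∑ k, content p k = n := sum_content p
  rw [isParking_iff_card, isForestWord_ofFn_iff]
  simp only [hcard, htot, Nat.add_comm 1 n, and_true]
  constructor
  · intro h k
    rcases Nat.eq_zero_or_pos (k : ℕ) with h0 | h0
    · omega
    · have := h ⟨k - 1, by omega⟩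
      have he : ∀ j : Fin n, j ≤ ⟨(k : ℕ) - 1, by omega⟩ ↔ j < k := fun j => by
        rw [Fin.le_def, Fin.lt_def]
        simp only
        omega
      simp only [he] at this
      omega
  · intro h i
    by_cases hi : (i : ℕ) + 1 < n
    · have := h ⟨i + 1, hi⟩
      have he : ∀ j : Fin n, j < ⟨(i : ℕ) + 1, hi⟩ ↔ j ≤ i := fun j => by
        rw [Fin.le_def, Fin.lt_def]
        simp only
        omega
      simp only [he] at this
      omega
    · have he : ∀ j : Fin n, j ≤ i := fun j => by
        rw [Fin.le_def]
        omega
      simp only [he, if_true, htot]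
      omega

theorem content_eq_fiberCard {n : ℕ} (p : Fin n → Fin n) : content p = fiberCard p := rfl

theorem sortTuple_eq_of_content_eq {n : ℕ} {p p' : Fin n → Fin n} (h : content p = content p') :
    sortTuple p = sortTuple p' := by
  obtain ⟨π, rfl⟩ := exists_perm_of_fiberCard_eq h
  exact sortTuple_comp p' π

theorem content_sortTuple {n : ℕ} (p : Fin n → Fin n) : content (sortTuple p) = content p :=
  content_comp p _

theorem sortTuple_sortTuple {n : ℕ} (p : Fin n → Fin n) :
    sortTuple (sortTuple p) = sortTuple p := sortTuple_comp p _

theorem prod_shape {n : ℕ} (p : Fin n → Fin n) (g : ℕ → SymFun) :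
    ((shape p).parts.map g).prod = ∏ k, if 0 < content p k then g (content p k) else 1 := by
  rw [shape, Nat.Partition.ofSums]
  simp only [Multiset.filter_map, Multiset.map_map]
  rw [← Finset.prod_filter]
  simp only [Finset.prod, Finset.filter, Nat.pos_iff_ne_zero]
  rfl

theorem isOddPartition_shape {n : ℕ} (p : Fin n → Fin n) :
    IsOddPartition (shape p) ↔ ∀ k, 0 < content p k → Odd (content p k) := by
  rw [IsOddPartition, shape, Nat.Partition.ofSums]
  simp only [Multiset.mem_filter, Multiset.mem_map, Finset.mem_val, Finset.mem_univ, true_and]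
  constructor
  · intro h k hk
    exact h _ ⟨⟨k, rfl⟩, hk.ne'⟩
  · rintro h _ ⟨⟨k, rfl⟩, hk⟩
    exact h k (Nat.pos_of_ne_zero hk)

/-! ### The series identities behind shiftification -/

theorem coeff_rescale_neg_one {R : Type*} [CommRing R] (F : PowerSeries R) (k : ℕ) :
    PowerSeries.coeff k (PowerSeries.rescale (-1 : R) F) =
      if Odd k then -PowerSeries.coeff k F else PowerSeries.coeff k F := by
  rw [PowerSeries.coeff_rescale]
  split_ifs with hk
  · rw [hk.neg_one_pow, neg_one_mul]
  · rw [(Nat.not_odd_iff_even.1 hk).neg_one_pow, one_mul]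

/-- The generating function `∑ sh(h_k) X^k`. -/
noncomputable def shSeries : PowerSeries SymFun := PowerSeries.mk fun k => sh (h k)

/-- The generating function of the `P_k` with `k` odd. -/
noncomputable def oddSeries : PowerSeries SymFun := PowerSeries.mk fun k => if Odd k then P k else 0

/-- In degree 0, which `sh_h` does not cover, both sides are 1. -/
theorem shSeries_eq : shSeries = PowerSeries.mk h * PowerSeries.mk e := by
  ext1 k
  rw [shSeries, PowerSeries.coeff_mk]
  rcases Nat.eq_zero_or_pos k with rfl | hk
  · rw [h_zero, map_one, PowerSeries.coeff_mul]
    simp [h_zero, e_zero]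
  · rw [sh_h k hk, two_smul_P]

/-- The product `H(X) E(X) H(-X) E(-X)` collapses by using `E(-X) H(X) = 1` and its image under `X ↦
-X`. -/
theorem shSeries_mul_rescale : shSeries * PowerSeries.rescale (-1 : SymFun) shSeries = 1 := by
  have h1 := rescale_e_mul_h
  have h2 := congrArg (PowerSeries.rescale (-1 : SymFun)) h1
  rw [map_mul, map_one, rescale_involutive] at h2
  rw [shSeries_eq, map_mul]
  linear_combination (PowerSeries.mk e * PowerSeries.rescale (-1 : SymFun) (PowerSeries.mk h)) * h1 +
    h2

/-- Subtracting the series at `-X` doubles the odd coefficients, which are already `2 P_k`. -/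
theorem four_mul_oddSeries : 4 * oddSeries = shSeries - PowerSeries.rescale (-1 : SymFun) shSeries := by
  have h4 : (4 : PowerSeries SymFun) = PowerSeries.C 4 := (map_ofNat _ 4).symm
  ext1 k
  rw [h4, PowerSeries.coeff_C_mul, map_sub, coeff_rescale_neg_one, oddSeries, shSeries,
    PowerSeries.coeff_mk, PowerSeries.coeff_mk]
  rcases Nat.eq_zero_or_pos k with rfl | hk
  · simp
  · have h2 : sh (h k) = 2 * P k := by
      rw [sh_h k hk, Algebra.smul_def, map_ofNat]
    rw [h2]
    split_ifs <;> ring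

theorem coeff_zero_shSeries : PowerSeries.coeff 0 shSeries = 1 := by
  rw [shSeries, PowerSeries.coeff_mk, h_zero, map_one]

theorem constantCoeff_shSeries : PowerSeries.constantCoeff shSeries = 1 := by
  rw [← PowerSeries.coeff_zero_eq_constantCoeff_apply, coeff_zero_shSeries]

theorem SH_eq_lukEval (n : ℕ) : SH n = lukEval shSeries (n + 1) PowerSeries.X := by
  classical
  have h1 := sum_isForestWord shSeries coeff_zero_shSeries n 0 n (by omega)
  rw [zero_add, pow_one] at h1
  rw [← h1, SH, PF, map_sum, ← Finset.sum_filter]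
  refine Finset.sum_bij (fun p _ => content p) ?_ ?_ ?_ ?_
  · intro p hp
    rw [Finset.mem_filter] at hp
    rw [Finset.mem_filter, Finset.mem_piAntidiag, ← isParking_iff]
    exact ⟨⟨sum_content p, by simp⟩, hp.2.1⟩
  · intro p hp p' hp' heq
    rw [Finset.mem_filter] at hp hp'
    rw [← hp.2.2, ← hp'.2.2]
    exact sortTuple_eq_of_content_eq heq
  · intro α hα
    rw [Finset.mem_filter, Finset.mem_piAntidiag] at hα
    obtain ⟨p, hp⟩ := exists_fiberCard_eq α hα.1.1
    have hp' : content (sortTuple p) = α := (content_sortTuple p).trans hp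
    refine ⟨sortTuple p, ?_, hp'⟩
    rw [Finset.mem_filter, isParking_iff, hp']
    exact ⟨Finset.mem_univ _, hα.2, sortTuple_sortTuple p⟩
  · intro p _
    rw [hProd, prod_shape, map_prod]
    refine Finset.prod_congr rfl fun k _ => ?_
    rw [shSeries, PowerSeries.coeff_mk]
    -- Values that do not occur contribute `sh (h 0) = 1`, so the product may run over all `k`.
    split_ifs with hk
    · rfl
    · rw [Nat.eq_zero_of_not_pos hk, h_zero]

/-! ### Sorted odd shifted parking functions -/

/-- The triples `(α, s, τ)` recording the contents, the signs and the matching of the sorted odd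
shifted parking functions of size `n`. -/
structure IsOddPattern {n : ℕ} (α : Fin n → ℕ) (s : Fin n → ℤˣ) (τ : Finset (Fin n × Fin n)) :
    Prop where
  forest : IsForestWord 1 (List.ofFn α)
  odd : ∀ k, 0 < α k → Odd (α k)
  pattern : IsArcPattern Finset.univ (fun k => 0 < α k) 1 s τ ∅

open Classical in
/-- The finite set of all triples `(α, s, τ)` with `IsOddPattern α s τ`. -/
noncomputable def oddPatterns (n : ℕ) :
    Finset ((Fin n → ℕ) × (Fin n → ℤˣ) × Finset (Fin n × Fin n)) :=
  (Finset.piAntidiag Finset.univ n ×ˢ Finset.univ ×ˢ Finset.univ).filter fun t =>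
    IsOddPattern t.1 t.2.1 t.2.2

theorem mem_oddPatterns {n : ℕ} {t : (Fin n → ℕ) × (Fin n → ℤˣ) × Finset (Fin n × Fin n)} :
    t ∈ oddPatterns n ↔ IsOddPattern t.1 t.2.1 t.2.2 := by
  simp only [oddPatterns, Finset.mem_filter, Finset.mem_product, Finset.mem_univ, and_true,
    Finset.mem_piAntidiag, implies_true]
  refine ⟨fun h => h.2, fun h => ⟨?_, h⟩⟩
  have h1 : 1 + Finset.univ.sum t.1 = n + 1 := ((isForestWord_ofFn_iff 1 t.1).1 h.forest).2
  omega

/-- For given contents the summand is independent of signs and matching, so the inner sum is a count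
given by `arcCount`. With `i = d = 0`, `sum_arcCount` then yields the same `lukEval` as
`SH_eq_lukEval`. -/
theorem sum_oddPatterns (n : ℕ) :
    ∑ t ∈ oddPatterns n, ∏ k, (if 0 < t.1 k then P (t.1 k) else 1) = SH n := by
  classical
  obtain ⟨Y, hY0, hY1, hY2⟩ := exists_arc_series (R := SymFun) (algebraMap ℂ SymFun (1 / 2)) (by
    rw [show (2 : SymFun) = algebraMap ℂ SymFun 2 from (map_ofNat _ 2).symm, ← map_mul]
    norm_num) shSeries (PowerSeries.rescale (-1 : SymFun) shSeries) oddSeries constantCoeff_shSeries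
    shSeries_mul_rescale four_mul_oddSeries
  have h1 := sum_arcCount shSeries oddSeries Y hY0 constantCoeff_shSeries (by simp [oddSeries])
    hY1 hY2 n 0 n 0 (by omega)
  rw [zero_add, pow_one, pow_zero, mul_one] at h1
  rw [SH_eq_lukEval, ← h1, oddPatterns, Finset.sum_filter, Finset.sum_product]
  refine Finset.sum_congr rfl fun α _ => ?_
  rw [← Finset.sum_filter]
  simp only [Finset.sum_const]
  by_cases hodd : ∀ k, 0 < α k → Odd (α k)
  · have hprod : ∏ k, (if 0 < α k then PowerSeries.coeff (α k) oddSeries else 1) =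
        ∏ k, if 0 < α k then P (α k) else 1 := by
      refine Finset.prod_congr rfl fun k _ => ?_
      split_ifs with hk
      · rw [oddSeries, PowerSeries.coeff_mk, if_pos (hodd k hk)]
      · rfl
    rw [hprod]
    split_ifs with hf
    · rw [nsmul_eq_mul]
      congr 2
      have h2 := card_arcPatterns_fin (fun k => 0 < α k) n 0 0 (by omega) 1
      simp only [Nat.zero_le, Finset.filter_true, zero_add, Fin.eta] at h2
      rw [← h2]
      refine Finset.card_bij (fun x _ => (x.1, x.2, ∅)) ?_ ?_ ?_
      · rintro ⟨s, τ⟩ hx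
        simp only [Finset.mem_filter] at hx
        rw [mem_arcPatterns]
        exact ⟨hx.2.pattern, rfl⟩
      · rintro ⟨s, τ⟩ _ ⟨s', τ'⟩ _ heq
        simpa using heq
      · rintro ⟨s, τ, Δ⟩ hx
        rw [mem_arcPatterns, Finset.card_eq_zero] at hx
        obtain ⟨hx, hΔ⟩ := hx
        simp only at hx hΔ
        subst hΔ
        refine ⟨(s, τ), ?_, rfl⟩
        simp only [Finset.mem_filter]
        exact ⟨by simp, hf, hodd, hx⟩
    · rw [Finset.filter_false_of_mem fun x _ hx => hf hx.forest]
      simp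
  -- An even positive content admits no pattern, and on the other side its coefficient in
  -- `oddSeries` is 0.
  · rw [Finset.filter_false_of_mem fun x _ hx => hodd hx.odd, Finset.card_empty, zero_smul]
    push Not at hodd
    obtain ⟨k, hk, hko⟩ := hodd
    have : ∏ k, (if 0 < α k then PowerSeries.coeff (α k) oddSeries else 1) = 0 := by
      refine Finset.prod_eq_zero (Finset.mem_univ k) ?_
      rw [if_pos hk, oddSeries, PowerSeries.coeff_mk, if_neg hko]
    rw [this, mul_zero, ite_self]

/-- The product of the signs `σ_i` with `p_i = k`. -/
def fiberSign {n : ℕ} (p : Fin n → Fin n) (σ : Fin n → ℤˣ) (k : Fin n) : ℤˣ :=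
  ∏ i with p i = k, σ i

theorem signBar_eq {n : ℕ} (p : Fin n → Fin n) (σ : Fin n → ℤˣ) (k : Fin n) :
    signBar p σ k = if 0 < content p k then (fiberSign p σ k : ℤ) else 0 := by
  rw [signBar, fiberSign, Units.coe_prod]

theorem content_pos_iff {n : ℕ} (p : Fin n → Fin n) (k : Fin n) :
    0 < content p k ↔ k ∈ Set.range p := by
  rw [content, Finset.card_pos, Finset.filter_nonempty_iff]
  simp

theorem fiberSign_of_content_eq_zero {n : ℕ} (p : Fin n → Fin n) (σ : Fin n → ℤˣ) {k : Fin n}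
    (hk : ¬0 < content p k) : fiberSign p σ k = 1 := by
  rw [fiberSign, Finset.card_eq_zero.1 (Nat.eq_zero_of_not_pos hk), Finset.prod_empty]

theorem OShPf.isOddPattern {n : ℕ} (x : OShPf n) :
    IsOddPattern (content x.p) (fiberSign x.p x.σ) x.τ := by
  have hpos : ∀ a c, (a, c) ∈ x.τ → 0 < content x.p a ∧ 0 < content x.p c := fun a c hac => by
    rw [content_pos_iff, content_pos_iff]
    exact x.matching.appears _ hac
  have hdis := x.matching.disjoint
  refine ⟨(isParking_iff _).1 x.parking, (isOddPartition_shape _).1 x.odd, ?_⟩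
  exact
    { sign := fun j hj => fiberSign_of_content_eq_zero _ _ fun h => hj ⟨Finset.mem_univ _, h⟩
      lt := fun a c hac => x.matching.lt _ hac
      left := fun a c hac => ⟨Finset.mem_univ _, (hpos a c hac).1⟩
      right := fun a c hac => ⟨Finset.mem_univ _, (hpos a c hac).2⟩
      disjoint := fun a b c d hab hcd => by
        by_cases heq : (a, b) = (c, d)
        · rw [Prod.mk.injEq] at heq
          obtain ⟨rfl, rfl⟩ := heq
          exact ⟨fun _ => ⟨rfl, rfl⟩, (x.matching.lt _ hab).ne, (x.matching.lt _ hab).ne'⟩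
        · obtain ⟨h1, h2, h3, h4⟩ := x.matching.disjoint _ hab _ hcd heq
          exact ⟨fun h => (h.elim h1 h4).elim, h2, h3⟩
      noncrossing := fun a b c d hac hbd hab hbc => by
        by_contra hdc
        refine x.matching.noncrossing a b c d hac hbd ⟨hab, hbc, ?_⟩
        -- The strict crossing is excluded by noncrossing, the case `c = d` by disjointness of arcs.
        refine lt_of_le_of_ne (not_lt.1 hdc) fun hcd => ?_
        exact (hdis _ hac _ hbd fun h => hab.ne (Prod.mk.inj h).1).2.2.2 hcd
      opposite := fun a c hac => by
        have h1 := x.opposite a c hac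
        rw [signBar_eq, signBar_eq, if_pos (hpos a c hac).1, if_pos (hpos a c hac).2] at h1
        exact Units.ext (by rw [h1, Units.val_neg])
      covered := fun a b c hac hab hbc => (content_pos_iff _ _).2 (x.covered a b c hac hab hbc)
      nested := fun a b c d had hbc hab hcd => by
        have h1 := x.nested a b c d had hbc hab (x.matching.lt _ hbc) hcd
        rw [signBar_eq, signBar_eq, if_pos (hpos a d had).1, if_pos (hpos b c hbc).1] at h1
        exact Units.ext h1
      mem_pending := by simp
      pending_sign := by simp
      pending_ne := by simp
      pending_covered := by simp
      pending_nested := by simp }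

/-- The odd shifted parking function with a given pattern. -/
def OShPf.ofPattern {n : ℕ} (p : Fin n → Fin n) (σ : Fin n → ℤˣ) (τ : Finset (Fin n × Fin n))
    (h : IsOddPattern (content p) (fiberSign p σ) τ) : OShPf n where
  p := p
  σ := σ
  τ := τ
  parking := (isParking_iff _).2 h.forest
  odd := (isOddPartition_shape _).2 h.odd
  matching :=
    { lt := fun x hx => h.pattern.lt x.1 x.2 hx
      appears := fun x hx => ⟨(content_pos_iff _ _).1 (h.pattern.left x.1 x.2 hx).2,
        (content_pos_iff _ _).1 (h.pattern.right x.1 x.2 hx).2⟩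
      disjoint := fun x hx y hy hne => by
        obtain ⟨h1, h2, h3⟩ := h.pattern.disjoint x.1 x.2 y.1 y.2 hx hy
        refine ⟨fun he => hne ?_, h2, h3, fun he => hne ?_⟩
        · exact Prod.ext he (h1 (Or.inl he)).2
        · exact Prod.ext (h1 (Or.inr he)).1 he
      noncrossing := fun a b c d hac hbd hlt =>
        (hlt.2.2.trans (h.pattern.noncrossing a b c d hac hbd hlt.1 hlt.2.1)).false }
  opposite := fun a c hac => by
    rw [signBar_eq, signBar_eq, if_pos (h.pattern.left a c hac).2,
      if_pos (h.pattern.right a c hac).2, h.pattern.opposite a c hac, Units.val_neg]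
  covered := fun a b c hac hab hbc => (content_pos_iff _ _).1 (h.pattern.covered a b c hac hab hbc)
  nested := fun a b c d had hbc hab _ hcd => by
    rw [signBar_eq, signBar_eq, if_pos (h.pattern.left a d had).2,
      if_pos (h.pattern.left b c hbc).2, h.pattern.nested a b c d had hbc hab hcd]

/-- Put the prescribed sign on one chosen position of each nonempty fiber and 1 on all other
positions. -/
theorem exists_fiberSign_eq {n : ℕ} (p : Fin n → Fin n) (s : Fin n → ℤˣ)
    (hs : ∀ k, ¬0 < content p k → s k = 1) : ∃ σ, fiberSign p σ = s := by
  have hrep : ∀ k, ∃ i, 0 < content p k → p i = k := by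
    intro k
    by_cases hk : 0 < content p k
    · obtain ⟨i, hi⟩ := (content_pos_iff p k).1 hk
      exact ⟨i, fun _ => hi⟩
    · exact ⟨k, fun h => absurd h hk⟩
  choose r hr using hrep
  refine ⟨fun i => if i = r (p i) then s (p i) else 1, ?_⟩
  funext k
  by_cases hk : 0 < content p k
  · rw [fiberSign, Finset.prod_eq_single (r k)]
    · rw [hr k hk, if_pos rfl]
    · intro i hi hne
      rw [(Finset.mem_filter.1 hi).2, if_neg hne]
    · intro hi
      exact (hi (Finset.mem_filter.2 ⟨Finset.mem_univ _, hr k hk⟩)).elim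
  · rw [fiberSign_of_content_eq_zero _ _ hk, hs k hk]

theorem sum_sortedOShPf (n : ℕ) :
    ∑ x ∈ sortedOShPf n, V (shape x.1) =
      ∑ t ∈ oddPatterns n, ∏ k, (if 0 < t.1 k then P (t.1 k) else 1) := by
  classical
  -- The value 0 of `signBar` at an absent entry becomes 1, the normalization used in
  -- `IsArcPattern`. Nothing is lost, since the contents record absence.
  let toUnit : (Fin n → ℤ) → Fin n → ℤˣ := fun s k => if s k = -1 then -1 else 1
  have hunit : ∀ (p : Fin n → Fin n) (σ : Fin n → ℤˣ),
      toUnit (signBar p σ) = fiberSign p σ := by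
    intro p σ
    funext k
    simp only [toUnit, signBar_eq]
    by_cases hk : 0 < content p k
    · rw [if_pos hk]
      rcases Int.units_eq_one_or (fiberSign p σ k) with h | h <;> simp [h]
    · rw [if_neg hk, fiberSign_of_content_eq_zero p σ hk]
      simp
  have hmem : ∀ x ∈ sortedOShPf n, ∃ y : OShPf n, y.sort = x := by
    intro x hx
    simpa [sortedOShPf] using hx
  refine Finset.sum_bij (fun x _ => (content x.1, toUnit x.2.1, x.2.2)) ?_ ?_ ?_ ?_
  · intro x hx
    obtain ⟨y, rfl⟩ := hmem x hx
    rw [mem_oddPatterns]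
    simp only [OShPf.sort, hunit, content_sortTuple]
    exact y.isOddPattern
  · intro x hx x' hx' heq
    obtain ⟨y, rfl⟩ := hmem x hx
    obtain ⟨y', rfl⟩ := hmem x' hx'
    simp only [OShPf.sort, hunit, content_sortTuple, Prod.mk.injEq] at heq ⊢
    obtain ⟨h1, h2, h3⟩ := heq
    refine ⟨sortTuple_eq_of_content_eq h1, ?_, h3⟩
    funext k
    rw [signBar_eq, signBar_eq, h1, h2]
  · rintro ⟨α, s, τ⟩ ht
    rw [mem_oddPatterns] at ht
    simp only at ht
    have hsum := ((isForestWord_ofFn_iff 1 α).1 ht.forest).2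
    obtain ⟨p, hp⟩ := exists_fiberCard_eq α (by omega : ∑ k, α k = n)
    rw [← content_eq_fiberCard] at hp
    subst hp
    obtain ⟨σ, rfl⟩ := exists_fiberSign_eq p s fun k hk => ht.pattern.sign k fun h => hk h.2
    refine ⟨(OShPf.ofPattern p σ τ ht).sort, Finset.mem_image_of_mem _ (Finset.mem_univ _), ?_⟩
    simp only [OShPf.sort, OShPf.ofPattern, hunit, content_sortTuple]
  · intro x _
    rw [V, prod_shape]

theorem isOddPartition_of_mem_sortedOShPf {n : ℕ}
    {x : (Fin n → Fin n) × (Fin n → ℤ) × Finset (Fin n × Fin n)} (hx : x ∈ sortedOShPf n) :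
    IsOddPartition (shape x.1) := by
  obtain ⟨y, -, rfl⟩ := Finset.mem_image.1 hx
  have : shape (sortTuple y.p) = shape y.p := shape_comp y.p _
  rw [OShPf.sort, this]
  exact y.odd

/-! ### Evaluation in finitely many variables -/

/-- The restriction of a symmetric function to the first `d` variables. -/
noncomputable def finEval (d : ℕ) : SymFun →ₐ[ℂ] MvPowerSeries (Fin d) ℂ :=
  (MvPowerSeries.killCompl (Fin.valEmbedding (n := d))).comp SymFun.val

theorem finEval_apply (d : ℕ) (f : SymFun) :
    finEval d f = MvPowerSeries.killCompl (Fin.valEmbedding (n := d)) (f : MvPowerSeries ℕ ℂ) := rfl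

/-- By symmetry a monomial of degree at most `d` can be moved into the first `d` variables, and
symmetric functions have bounded degree. -/
theorem ext_of_finEval {f g : SymFun} (hfg : ∀ d, finEval d f = finEval d g) : f = g := by
  obtain ⟨a, ha⟩ := f.2.2
  obtain ⟨b, hb⟩ := g.2.2
  refine ext_of_killCompl (d := max a b) (fun m hm => (ha m hm).trans (le_max_left _ _))
    (fun m hm => (hb m hm).trans (le_max_right _ _)) fun m' _ => ?_
  have h1 := congrArg (MvPowerSeries.coeff m') (hfg (max a b))
  rwa [finEval_apply, finEval_apply, MvPowerSeries.coeff_killCompl,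
    MvPowerSeries.coeff_killCompl] at h1

/-- The monomial in finitely many variables with exponents `ν`. -/
noncomputable def expMonomial {d : ℕ} (ν : Fin d → ℕ) : MvPowerSeries (Fin d) ℂ :=
  ∏ i, MvPowerSeries.X i ^ ν i

theorem coeff_expMonomial {d : ℕ} (ν : Fin d → ℕ) (m : Fin d →₀ ℕ) :
    MvPowerSeries.coeff m (expMonomial ν) = if ν = m then 1 else 0 := by
  classical
  have h1 : expMonomial ν = MvPowerSeries.monomial (Finsupp.equivFunOnFinite.symm ν) 1 := by
    simp only [expMonomial, MvPowerSeries.X_pow_eq]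
    rw [MvPowerSeries.prod_monomial, Finset.prod_const_one]
    have : ∑ i, Finsupp.single i (ν i) = Finsupp.equivFunOnFinite.symm ν := by
      ext i
      rw [Finsupp.finsetSum_apply]
      simp [Finsupp.single_apply]
    rw [this]
  rw [h1, MvPowerSeries.coeff_monomial]
  congr 1
  rw [eq_iff_iff, Equiv.eq_symm_apply, eq_comm]
  rfl

theorem finEval_h (d k : ℕ) :
    finEval d (h k) = ∑ ν ∈ Finset.piAntidiag Finset.univ k, expMonomial ν := by
  ext m
  rw [finEval_apply, MvPowerSeries.coeff_killCompl, coeff_h, degree_embDomain, map_sum]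
  simp only [coeff_expMonomial]
  rw [Finset.sum_ite_eq']
  simp [Finset.mem_piAntidiag, Finsupp.degree_eq_sum]

theorem finEval_e (d k : ℕ) :
    finEval d (e k) =
      ∑ ν ∈ (Finset.piAntidiag Finset.univ k).filter (fun ν : Fin d → ℕ => ∀ i, ν i ≤ 1),
        expMonomial ν := by
  classical
  ext m
  have hall : (∀ i, m.embDomain (Fin.valEmbedding (n := d)) i ≤ 1) ↔ ∀ i, m i ≤ 1 := by
    refine ⟨fun hm i => ?_, fun hm i => ?_⟩
    · have := hm (Fin.valEmbedding i)
      rwa [Finsupp.embDomain_apply_self] at this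
    · by_cases hi : i ∈ Set.range (Fin.valEmbedding (n := d))
      · obtain ⟨j, rfl⟩ := hi
        rw [Finsupp.embDomain_apply_self]
        exact hm j
      · rw [Finsupp.embDomain_of_notMem_range _ _ _ hi]
        exact Nat.zero_le _
  rw [finEval_apply, MvPowerSeries.coeff_killCompl, coeff_e, degree_embDomain, map_sum]
  simp only [coeff_expMonomial, hall]
  rw [Finset.sum_ite_eq']
  simp [Finset.mem_piAntidiag, Finsupp.degree_eq_sum]

theorem coeff_powerSum (k : ℕ) (m : ℕ →₀ ℕ) [Decidable (∃ i, m = Finsupp.single i k)] :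
    MvPowerSeries.coeff m (powerSum k : MvPowerSeries ℕ ℂ) =
      if ∃ i, m = Finsupp.single i k then 1 else 0 := by
  have : MvPowerSeries.coeff m (powerSum k : MvPowerSeries ℕ ℂ) =
      @ite _ (∃ i, m = Finsupp.single i k) (Classical.propDecidable _) 1 0 := rfl
  rw [this]
  congr

theorem finEval_powerSum (d : ℕ) {k : ℕ} (hk : 0 < k) :
    finEval d (powerSum k) = ∑ i, MvPowerSeries.X i ^ k := by
  classical
  ext m
  rw [finEval_apply, MvPowerSeries.coeff_killCompl, coeff_powerSum, map_sum]
  simp only [MvPowerSeries.coeff_X_pow]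
  by_cases hm : ∃ i, m = Finsupp.single i k
  · obtain ⟨i, rfl⟩ := hm
    rw [if_pos ⟨Fin.valEmbedding i, Finsupp.embDomain_single _ _ _⟩, Finset.sum_eq_single i]
    · simp
    · intro j _ hj
      rw [if_neg fun hij => hj ?_]
      exact ((Finsupp.single_left_inj hk.ne').1 hij).symm
    · simp
  · rw [if_neg, Finset.sum_eq_zero]
    · intro i _
      exact if_neg fun hi => hm ⟨i, hi⟩
    · rintro ⟨i, hi⟩
      have hid : i < d := by
        by_contra hid
        have h1 := Finsupp.embDomain_of_notMem_range (Fin.valEmbedding (n := d)) m i (by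
          rintro ⟨j, rfl⟩
          exact hid j.2)
        rw [hi, Finsupp.single_eq_same] at h1
        exact hk.ne' h1
      refine hm ⟨⟨i, hid⟩, Finsupp.embDomain_injective (Fin.valEmbedding (n := d)) ?_⟩
      rw [hi, Finsupp.embDomain_single]
      rfl

/-! ### Cycle types and colorings -/

open Classical in
/-- The parts of the cycle type of `π` are the sizes of its orbits. -/
theorem parts_partition_eq_map_orbits {α : Type*} [Fintype α] [DecidableEq α] (π : Equiv.Perm α) :
    π.partition.parts = (Finset.univ : Finset (Quotient (Equiv.Perm.SameCycle.setoid π))).val.map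
      fun ω => (Finset.univ.filter fun j => Quotient.mk _ j = ω).card := by
  set Ω := Quotient (Equiv.Perm.SameCycle.setoid π)
  have hmk : ∀ i j : α, (Quotient.mk (Equiv.Perm.SameCycle.setoid π) i : Ω) =
      Quotient.mk (Equiv.Perm.SameCycle.setoid π) j ↔ π.SameCycle i j := fun i j => Quotient.eq
  have hout : ∀ ω : Ω, Quotient.mk (Equiv.Perm.SameCycle.setoid π) ω.out = ω := Quotient.out_eq
  have hcard : ∀ ω : Ω, (Finset.univ.filter fun j => Quotient.mk _ j = ω) =
      Finset.univ.filter fun j => π.SameCycle ω.out j := by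
    intro ω
    refine Finset.filter_congr fun j _ => ?_
    conv_lhs => rw [← hout ω]
    rw [hmk, Equiv.Perm.sameCycle_comm]
  have hfix : ∀ ω : Ω, ω.out ∉ π.support → ∀ j, π.SameCycle ω.out j → j = ω.out := by
    rintro ω hω j ⟨z, rfl⟩
    exact Equiv.Perm.zpow_apply_eq_self_of_apply_eq_self (Equiv.Perm.notMem_support.1 hω) z
  -- Orbits with a moved representative correspond to the cycle factors; the remaining ones are
  -- fixed points and give the parts 1.
  rw [Equiv.Perm.parts_partition, Equiv.Perm.cycleType_def,
    ← Multiset.filter_add_not (fun ω : Ω => ω.out ∈ π.support) Finset.univ.val, Multiset.map_add]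
  congr 1
  · symm
    refine Multiset.map_eq_map_of_bij_of_nodup _ _ (Finset.univ.nodup.filter _)
      π.cycleFactorsFinset.nodup (fun ω _ => π.cycleOf ω.out) ?_ ?_ ?_ ?_
    · intro ω hω
      exact Equiv.Perm.cycleOf_mem_cycleFactorsFinset_iff.2 (Multiset.mem_filter.1 hω).2
    · intro ω hω ω' hω' heq
      have h1 : ω.out ∈ (π.cycleOf ω'.out).support := by
        rw [← heq, Equiv.Perm.mem_support_cycleOf_iff]
        exact ⟨Equiv.Perm.SameCycle.refl _ _, (Multiset.mem_filter.1 hω).2⟩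
      rw [Equiv.Perm.mem_support_cycleOf_iff] at h1
      rw [← hout ω, ← hout ω', hmk]
      exact h1.1.symm
    · intro c hc
      have hc' := Equiv.Perm.mem_cycleFactorsFinset_iff.1 hc
      obtain ⟨x, hx⟩ := hc'.1.nonempty_support
      have hxs : x ∈ π.support := by
        rw [Equiv.Perm.mem_support, ← hc'.2 x hx]
        exact Equiv.Perm.mem_support.1 hx
      have hsame : π.SameCycle (Quotient.mk (Equiv.Perm.SameCycle.setoid π) x).out x :=
        (hmk _ _).1 (hout _)
      refine ⟨Quotient.mk _ x, Multiset.mem_filter.2 ⟨Finset.mem_univ _, ?_⟩, ?_⟩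
      · rw [Equiv.Perm.mem_support] at hxs ⊢
        exact fun h => hxs (hsame.apply_eq_self_iff.1 h)
      · rw [hsame.cycleOf_eq]
        exact (Equiv.Perm.cycle_is_cycleOf hx hc).symm
    · intro ω hω
      rw [hcard, Function.comp_apply]
      congr 1
      ext j
      rw [Equiv.Perm.mem_support_cycleOf_iff, Finset.mem_filter]
      simp [(Multiset.mem_filter.1 hω).2]
  · symm
    rw [Multiset.eq_replicate]
    constructor
    · rw [Multiset.card_map, ← Finset.card_compl]
      refine Finset.card_bij (s := Finset.univ.filter fun ω : Ω => ω.out ∉ π.support)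
        (fun ω _ => ω.out) ?_ ?_ ?_
      · intro ω hω
        rw [Finset.mem_compl]
        exact (Finset.mem_filter.1 hω).2
      · intro ω _ ω' _ heq
        rw [← hout ω, ← hout ω', heq]
      · intro x hx
        rw [Finset.mem_compl] at hx
        have hsame : π.SameCycle (Quotient.mk (Equiv.Perm.SameCycle.setoid π) x).out x :=
          (hmk _ _).1 (hout _)
        have hxo : (Quotient.mk (Equiv.Perm.SameCycle.setoid π) x).out ∉ π.support := by
          rw [Equiv.Perm.notMem_support] at hx ⊢
          exact hsame.apply_eq_self_iff.2 hx
        exact ⟨Quotient.mk _ x, Finset.mem_filter.2 ⟨Finset.mem_univ _, hxo⟩,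
          (hfix _ hxo x hsame).symm⟩
    · intro m hm
      obtain ⟨ω, hω, rfl⟩ := Multiset.mem_map.1 hm
      rw [hcard, Finset.card_eq_one]
      refine ⟨ω.out, Finset.ext fun j => ?_⟩
      rw [Finset.mem_filter, Finset.mem_singleton]
      refine ⟨fun h => hfix ω (Multiset.mem_filter.1 hω).2 j h.2, ?_⟩
      rintro rfl
      exact ⟨Finset.mem_univ _, Equiv.Perm.SameCycle.refl _ _⟩

/-- Expanding the product of the sums `∑ x_i ^ |ω|` over the orbits `ω` chooses one color per orbit,
that is, a coloring invariant under `π`. -/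
theorem finEval_prod_parts {n : ℕ} (d : ℕ) (π : Equiv.Perm (Fin n)) :
    finEval d (π.partition.parts.map powerSum).prod =
      ∑ c : Fin n → Fin d with c ∘ π = c, ∏ j, MvPowerSeries.X (c j) := by
  classical
  rw [parts_partition_eq_map_orbits, Multiset.map_map, ← Finset.prod_eq_multiset_prod, map_prod]
  set Ω := Quotient (Equiv.Perm.SameCycle.setoid π)
  let mk : Fin n → Ω := Quotient.mk _
  have hpos : ∀ ω : Ω, 0 < (Finset.univ.filter fun j => mk j = ω).card := by
    intro ω
    rw [Finset.card_pos, Finset.filter_nonempty_iff]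
    exact ⟨ω.out, Finset.mem_univ _, Quotient.out_eq ω⟩
  have h1 : ∀ ω ∈ (Finset.univ : Finset Ω),
      finEval d ((powerSum ∘ fun ω => (Finset.univ.filter fun j => mk j = ω).card) ω) =
        ∑ i ∈ (Finset.univ : Finset (Fin d)),
          MvPowerSeries.X i ^ (Finset.univ.filter fun j => mk j = ω).card := fun ω _ =>
    finEval_powerSum d (hpos ω)
  rw [Finset.prod_congr rfl h1, Finset.prod_univ_sum, Fintype.piFinset_univ]
  refine Finset.sum_bij (fun g _ => g ∘ mk) ?_ ?_ ?_ ?_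
  · intro g _
    rw [Finset.mem_filter]
    refine ⟨Finset.mem_univ _, funext fun j => congrArg g (Quotient.sound ?_)⟩
    exact Equiv.Perm.sameCycle_apply_left.2 (Equiv.Perm.SameCycle.refl _ _)
  · intro g _ g' _ hgg
    funext ω
    have := congrFun hgg ω.out
    simp only [Function.comp_apply, mk, Ω, Quotient.out_eq] at this
    exact this
  · intro c hc
    rw [Finset.mem_filter] at hc
    have hzpow : ∀ (z : ℤ) (j : Fin n), c ((π ^ z) j) = c j := by
      intro z
      induction z using Int.induction_on with
      | zero => simp
      | succ k ih =>
        intro j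
        rw [zpow_add_one, Equiv.Perm.mul_apply, ih]
        exact congrFun hc.2 j
      | pred k ih =>
        intro j
        rw [zpow_sub_one, Equiv.Perm.mul_apply, ih]
        have := congrFun hc.2 (π⁻¹ j)
        rw [Function.comp_apply, show π (π⁻¹ j) = j from π.apply_symm_apply j] at this
        exact this.symm
    refine ⟨Quotient.lift c ?_, Finset.mem_univ _, rfl⟩
    rintro a b ⟨z, rfl⟩
    exact (hzpow z a).symm
  · intro g _
    rw [← Finset.prod_fiberwise (s := Finset.univ) (g := mk)]
    refine Finset.prod_congr rfl fun ω _ => ?_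
    rw [← Finset.prod_const]
    refine Finset.prod_congr rfl fun j hj => ?_
    rw [Finset.mem_filter] at hj
    rw [Function.comp_apply, hj.2]

/-! ### Signs on stabilizers -/

/-- The pair `(a, b)` is inverted; the transposition acts on the other pairs as an involution that
matches up the inverted ones. -/
theorem wedgeSign_swap {n : ℕ} (I : Finset (Fin n)) {a b : Fin n} (ha : a ∈ I) (hb : b ∈ I)
    (hab : a < b) : wedgeSign (Equiv.swap a b) I = -1 := by
  classical
  set π := Equiv.swap a b with hπ
  have hI : ∀ x ∈ I, π x ∈ I := by
    intro x hx
    rw [hπ, Equiv.swap_apply_def]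
    split_ifs <;> assumption
  have hinv : ∀ x, π (π x) = x := fun x => Equiv.swap_apply_self a b x
  have hmem : (a, b) ∈ (I ×ˢ I).filter fun x => x.1 < x.2 := by simp [ha, hb, hab]
  rw [wedgeSign, ← Finset.mul_prod_erase _ _ hmem]
  have h1 : π a = b := Equiv.swap_apply_left a b
  have h2 : π b = a := Equiv.swap_apply_right a b
  simp only [h1, h2, if_neg hab.not_gt]
  rw [Finset.prod_involution (fun x _ => if π x.1 < π x.2 then (π x.1, π x.2) else (π x.2, π x.1))]
  · ring
  · rintro ⟨x, y⟩ hx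
    simp only [Finset.mem_erase, Finset.mem_filter, Finset.mem_product] at hx
    by_cases hlt : π x < π y
    · simp [hlt, hinv, hx.2.2]
    · simp [hlt, hinv, hx.2.2.not_gt]
  · rintro ⟨x, y⟩ hx hne heq
    simp only [Finset.mem_erase, Finset.mem_filter, Finset.mem_product] at hx
    by_cases hlt : π x < π y
    · simp [hlt] at hne
    · simp only [hlt, if_false, Prod.mk.injEq] at heq
      have hxy : x ≠ y := hx.2.2.ne
      have hx1 : x = a ∨ x = b := by
        by_contra hcon
        push Not at hcon
        have := Equiv.swap_apply_of_ne_of_ne hcon.1 hcon.2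
        rw [← hπ, heq.2] at this
        exact hxy this.symm
      rcases hx1 with rfl | rfl
      · rw [h1] at heq
        exact hx.1 (by rw [heq.2])
      · rw [h2] at heq
        exact absurd (heq.2 ▸ hx.2.2) hab.not_gt
  · rintro ⟨x, y⟩ hx
    simp only [Finset.mem_erase, Finset.mem_filter, Finset.mem_product, Ne] at hx ⊢
    have hne : π x ≠ π y := fun h => hx.2.2.ne (π.injective h)
    by_cases hlt : π x < π y
    · simp only [hlt, if_true]
      refine ⟨fun heq => ?_, ⟨hI x hx.2.1.1, hI y hx.2.1.2⟩, trivial⟩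
      rw [Prod.mk.injEq] at heq
      have e1 : x = b := by rw [← hinv x, heq.1, h1]
      have e2 : y = a := by rw [← hinv y, heq.2, h2]
      rw [e1, e2] at hx
      exact hx.2.2.not_gt hab
    · simp only [hlt, if_false]
      refine ⟨fun heq => ?_, ⟨hI y hx.2.1.2, hI x hx.2.1.1⟩, lt_of_le_of_ne (not_lt.1 hlt) hne.symm⟩
      rw [Prod.mk.injEq] at heq
      have e1 : y = b := by rw [← hinv y, heq.1, h1]
      have e2 : x = a := by rw [← hinv x, heq.2, h2]
      rw [e1, e2] at hx
      exact hx.1 rfl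
  · rintro ⟨x, y⟩ hx
    simp only [Finset.mem_erase, Finset.mem_filter, Finset.mem_product] at hx
    by_cases hlt : π x < π y
    · simp [hlt, hinv, hx.2.2]
    · simp [hlt, hinv, hx.2.2.not_gt]

section Stabilizers

variable {n : ℕ} {C : Type*} [DecidableEq C]

/-- The permutations preserving a tuple. -/
def tupleStabilizer (f : Fin n → C) : Finset (Equiv.Perm (Fin n)) :=
  Finset.univ.filter fun π => f ∘ π = f

theorem mem_tupleStabilizer {f : Fin n → C} {π : Equiv.Perm (Fin n)} :
    π ∈ tupleStabilizer f ↔ f ∘ π = f := by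
  simp [tupleStabilizer]

/-- The signs of the stabilizer of `f` on a subset of values cancel unless every value of this
subset is taken at most once. -/
theorem sum_wedgeSign_tupleStabilizer (f : Fin n → C) (S : C → Prop) [DecidablePred S]
    [Decidable (∀ c, S c → fiberCard f c ≤ 1)] :
    ∑ π ∈ tupleStabilizer f, wedgeSign π (Finset.univ.filter fun i => S (f i)) =
      if ∀ c, S c → fiberCard f c ≤ 1 then ((tupleStabilizer f).card : ℤ) else 0 := by
  classical
  set I := Finset.univ.filter fun i => S (f i) with hI
  have hmemI : ∀ i, i ∈ I ↔ S (f i) := fun i => by simp [hI]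
  split_ifs with hS
  · rw [Finset.card_eq_sum_ones, Nat.cast_sum]
    refine Finset.sum_congr rfl fun π hπ => ?_
    rw [mem_tupleStabilizer] at hπ
    -- Values in `S` are not repeated, so the stabilizer fixes `I` pointwise and all signs are 1.
    have hfix : ∀ i ∈ I, π i = i := by
      intro i hi
      have h1 := hS (f i) ((hmemI i).1 hi)
      rw [fiberCard, Finset.card_le_one] at h1
      exact h1 _ (by simpa using congrFun hπ i) _ (by simp)
    rw [wedgeSign, Nat.cast_one]
    refine Finset.prod_eq_one fun x hx => if_pos ?_
    rw [Finset.mem_filter, Finset.mem_product] at hx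
    rw [hfix _ hx.1.1, hfix _ hx.1.2]
    exact hx.2
  · push Not at hS
    obtain ⟨c, hc, hlt⟩ := hS
    rw [fiberCard, Finset.one_lt_card] at hlt
    obtain ⟨a, ha, b, hb, hab⟩ := hlt
    rw [Finset.mem_filter] at ha hb
    have hsgn : wedgeSign (Equiv.swap a b) I = -1 := by
      have haI : a ∈ I := (hmemI a).2 (ha.2.symm ▸ hc)
      have hbI : b ∈ I := (hmemI b).2 (hb.2.symm ▸ hc)
      rcases lt_or_gt_of_ne hab with h | h
      · exact wedgeSign_swap I haI hbI h
      · rw [Equiv.swap_comm]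
        exact wedgeSign_swap I hbI haI h
    have hswap : f ∘ Equiv.swap a b = f := by
      funext i
      simp only [Function.comp_apply, Equiv.swap_apply_def]
      split_ifs with h1 h2
      · rw [h1, ha.2, hb.2]
      · rw [h2, ha.2, hb.2]
      · rfl
    have himage : I.image (Equiv.swap a b) = I := by
      ext i
      rw [Finset.mem_image]
      constructor
      · rintro ⟨j, hj, rfl⟩
        rw [hmemI] at hj ⊢
        rwa [show f (Equiv.swap a b j) = f j from congrFun hswap j]
      · intro hi
        refine ⟨Equiv.swap a b i, ?_, Equiv.swap_apply_self a b i⟩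
        rw [hmemI] at hi ⊢
        rwa [show f (Equiv.swap a b i) = f i from congrFun hswap i]
    -- Right multiplication by a transposition of two equal values in `S` preserves the stabilizer
    -- and reverses every sign.
    have hneg : ∑ π ∈ tupleStabilizer f, wedgeSign π I =
        ∑ π ∈ tupleStabilizer f, -wedgeSign π I := by
      refine Finset.sum_bij' (fun π _ => π * Equiv.swap a b) (fun π _ => π * Equiv.swap a b)
        ?_ ?_ ?_ ?_ ?_
      · intro π hπ
        rw [mem_tupleStabilizer] at hπ ⊢
        rw [Equiv.Perm.coe_mul, ← Function.comp_assoc, hπ, hswap]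
      · intro π hπ
        rw [mem_tupleStabilizer] at hπ ⊢
        rw [Equiv.Perm.coe_mul, ← Function.comp_assoc, hπ, hswap]
      · intro π _
        rw [mul_assoc, Equiv.swap_mul_self, mul_one]
      · intro π _
        rw [mul_assoc, Equiv.swap_mul_self, mul_one]
      · intro π _
        rw [wedgeSign_mul, himage, hsgn]
        ring
    rw [Finset.sum_neg_distrib] at hneg
    omega

/-- The orbit-stabilizer count for tuples with given fiber sizes. -/
theorem sum_card_tupleStabilizer [Fintype C] (μ : C → ℕ) (hμ : ∑ c, μ c = n) :
    ∑ f : Fin n → C with fiberCard f = μ, (tupleStabilizer f).card = n.factorial := by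
  classical
  obtain ⟨f₀, hf₀⟩ := exists_fiberCard_eq μ hμ
  -- The `ρ f` are coset representatives: `(f, π) ↦ ρ f * π` is a bijection onto the symmetric
  -- group.
  have hex : ∀ f : Fin n → C, ∃ ρ : Equiv.Perm (Fin n), fiberCard f = μ → f = f₀ ∘ ρ := by
    intro f
    by_cases hf : fiberCard f = μ
    · obtain ⟨ρ, hρ⟩ := exists_perm_of_fiberCard_eq (hf.trans hf₀.symm)
      exact ⟨ρ, fun _ => hρ⟩
    · exact ⟨1, fun h => absurd h hf⟩
  choose ρ hρ using hex
  have hcard : n.factorial = (Finset.univ : Finset (Equiv.Perm (Fin n))).card := by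
    rw [Finset.card_univ, Fintype.card_perm, Fintype.card_fin]
  rw [hcard, ← Finset.card_sigma]
  refine Finset.card_bij' (fun x _ => ρ x.1 * x.2) (fun g _ => ⟨f₀ ∘ g, (ρ (f₀ ∘ g))⁻¹ * g⟩)
    ?_ ?_ ?_ ?_
  · intro x _
    exact Finset.mem_univ _
  · intro g _
    have hfib : fiberCard (f₀ ∘ g) = μ := (fiberCard_comp f₀ g).trans hf₀
    rw [Finset.mem_sigma, Finset.mem_filter, mem_tupleStabilizer]
    refine ⟨⟨Finset.mem_univ _, hfib⟩, ?_⟩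
    have h1 := hρ _ hfib
    funext i
    refine (congrFun h1 _).trans ?_
    simp
  · rintro ⟨f, π⟩ hx
    rw [Finset.mem_sigma, Finset.mem_filter, mem_tupleStabilizer] at hx
    have h1 : f₀ ∘ ⇑(ρ f * π) = f := by
      rw [Equiv.Perm.coe_mul, ← Function.comp_assoc, ← hρ f hx.1.2, hx.2]
    simp only [Sigma.mk.injEq, h1, true_and]
    simp
  · intro g _
    simp

/-- Summing over tuples with weights given by stabilizers is summing over fiber sizes. -/
theorem sum_tupleStabilizer_mul [Fintype C] {R : Type*} [CommSemiring R] (G : (C → ℕ) → R) :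
    ∑ f : Fin n → C, ((tupleStabilizer f).card : R) * G (fiberCard f) =
      n.factorial * ∑ μ ∈ Finset.piAntidiag Finset.univ n, G μ := by
  classical
  rw [← Finset.sum_fiberwise_of_maps_to (s := Finset.univ) (g := fun f : Fin n → C => fiberCard f)
    (t := Finset.piAntidiag Finset.univ n) (fun f _ => by
      rw [Finset.mem_piAntidiag]
      exact ⟨sum_fiberCard f, by simp⟩), Finset.mul_sum]
  refine Finset.sum_congr rfl fun μ hμ => ?_
  rw [← sum_card_tupleStabilizer μ (Finset.mem_piAntidiag.1 hμ).1, Nat.cast_sum, Finset.sum_mul]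
  refine Finset.sum_congr rfl fun f hf => ?_
  rw [(Finset.mem_filter.1 hf).2]

end Stabilizers

/-! ### Expansion of the `P_k` into colored multisets -/

/-- The sum of all `h_i e_j` with `i + j = a` is `2 P_a`, and for `a > 0` the alternating sum
vanishes, so the terms with `j` even and those with `j` odd each add up to `P_a`. -/
theorem P_eq_sum_antidiagonal {a : ℕ} (ha : 0 < a) (u : ℤˣ) :
    P a = ∑ x ∈ Finset.HasAntidiagonal.antidiagonal a with (-1 : ℤˣ) ^ x.2 = u, h x.1 * e x.2 := by
  classical
  have h1 : ∑ x ∈ Finset.HasAntidiagonal.antidiagonal a,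
      h x.1 * (if Odd x.2 then -e x.2 else e x.2) = 0 := by
    have h0 := congrArg (PowerSeries.coeff a) rescale_e_mul_h
    rw [mul_comm, PowerSeries.coeff_mul, PowerSeries.coeff_one, if_neg ha.ne'] at h0
    simpa only [coeff_rescale_neg_one, PowerSeries.coeff_mk] using h0
  have h2 := two_smul_P a
  rw [PowerSeries.coeff_mul] at h2
  simp only [PowerSeries.coeff_mk] at h2
  have h3 : (2 : ℂ) • ∑ x ∈ Finset.HasAntidiagonal.antidiagonal a with (-1 : ℤˣ) ^ x.2 = u, h x.1 * e x.2 =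
      (2 : ℂ) • P a := by
    rw [two_smul, h2, Finset.sum_filter]
    rcases Int.units_eq_one_or u with rfl | rfl
    · refine Eq.trans ?_ ((congrArg ((∑ x ∈ Finset.HasAntidiagonal.antidiagonal a, h x.1 * e x.2) + ·) h1).trans (add_zero _))
      rw [← Finset.sum_add_distrib, ← Finset.sum_add_distrib]
      refine Finset.sum_congr rfl fun x _ => ?_
      by_cases ho : Odd x.2
      · rw [if_neg (by rw [ho.neg_one_pow]; decide), if_pos ho]
        ring
      · rw [if_pos (Nat.not_odd_iff_even.1 ho).neg_one_pow, if_neg ho]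
    · refine Eq.trans ?_ ((congrArg ((∑ x ∈ Finset.HasAntidiagonal.antidiagonal a, h x.1 * e x.2) - ·) h1).trans (sub_zero _))
      rw [← Finset.sum_add_distrib, ← Finset.sum_sub_distrib]
      refine Finset.sum_congr rfl fun x _ => ?_
      by_cases ho : Odd x.2
      · rw [if_pos ho.neg_one_pow, if_pos ho]
        ring
      · rw [if_neg (by rw [(Nat.not_odd_iff_even.1 ho).neg_one_pow]; decide), if_neg ho]
        ring
  exact (smul_right_injective SymFun (two_ne_zero : (2 : ℂ) ≠ 0) h3).symm

theorem sum_units_prod {M : Type*} [AddCommMonoid M] {d : ℕ} (f : ℤˣ × Fin d → M) :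
    ∑ b, f b = ∑ i, f (1, i) + ∑ i, f (-1, i) := by
  rw [Fintype.sum_prod_type, UnitsInt.univ, Finset.sum_pair (by decide)]

theorem prod_units_prod {M : Type*} [CommMonoid M] {d : ℕ} (f : ℤˣ × Fin d → M) :
    ∏ b, f b = (∏ i, f (1, i)) * ∏ i, f (-1, i) := by
  rw [Fintype.prod_prod_type, UnitsInt.univ, Finset.prod_pair (by decide)]

/-- Multiplicities of signed colors, of total `a` and total sign `u`, in which every color with
sign `-1` occurs at most once. -/
def signedColorings (d a : ℕ) (u : ℤˣ) : Finset (ℤˣ × Fin d → ℕ) :=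
  (Finset.piAntidiag Finset.univ a).filter fun ν =>
    (∀ i, ν (-1, i) ≤ 1) ∧ ∏ b, b.1 ^ ν b = u

theorem mem_signedColorings {d a : ℕ} {u : ℤˣ} {ν : ℤˣ × Fin d → ℕ} :
    ν ∈ signedColorings d a u ↔
      ∑ b, ν b = a ∧ (∀ i, ν (-1, i) ≤ 1) ∧ ∏ b, b.1 ^ ν b = u := by
  simp [signedColorings, Finset.mem_piAntidiag]

theorem prod_sign_pow {d : ℕ} (ν : ℤˣ × Fin d → ℕ) :
    ∏ b, b.1 ^ ν b = (-1 : ℤˣ) ^ ∑ i, ν (-1, i) := by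
  rw [prod_units_prod]
  simp [Finset.prod_pow_eq_pow_sum]

/-- Colors of sign `1` may repeat and come from `h_i`; those of sign `-1` are distinct and come from
`e_j`. Prescribing the total sign `u` selects one of the two halves in `P_eq_sum_antidiagonal`. -/
theorem finEval_P (d : ℕ) {a : ℕ} (ha : 0 < a) (u : ℤˣ) :
    finEval d (P a) = ∑ ν ∈ signedColorings d a u, ∏ b, MvPowerSeries.X b.2 ^ ν b := by
  classical
  rw [P_eq_sum_antidiagonal ha u, map_sum]
  simp only [map_mul, finEval_h, finEval_e, Finset.sum_mul_sum]
  simp only [← Finset.sum_product', Finset.sum_sigma']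
  refine Finset.sum_bij'
    (fun x _ => fun b => if b.1 = 1 then x.2.1 b.2 else x.2.2 b.2)
    (fun ν _ => ⟨(∑ i, ν (1, i), ∑ i, ν (-1, i)), (fun i => ν (1, i), fun i => ν (-1, i))⟩)
    ?_ ?_ ?_ ?_ ?_
  · rintro ⟨⟨k, l⟩, ν₁, ν₂⟩ hx
    simp only [Finset.mem_sigma, Finset.mem_filter, Finset.HasAntidiagonal.mem_antidiagonal, Finset.mem_product,
      Finset.mem_piAntidiag] at hx
    obtain ⟨⟨hkl, hu⟩, ⟨h1, -⟩, ⟨h2, -⟩, h3⟩ := hx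
    rw [mem_signedColorings, sum_units_prod, prod_sign_pow]
    have hne : (-1 : ℤˣ) ≠ 1 := by decide
    simp only [if_true, if_neg hne]
    exact ⟨by rw [h1, h2, hkl], h3, by rw [h2, hu]⟩
  · intro ν hν
    rw [mem_signedColorings, sum_units_prod, prod_sign_pow] at hν
    simp only [Finset.mem_sigma, Finset.mem_filter, Finset.HasAntidiagonal.mem_antidiagonal, Finset.mem_product,
      Finset.mem_piAntidiag]
    exact ⟨⟨hν.1, hν.2.2⟩, ⟨trivial, by simp⟩, ⟨trivial, by simp⟩, hν.2.1⟩
  · rintro ⟨⟨k, l⟩, ν₁, ν₂⟩ hx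
    simp only [Finset.mem_sigma, Finset.mem_filter, Finset.HasAntidiagonal.mem_antidiagonal, Finset.mem_product,
      Finset.mem_piAntidiag] at hx
    obtain ⟨⟨hkl, hu⟩, ⟨h1, -⟩, ⟨h2, -⟩, h3⟩ := hx
    have hne : (-1 : ℤˣ) ≠ 1 := by decide
    simp only [if_true, if_neg hne]
    change Finset.univ.sum ν₁ = k at h1
    change Finset.univ.sum ν₂ = l at h2
    subst h1 h2
    rfl
  · intro ν _
    funext b
    obtain ⟨u, i⟩ := b
    rcases Int.units_eq_one_or u with rfl | rfl
    · simp
    · have hne : (-1 : ℤˣ) ≠ 1 := by decide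
      simp [hne]
  · rintro ⟨⟨k, l⟩, ν₁, ν₂⟩ _
    rw [prod_units_prod]
    have hne : (-1 : ℤˣ) ≠ 1 := by decide
    simp only [if_true, if_neg hne, expMonomial]

/-- Absent values need this separate case: `P 0` is one half, whereas an absent value must
contribute 1. -/
theorem signedColorings_zero (d : ℕ) : signedColorings d 0 1 = {0} := by
  ext ν
  rw [mem_signedColorings, Finset.mem_singleton]
  constructor
  · rintro ⟨h, -⟩
    funext b
    exact (Finset.sum_eq_zero_iff.1 h) b (Finset.mem_univ _)
  · rintro rfl
    simp

/-! ### The character of the representation on odd shifted parking functions -/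

theorem character_oddRep {n : ℕ} [DecidableEq (OShPf n)] (π : Equiv.Perm (Fin n)) :
    (oddRep n).character π =
      ∑ x : OShPf n, if x.act π = x then (wedgeSign π (negSet x.σ) : ℂ) else 0 := by
  classical
  rw [Representation.character, LinearMap.trace_eq_matrix_trace ℂ Finsupp.basisSingleOne,
    Matrix.trace]
  refine Finset.sum_congr rfl fun x _ => ?_
  rw [Matrix.diag_apply, LinearMap.toMatrix_apply, Finsupp.coe_basisSingleOne]
  have h1 : oddRep n π (Finsupp.single x 1) =
      Finsupp.single (x.act π) (wedgeSign π (negSet x.σ) : ℂ) := by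
    change Finsupp.linearCombination ℂ _ (Finsupp.single x 1) = _
    rw [Finsupp.linearCombination_single, one_smul]
  rw [h1]
  exact Finsupp.single_apply

theorem comp_inv_eq_iff {n : ℕ} {C : Type*} (f : Fin n → C) (π : Equiv.Perm (Fin n)) :
    f ∘ ⇑(π⁻¹) = f ↔ f ∘ π = f := by
  constructor
  · intro hf
    conv_lhs => rw [← hf]
    funext i
    simp
  · intro hf
    conv_lhs => rw [← hf]
    funext i
    simp

theorem prod_comp_eq_prod_fiberCard {n : ℕ} {C M : Type*} [Fintype C] [DecidableEq C]
    [CommMonoid M] (f : Fin n → C) (φ : C → M) : ∏ j, φ (f j) = ∏ c, φ c ^ fiberCard f c := by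
  rw [← Finset.prod_fiberwise (s := Finset.univ) (g := f)]
  refine Finset.prod_congr rfl fun c _ => ?_
  rw [fiberCard, ← Finset.prod_const]
  refine Finset.prod_congr rfl fun j hj => ?_
  rw [(Finset.mem_filter.1 hj).2]

section FrobeniusCharacter

variable {n d : ℕ}

/-- The tuple of triples (entry, sign, color). -/
def coloredTuple (p : Fin n → Fin n) (σ : Fin n → ℤˣ) (c : Fin n → Fin d) (i : Fin n) :
    Fin n × ℤˣ × Fin d := (p i, σ i, c i)

theorem content_eq_sum_fiberCard (p : Fin n → Fin n) (σ : Fin n → ℤˣ) (c : Fin n → Fin d)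
    (k : Fin n) : content p k = ∑ b, fiberCard (coloredTuple p σ c) (k, b) := by
  rw [content, Finset.card_eq_sum_card_fiberwise (f := fun i => (σ i, c i)) (t := Finset.univ)
    (fun _ _ => Finset.mem_coe.2 (Finset.mem_univ _))]
  refine Finset.sum_congr rfl fun b _ => ?_
  rw [fiberCard, Finset.filter_filter]
  congr 1
  refine Finset.filter_congr fun i _ => ?_
  rw [coloredTuple, Prod.mk.injEq (p i)]

theorem fiberSign_eq_prod_fiberCard (p : Fin n → Fin n) (σ : Fin n → ℤˣ) (c : Fin n → Fin d)
    (k : Fin n) : fiberSign p σ k = ∏ b, b.1 ^ fiberCard (coloredTuple p σ c) (k, b) := by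
  rw [fiberSign, ← Finset.prod_fiberwise (g := fun i => (σ i, c i))]
  refine Finset.prod_congr rfl fun b _ => ?_
  rw [fiberCard, ← Finset.prod_const, Finset.filter_filter]
  refine Finset.prod_congr ?_ fun i hi => ?_
  · refine Finset.filter_congr fun i _ => ?_
    rw [coloredTuple, Prod.mk.injEq (p i)]
  · rw [← (Prod.mk.inj (Finset.mem_filter.1 hi).2).2]

/-- The condition on the multiplicities of a colored tuple to underlie an odd shifted parking
function with matching `τ`. -/
def IsOddMultiplicity (μ : Fin n × ℤˣ × Fin d → ℕ) (τ : Finset (Fin n × Fin n)) : Prop :=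
  IsOddPattern (fun k => ∑ b, μ (k, b)) (fun k => ∏ b, b.1 ^ μ (k, b)) τ

theorem isOddMultiplicity_fiberCard (p : Fin n → Fin n) (σ : Fin n → ℤˣ) (c : Fin n → Fin d)
    (τ : Finset (Fin n × Fin n)) :
    IsOddMultiplicity (fiberCard (coloredTuple p σ c)) τ ↔
      IsOddPattern (content p) (fiberSign p σ) τ := by
  have h1 : content p = fun k => ∑ b, fiberCard (coloredTuple p σ c) (k, b) :=
    funext fun k => content_eq_sum_fiberCard p σ c k
  have h2 : fiberSign p σ = fun k => ∏ b, b.1 ^ fiberCard (coloredTuple p σ c) (k, b) :=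
    funext fun k => fiberSign_eq_prod_fiberCard p σ c k
  rw [h1, h2, IsOddMultiplicity]

open Classical in
/-- The contribution of a family of multiplicities. -/
noncomputable def multiplicityTerm (τ : Finset (Fin n × Fin n)) (μ : Fin n × ℤˣ × Fin d → ℕ) :
    MvPowerSeries (Fin d) ℂ :=
  if IsOddMultiplicity μ τ then
    if ∀ x : Fin n × ℤˣ × Fin d, x.2.1 = -1 → μ x ≤ 1 then ∏ x, MvPowerSeries.X x.2.2 ^ μ x else 0
  else 0

theorem act_eq_iff (π : Equiv.Perm (Fin n)) (x : OShPf n) (c : Fin n → Fin d) :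
    (x.act π = x ∧ c ∘ π = c) ↔ coloredTuple x.p x.σ c ∘ π = coloredTuple x.p x.σ c := by
  have h1 : x.act π = x ↔ x.p ∘ π = x.p ∧ x.σ ∘ π = x.σ := by
    rw [OShPf.ext_iff, ← comp_inv_eq_iff x.p, ← comp_inv_eq_iff x.σ]
    simp [OShPf.act]
  rw [h1]
  simp only [funext_iff, Function.comp_apply, coloredTuple, Prod.mk.injEq, forall_and, and_assoc]

/-- Whether a tuple of triples comes from an odd shifted parking function with matching `τ` depends
only on its multiplicities. This makes orbit counting possible for each fixed `τ`. -/
theorem sum_oShPf_coloredTuple {M : Type*} [AddCommMonoid M]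
    (Φ : (Fin n → Fin n × ℤˣ × Fin d) → M)
    [∀ (μ : Fin n × ℤˣ × Fin d → ℕ) (τ : Finset (Fin n × Fin n)), Decidable (IsOddMultiplicity μ τ)] :
    ∑ x : OShPf n, ∑ c : Fin n → Fin d, Φ (coloredTuple x.p x.σ c) =
      ∑ τ : Finset (Fin n × Fin n), ∑ f, if IsOddMultiplicity (fiberCard f) τ then Φ f else 0 := by
  classical
  rw [← Fintype.sum_prod_type', ← Fintype.sum_prod_type', ← Finset.sum_filter]
  refine Finset.sum_bij' (fun y _ => (y.1.τ, coloredTuple y.1.p y.1.σ y.2))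
    (fun z hz => (OShPf.ofPattern (fun i => (z.2 i).1) (fun i => (z.2 i).2.1) z.1
      ((isOddMultiplicity_fiberCard _ _ (fun i => (z.2 i).2.2) _).1 (Finset.mem_filter.1 hz).2),
      fun i => (z.2 i).2.2)) ?_ ?_ ?_ ?_ ?_
  · intro y _
    rw [Finset.mem_filter, isOddMultiplicity_fiberCard]
    exact ⟨Finset.mem_univ _, y.1.isOddPattern⟩
  · intro z _
    exact Finset.mem_univ _
  · intro y _
    rfl
  · intro z _
    rfl
  · intro y _
    rfl

theorem sum_act_eq (x : OShPf n) (c : Fin n → Fin d) [DecidableEq (OShPf n)]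
    [Decidable (∀ y : Fin n × ℤˣ × Fin d, y.2.1 = -1 → fiberCard (coloredTuple x.p x.σ c) y ≤ 1)] :
    ∑ π : Equiv.Perm (Fin n), (if x.act π = x ∧ c ∘ π = c then wedgeSign π (negSet x.σ) else 0) =
      if ∀ y : Fin n × ℤˣ × Fin d, y.2.1 = -1 → fiberCard (coloredTuple x.p x.σ c) y ≤ 1 then
        ((tupleStabilizer (coloredTuple x.p x.σ c)).card : ℤ) else 0 := by
  rw [← sum_wedgeSign_tupleStabilizer (coloredTuple x.p x.σ c) fun y => y.2.1 = -1,
    ← Finset.sum_filter]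
  refine Finset.sum_congr ?_ fun π _ => rfl
  ext π
  rw [Finset.mem_filter, mem_tupleStabilizer, act_eq_iff]
  simp

/-- Signed Burnside count: exchange the sum over `π` with the sum over basis elements and colorings,
evaluate the stabilizer sums, and cancel `n!` against the orbit count. -/
theorem finEval_frobeniusChar_oddRep (n d : ℕ) :
    finEval d (frobeniusChar (oddRep n)) =
      ∑ τ : Finset (Fin n × Fin n), ∑ μ ∈ Finset.piAntidiag Finset.univ n,
        multiplicityTerm (d := d) τ μ := by
  classical
  have hfac : (n.factorial : ℂ) ≠ 0 := Nat.cast_ne_zero.2 n.factorial_ne_zero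
  rw [frobeniusChar, map_smul, map_sum, inv_smul_eq_iff₀ hfac]
  have e1 : ∀ π : Equiv.Perm (Fin n),
      finEval d ((oddRep n).character π • (π.partition.parts.map powerSum).prod) =
        ∑ x : OShPf n, ∑ c : Fin n → Fin d,
          ((if x.act π = x ∧ c ∘ π = c then wedgeSign π (negSet x.σ) else 0 : ℤ) :
            MvPowerSeries (Fin d) ℂ) * ∏ j, MvPowerSeries.X (c j) := by
    intro π
    rw [map_smul, finEval_prod_parts, character_oddRep, Finset.sum_smul]
    refine Finset.sum_congr rfl fun x _ => ?_
    rw [Finset.sum_filter, Finset.smul_sum]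
    refine Finset.sum_congr rfl fun c _ => ?_
    by_cases h1 : x.act π = x <;> by_cases h2 : c ∘ π = c
    · rw [if_pos h1, if_pos h2, if_pos ⟨h1, h2⟩, Int.cast_smul_eq_zsmul, zsmul_eq_mul]
    · simp [h2]
    · simp [h1]
    · simp [h1]
  rw [Finset.sum_congr rfl fun π _ => e1 π, Finset.sum_comm]
  -- The order of the stabilizer times a function of the multiplicities, the form required by
  -- `sum_tupleStabilizer_mul`.
  obtain ⟨Φ, hΦ⟩ : ∃ Φ : (Fin n → Fin n × ℤˣ × Fin d) → MvPowerSeries (Fin d) ℂ, ∀ f, Φ f =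
      ((tupleStabilizer f).card : MvPowerSeries (Fin d) ℂ) *
        if ∀ y : Fin n × ℤˣ × Fin d, y.2.1 = -1 → fiberCard f y ≤ 1 then
          ∏ y, MvPowerSeries.X y.2.2 ^ fiberCard f y else 0 := ⟨_, fun _ => rfl⟩
  have e2 : ∀ x : OShPf n, ∑ π : Equiv.Perm (Fin n), ∑ c : Fin n → Fin d,
      ((if x.act π = x ∧ c ∘ π = c then wedgeSign π (negSet x.σ) else 0 : ℤ) :
        MvPowerSeries (Fin d) ℂ) * ∏ j, MvPowerSeries.X (c j) =
      ∑ c : Fin n → Fin d, Φ (coloredTuple x.p x.σ c) := by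
    intro x
    rw [Finset.sum_comm]
    refine Finset.sum_congr rfl fun c _ => ?_
    rw [← Finset.sum_mul, ← Int.cast_sum, sum_act_eq, hΦ]
    have e3 : ∏ j, MvPowerSeries.X (c j) = ∏ y : Fin n × ℤˣ × Fin d,
        (MvPowerSeries.X y.2.2 : MvPowerSeries (Fin d) ℂ) ^
          fiberCard (coloredTuple x.p x.σ c) y :=
      prod_comp_eq_prod_fiberCard (coloredTuple x.p x.σ c) fun y => MvPowerSeries.X y.2.2
    rw [e3]
    by_cases hg : ∀ y : Fin n × ℤˣ × Fin d, y.2.1 = -1 → fiberCard (coloredTuple x.p x.σ c) y ≤ 1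
    · rw [if_pos hg, if_pos hg, Int.cast_natCast]
    · rw [if_neg hg, if_neg hg, Int.cast_zero, zero_mul, mul_zero]
  rw [Finset.sum_congr rfl fun x _ => e2 x, sum_oShPf_coloredTuple Φ, Finset.smul_sum]
  refine Finset.sum_congr rfl fun τ _ => ?_
  rw [Nat.cast_smul_eq_nsmul, nsmul_eq_mul, ← sum_tupleStabilizer_mul]
  refine Finset.sum_congr rfl fun f _ => ?_
  rw [multiplicityTerm, mul_ite, mul_zero, hΦ]

theorem finEval_sum_oddPatterns (n d : ℕ) :
    finEval d (∑ t ∈ oddPatterns n, ∏ k, (if 0 < t.1 k then P (t.1 k) else 1)) =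
      ∑ τ : Finset (Fin n × Fin n), ∑ μ ∈ Finset.piAntidiag Finset.univ n,
        multiplicityTerm (d := d) τ μ := by
  classical
  -- Each `P` is expanded with `u` equal to the sign of the pattern at `k`. Contents and signs can
  -- then be read off from the multiplicities, so summing over patterns leaves only `τ` and `μ`.
  have e1 : ∀ t ∈ oddPatterns n,
      finEval d (∏ k, (if 0 < t.1 k then P (t.1 k) else 1)) =
        ∑ ν ∈ Fintype.piFinset fun k => signedColorings d (t.1 k) (t.2.1 k),
          ∏ k, ∏ b, MvPowerSeries.X b.2 ^ ν k b := by
    intro t ht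
    rw [mem_oddPatterns] at ht
    rw [map_prod]
    refine Eq.trans ?_ (Finset.prod_univ_sum (fun k => signedColorings d (t.1 k) (t.2.1 k))
      fun _ ν => ∏ b, MvPowerSeries.X b.2 ^ ν b)
    refine Finset.prod_congr rfl fun k _ => ?_
    split_ifs with hk
    · exact finEval_P d hk _
    · rw [ht.pattern.sign k fun h => hk h.2, Nat.eq_zero_of_not_pos hk, signedColorings_zero]
      simp
  rw [map_sum, Finset.sum_congr rfl e1, Finset.sum_sigma', ← Finset.sum_product']
  simp only [multiplicityTerm, ← ite_and]
  rw [← Finset.sum_filter]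
  refine Finset.sum_bij' (fun y _ => (y.1.2.2, fun x => y.2 x.1 x.2))
    (fun z _ => ⟨(fun k => ∑ b, z.2 (k, b), fun k => ∏ b, b.1 ^ z.2 (k, b), z.1),
      fun k b => z.2 (k, b)⟩) ?_ ?_ ?_ ?_ ?_
  · rintro ⟨⟨α, s, τ⟩, ν⟩ hy
    simp only [Finset.mem_sigma, mem_oddPatterns, Fintype.mem_piFinset, mem_signedColorings] at hy
    have hα : (fun k => ∑ b, ν k b) = α := funext fun k => (hy.2 k).1
    have hs : (fun k => ∏ b, b.1 ^ ν k b) = s := funext fun k => (hy.2 k).2.2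
    simp only [Finset.mem_filter, Finset.mem_product, Finset.mem_univ, true_and,
      Finset.mem_piAntidiag, implies_true, and_true]
    simp only [IsOddMultiplicity]
    have h0 := ((isForestWord_ofFn_iff 1 α).1 hy.1.forest).2
    refine ⟨?_, ?_, ?_⟩
    · rw [Fintype.sum_prod_type, Finset.sum_congr rfl fun k _ => (hy.2 k).1]
      exact Nat.add_left_cancel (h0.trans (add_comm n 1))
    · rw [hα, hs]
      exact hy.1
    · rintro ⟨k, u, i⟩ hu
      simp only at hu
      rw [hu]
      exact (hy.2 k).2.1 i
  · rintro ⟨τ, μ⟩ hz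
    simp only [Finset.mem_filter, Finset.mem_product] at hz
    simp only [IsOddMultiplicity] at hz
    simp only [Finset.mem_sigma, mem_oddPatterns, Fintype.mem_piFinset, mem_signedColorings]
    exact ⟨hz.2.1, fun k => ⟨trivial, fun i => hz.2.2 (k, -1, i) rfl, trivial⟩⟩
  · rintro ⟨⟨α, s, τ⟩, ν⟩ hy
    simp only [Finset.mem_sigma, mem_oddPatterns, Fintype.mem_piFinset, mem_signedColorings] at hy
    have hα : (fun k => ∑ b, ν k b) = α := funext fun k => (hy.2 k).1
    have hs : (fun k => ∏ b, b.1 ^ ν k b) = s := funext fun k => (hy.2 k).2.2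
    simp only [hα, hs]
  · rintro ⟨τ, μ⟩ _
    rfl
  · rintro ⟨⟨α, s, τ⟩, ν⟩ _
    rw [Fintype.prod_prod_type]

end FrobeniusCharacter

theorem frobeniusChar_oddRep (n : ℕ) :
    frobeniusChar (oddRep n) =
      ∑ t ∈ oddPatterns n, ∏ k, (if 0 < t.1 k then P (t.1 k) else 1) :=
  ext_of_finEval fun d => by rw [finEval_frobeniusChar_oddRep, finEval_sum_oddPatterns]

end ShiftedParking

/-- The Frobenius character of the `S_n`-module `ℂ[OShPf(n)]` is `SH_n = sh(PF_n)`, and `SH_n` is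
the sum of `V_{shape(p)}` over the sorted odd shifted parking functions `(p, σ̄, τ)`, all of whose
shapes are odd. -/
theorem theorem1p2 (n : ℕ) :
    ShiftedParking.frobeniusChar (ShiftedParking.oddRep n) = ShiftedParking.SH n ∧
    ShiftedParking.SH n =
      ∑ x ∈ ShiftedParking.sortedOShPf n, ShiftedParking.V (ShiftedParking.shape x.1) ∧
    ∀ x ∈ ShiftedParking.sortedOShPf n,
      ShiftedParking.IsOddPartition (ShiftedParking.shape x.1) :=
  ⟨(ShiftedParking.frobeniusChar_oddRep n).trans (ShiftedParking.sum_oddPatterns n),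
    ((ShiftedParking.sum_sortedOShPf n).trans (ShiftedParking.sum_oddPatterns n)).symm,
    fun _ hx => ShiftedParking.isOddPartition_of_mem_sortedOShPf hx⟩
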